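/- Let $(\mathcal Y,\mathcal A)$ be a measurable space, $\mathcal P(\mathcal A)$ the set of probability measures on it, $\mathcal X$ a set, $W:\mathcal X\to\mathcal P(\mathcal A)$ an arbitrary function (a channel), and $P$ a probability mass function on $\mathcal X$ with finite support. For $\alpha>0$ let $D_\alpha(\cdot\|\cdot)$ be the order $\alpha$ Rényi divergence in nats (for $\alpha=1$ the Kullback–Leibler divergence), and for channels $V,U:\mathcal X\to\mathcal P(\mathcal A)$ let $D_\alpha(V\|U|P)=\sum_x P(x)D_\alpha(V(x)\|U(x))$, where only the $x$ with $P(x)>0$ contribute; a measure $Q\in\mathcal P(\mathcal A)$ in place of $U$ stands for the constant channel $Q$. Let $$I_\alpha(P;V)=\inf_{Q\in\mathcal P(\mathcal A)}D_\alpha(V\|Q|P)$$ be the Augustin information, $I_{0+}(P;W)=\lim_{\alpha\downarrow0}I_\alpha(P;W)$, and $q_{\alpha,P}$ the Augustin mean, i.e. the probability measure that attains the infimum defining $I_\alpha(P;W)$. For $\alpha>0$ and $Q\in\mathcal P(\mathcal A)$ let $W_\alpha^{Q}$ be the tilted channel $$\frac{dW_\alpha^{Q}(x)}{d\nu}=e^{(1-\alpha)D_\alpha(W(x)\|Q)}\Big(\frac{dW(x)}{d\nu}\Big)^{\alpha}\Big(\frac{dQ}{d\nu}\Big)^{1-\alpha}\qquad\text{whenever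 } D_\alpha(W(x)\|Q)<\infty,$$ where $\nu$ is any measure dominating $W(x)$ and $Q$. Finally let $$E_{sp}(R,W,P)=\sup_{\alpha\in(0,1)}\tfrac{1-\alpha}{\alpha}\big(I_\alpha(P;W)-R\big)$$ be the sphere packing exponent. Suppose that $I_{0+}(P;W)\neq I_1(P;W)$. Then for each $\alpha\in(0,1]$ the Augustin mean $q_{\alpha,P}$ exists and is unique, the limit defining $I_{0+}(P;W)$ exists, $0\le I_{0+}(P;W)<I_1(P;W)<\infty$, and the following hold. 1. For every $R\in(I_{0+}(P;W),I_1(P;W)]$ there is a unique $\alpha_R\in(0,1]$ with $R=I_1\big(P;W_{\alpha_R}^{q_{\alpha_R,P}}\big)$. The map $R\mapsto\alpha_R$ is a strictly increasing continuous bijection from $(I_{0+}(P;W),I_1(P;W)]$ onto $(0,1]$. 2. $E_{sp}(R,W,P)$ is finite for every $R>I_{0+}(P;W)$, and for every $R\in(I_{0+}(P;W),I_1(P;W)]$ $$E_{sp}(R,W,P)=D_1\big(W_{\alpha_R}^{q_{\alpha_R,P}}\big\|W\big|P\big),\qquad \frac{\partial}{\partial R}E_{sp}(R,W,P)=\frac{\alpha_R-1}{\alpha_R}.$$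 Thus $E_{sp}(R,W,P)$ is finite, convex, continuously differentiable and strictly decreasing in $R$ on $(I_{0+}(P;W),I_1(P;W)]$. 3. With values in $[0,\infty]$, $$E_{sp}\big(I_{0+}(P;W),W,P\big)=\lim_{\alpha\downarrow0}D_1\big(W_\alpha^{q_{\alpha,P}}\big\|W\big|P\big).$$ 4. If $E_{sp}(I_{0+}(P;W),W,P)$ is finite, then there is a channel $V:\mathcal X\to\mathcal P(\mathcal A)$ with $I_1(P;V)=I_{0+}(P;W)$ and $D_1(V\|W|P)=E_{sp}(I_{0+}(P;W),W,P)$. -/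

import Mathlib

open MeasureTheory Filter Topology Set
open scoped ENNReal

noncomputable section

namespace SpherePacking

universe u v

variable {X : Type u} {Y : Type v} [MeasurableSpace Y]

/-! Probability measures on the output space `Y` are terms of `ProbabilityMeasure Y`, channels are
arbitrary functions `X → ProbabilityMeasure Y`, and finitely supported probability mass functions
on the input set `X` are terms of `Convexity.StdSimplex ℝ X`. -/

/-- The function `(dW/dν)^α (dQ/dν)^(1-α)` for the reference measure `ν = W + Q`, which dominates
both `W` and `Q`. -/
def tiltDensity (α : ℝ) (W Q : ProbabilityMeasure Y) (y : Y) : ℝ≥0∞ :=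
  ((W : Measure Y).rnDeriv ((W : Measure Y) + (Q : Measure Y)) y) ^ α *
    ((Q : Measure Y).rnDeriv ((W : Measure Y) + (Q : Measure Y)) y) ^ (1 - α)

/-- The integral `∫ (dW/dν)^α (dQ/dν)^(1-α) dν` for `ν = W + Q`. -/
def tiltMass (α : ℝ) (W Q : ProbabilityMeasure Y) : ℝ≥0∞ :=
  ∫⁻ y, tiltDensity α W Q y ∂((W : Measure Y) + (Q : Measure Y))

/-- The order `α` Rényi divergence between probability measures, in nats, with values in the
extended reals. At order one it is the Kullback-Leibler divergence. -/
def renyiDiv (α : ℝ) (W Q : ProbabilityMeasure Y) : EReal :=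
  if α = 1 then ((InformationTheory.klDiv (W : Measure Y) (Q : Measure Y) : ℝ≥0∞) : EReal)
  else (((α - 1)⁻¹ : ℝ) : EReal) * ENNReal.log (tiltMass α W Q)

/-- The measure with density `exp ((1-α) D_α(W‖Q)) (dW/dν)^α (dQ/dν)^(1-α)` with respect to
`ν = W + Q`. -/
def tiltedRaw (α : ℝ) (W Q : ProbabilityMeasure Y) : Measure Y :=
  ((W : Measure Y) + (Q : Measure Y)).withDensity
    (fun y => EReal.exp (((1 - α : ℝ) : EReal) * renyiDiv α W Q) * tiltDensity α W Q y)

theorem measurable_tiltDensity (α : ℝ) (W Q : ProbabilityMeasure Y) :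
    Measurable (tiltDensity α W Q) := by
  unfold tiltDensity
  exact ((Measure.measurable_rnDeriv _ _).pow_const _).mul
    ((Measure.measurable_rnDeriv _ _).pow_const _)

theorem lintegral_left (W Q : ProbabilityMeasure Y) :
    ∫⁻ y, (W : Measure Y).rnDeriv ((W : Measure Y) + (Q : Measure Y)) y
      ∂((W : Measure Y) + (Q : Measure Y)) = 1 := by
  rw [Measure.lintegral_rnDeriv (Measure.AbsolutelyContinuous.rfl.add_right _)]
  exact measure_univ

theorem lintegral_right (W Q : ProbabilityMeasure Y) :
    ∫⁻ y, (Q : Measure Y).rnDeriv ((W : Measure Y) + (Q : Measure Y)) y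
      ∂((W : Measure Y) + (Q : Measure Y)) = 1 := by
  rw [Measure.lintegral_rnDeriv]
  · exact measure_univ
  · rw [add_comm]
    exact Measure.AbsolutelyContinuous.rfl.add_right _

theorem rpow_mul_rpow_le {α : ℝ} (h0 : 0 < α) (h1 : α < 1) (a b : ℝ≥0∞) :
    a ^ α * b ^ (1 - α) ≤ a + b := by
  have hmax : max a b ≤ a + b := max_le le_self_add le_add_self
  calc a ^ α * b ^ (1 - α) ≤ (a + b) ^ α * (a + b) ^ (1 - α) :=
        mul_le_mul' (ENNReal.rpow_le_rpow le_self_add h0.le)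
          (ENNReal.rpow_le_rpow le_add_self (by linarith))
    _ = a + b := by
        rw [← ENNReal.rpow_add_of_nonneg _ _ h0.le (by linarith)]
        simp

theorem tiltMass_ne {α : ℝ} {W Q : ProbabilityMeasure Y} (h0 : 0 < α) (h1 : α ≠ 1)
    (h : renyiDiv α W Q ≠ ⊤) : tiltMass α W Q ≠ 0 ∧ tiltMass α W Q ≠ ∞ := by
  rw [renyiDiv, if_neg h1] at h
  rcases lt_or_gt_of_ne h1 with h2 | h2
  · constructor
    · intro hz
      rw [hz, ENNReal.log_zero, EReal.coe_mul_bot_of_neg (inv_lt_zero.2 (by linarith))] at h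
      exact h rfl
    · have hle : tiltMass α W Q ≤ 1 + 1 := by
        conv_rhs => rw [← lintegral_left W Q]
        conv_rhs => rhs; rw [lintegral_left W Q, ← lintegral_right W Q]
        rw [← lintegral_add_left (Measure.measurable_rnDeriv _ _)]
        exact lintegral_mono fun y => rpow_mul_rpow_le h0 h2 _ _
      exact ne_top_of_le_ne_top (by simp) hle
  · constructor
    · intro hz
      rw [tiltMass, lintegral_eq_zero_iff (measurable_tiltDensity α W Q)] at hz
      have hw : (W : Measure Y).rnDeriv ((W : Measure Y) + (Q : Measure Y))
          =ᵐ[(W : Measure Y) + (Q : Measure Y)] 0 := by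
        filter_upwards [hz, Measure.rnDeriv_lt_top (Q : Measure Y)
          ((W : Measure Y) + (Q : Measure Y))] with y hy hq
        rcases mul_eq_zero.1 hy with h3 | h3
        · rcases ENNReal.rpow_eq_zero_iff.1 h3 with h4 | h4
          · exact h4.1
          · linarith [h4.2]
        · rcases ENNReal.rpow_eq_zero_iff.1 h3 with h4 | h4
          · linarith [h4.2]
          · exact absurd h4.1 hq.ne
      have := lintegral_left W Q
      rw [lintegral_congr_ae hw] at this
      simp at this
    · intro hz
      rw [hz, ENNReal.log_top, EReal.coe_mul_top_of_pos (inv_pos.2 (by linarith))] at h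
      exact h rfl

/-- The normalization in the definition of the tilted measure is the right one, at every positive
order at which the Rényi divergence is finite. -/
theorem isProbabilityMeasure_tiltedRaw {α : ℝ} {W Q : ProbabilityMeasure Y} (h0 : 0 < α)
    (h : renyiDiv α W Q ≠ ⊤) : IsProbabilityMeasure (tiltedRaw α W Q) := by
  constructor
  rw [tiltedRaw, withDensity_apply _ MeasurableSet.univ, Measure.restrict_univ,
    lintegral_const_mul _ (measurable_tiltDensity α W Q)]
  by_cases h1 : α = 1
  · subst h1
    have hm : ∫⁻ y, tiltDensity 1 W Q y ∂((W : Measure Y) + (Q : Measure Y)) = 1 := by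
      rw [← lintegral_left W Q]
      simp [tiltDensity]
    rw [hm]
    simp
  · obtain ⟨hz, ht⟩ := tiltMass_ne h0 h1 h
    have hα : (1 - α) * (α - 1)⁻¹ = -1 := by
      have : α - 1 ≠ 0 := sub_ne_zero.2 h1
      field_simp
      ring
    rw [renyiDiv, if_neg h1, ← mul_assoc, ← EReal.coe_mul, hα]
    change _ * tiltMass α W Q = 1
    have : ((-1 : ℝ) : EReal) * ENNReal.log (tiltMass α W Q)
        = ENNReal.log (tiltMass α W Q)⁻¹ := by
      rw [ENNReal.log_inv]
      simp
    rw [this, ENNReal.exp_log]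
    exact ENNReal.inv_mul_cancel hz ht

/-- The order `α` tilted probability measure, given a proof that its defining conditions hold. -/
def tiltedOfFinite (α : ℝ) (W Q : ProbabilityMeasure Y) (h : 0 < α ∧ renyiDiv α W Q ≠ ⊤) :
    ProbabilityMeasure Y :=
  ⟨tiltedRaw α W Q, isProbabilityMeasure_tiltedRaw h.1 h.2⟩

open Classical in
/-- The order `α` tilted probability measure `W_α^Q`, defined for `α > 0` when `D_α(W‖Q)` is
finite; outside this domain the value `W` is a placeholder. -/
def tiltedMeasure (α : ℝ) (W Q : ProbabilityMeasure Y) : ProbabilityMeasure Y :=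
  if h : 0 < α ∧ renyiDiv α W Q ≠ ⊤ then tiltedOfFinite α W Q h else W

/-- The order `α` tilted channel `W_α^Q` for a channel `W` and a probability measure `Q`. -/
def tiltedChannel (α : ℝ) (W : X → ProbabilityMeasure Y) (Q : ProbabilityMeasure Y) :
    X → ProbabilityMeasure Y :=
  fun x => tiltedMeasure α (W x) Q

/-- The order `α` conditional Rényi divergence `D_α(W‖Q|P) = ∑ₓ P(x) D_α(W(x)‖Q(x))` of two
channels. Only the support of `P` contributes. -/
def condRenyiDiv (α : ℝ) (W Q : X → ProbabilityMeasure Y) (P : Convexity.StdSimplex ℝ X) :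
    EReal :=
  ∑ x ∈ P.weights.support, ((P.weights x : ℝ) : EReal) * renyiDiv α (W x) (Q x)

/-- The order `α` Augustin information `I_α(P;W) = inf_Q D_α(W‖Q|P)`. -/
def augustinInfo (α : ℝ) (P : Convexity.StdSimplex ℝ X) (W : X → ProbabilityMeasure Y) : EReal :=
  ⨅ Q : ProbabilityMeasure Y, condRenyiDiv α W (fun _ => Q) P

/-- `I_{0+}(P;W)`, the limit of `I_α(P;W)` as `α` decreases to `0`. -/
def augustinInfoZero (P : Convexity.StdSimplex ℝ X) (W : X → ProbabilityMeasure Y) : EReal :=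
  limUnder (𝓝[>] (0 : ℝ)) (fun α => augustinInfo α P W)

/-- `Q` attains the infimum that defines the order `α` Augustin information. -/
def IsAugustinMean (α : ℝ) (P : Convexity.StdSimplex ℝ X) (W : X → ProbabilityMeasure Y)
    (Q : ProbabilityMeasure Y) : Prop :=
  condRenyiDiv α W (fun _ => Q) P = augustinInfo α P W

theorem nonempty_probabilityMeasure (P : Convexity.StdSimplex ℝ X)
    (W : X → ProbabilityMeasure Y) : Nonempty (ProbabilityMeasure Y) :=
  P.support_weights_nonempty.elim fun x _ => ⟨W x⟩

/-- The order `α` Augustin mean `q_{α,P}`: the probability measure that attains the infimum. -/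
def augustinMean (α : ℝ) (P : Convexity.StdSimplex ℝ X) (W : X → ProbabilityMeasure Y) :
    ProbabilityMeasure Y :=
  @Classical.epsilon _ (nonempty_probabilityMeasure P W) (IsAugustinMean α P W)

/-- The order `α` Augustin capacity of `W` for the constraint set `A`. -/
def augustinCapacity (α : ℝ) (W : X → ProbabilityMeasure Y)
    (A : Set (Convexity.StdSimplex ℝ X)) : EReal :=
  ⨆ P ∈ A, augustinInfo α P W

/-- The sphere packing exponent at rate `R` for the constraint set `A`. -/
def spherePackingExponent (R : ℝ) (W : X → ProbabilityMeasure Y)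
    (A : Set (Convexity.StdSimplex ℝ X)) : EReal :=
  ⨆ α ∈ Ioo (0 : ℝ) 1, (((1 - α) / α : ℝ) : EReal) * (augustinCapacity α W A - (R : EReal))

end SpherePacking

end

/-! Write `a(V) = D₁(V‖W|P)` and `b(V) = I₁(P;V)` for a channel `V`. Everything follows from the
minimization of the trade-off `α a(V) + (1-α) b(V)` over all channels.

*Duality.* For `α ∈ (0,1)` and measures `w`, `q` with `D_α(w‖q) < ∞` one has
`α D(v‖w) + (1-α) D(v‖q) = D(v‖w_α^q) + (1-α) D_α(w‖q)` for every `v` (`exists_variational`). Since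
`b(V)` is the minimum of `D₁(V‖Q|P)` over `Q`, attained at the output distribution of `V`, it
follows that the minimum of the trade-off is `(1-α) I_α(P;W)`, that a minimizer `V_α` is the channel
`W` tilted towards its own output distribution, and that this distribution is the Augustin mean
(`IsTradeoffMin.augustinMean_eq`, `IsTradeoffMin.tiltedChannel_eq`).

*Existence.* The compensation identity makes the trade-off strongly convex: the midpoint of two
nearly optimal channels improves on them by their divergences from the midpoint. So a minimizing
sequence is Cauchy in Hellinger distance, the densities converge along a subsequence, and Fatou's
lemma shows that the limit is a minimizer (`exists_isTradeoffMin`). The same convexity gives the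
growth bound `IsTradeoffMin.add_condKL_le`, hence uniqueness of the minimizer and continuity of
`f α = b(V_α)` and `g α = a(V_α)`.

*Strictness.* `f` is monotone. If it took the same value at two orders, the two minimizers would
coincide, the variational identity at both orders would identify the minimizer with `W`, and `W`
would minimize `b` among all channels at finite divergence from `W`; then `I_{0+}(P;W) = I₁(P;W)`
(`injOn_infoCurve`). So `f` is a strictly increasing homeomorphism of `(0,1]` onto the interval of
rates, and `α_R` is its inverse.

*The exponent.* By duality, `E_sp(R)` is the supremum over `α` of the lines
`g α + (1-α)/α (f α - R)`, and these support the curve `(f, g)` from below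
(`spherePackingExponent_eq`). So the line of order `α_R` is the largest one at `R`, and a function
with a continuous choice of supporting slopes is continuously differentiable
(`hasDerivAt_of_support`). At the left end point the supremum is the limit of `g`, and if it is
finite then the `V_α` themselves are Cauchy as `α` decreases to `0`, which gives the limit channel
(`exists_limit_channel`). -/

open InformationTheory (klDiv)

/-! ### The pointwise relative entropy -/

/-- The integrand `v log (v / w) - v + w` of the Kullback-Leibler divergence of two measures with
nonnegative densities `v` and `w` with respect to a common reference measure. It is nonnegative;
at `w = 0` it takes its lower semicontinuous value, which is `0` for `v = 0` and `∞` otherwise. -/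
noncomputable def klDensity (v w : ℝ) : ℝ≥0∞ :=
  if w = 0 then (if v = 0 then 0 else ⊤) else ENNReal.ofReal (v * Real.log (v / w) - v + w)

theorem measurable_klDensity {Y : Type*} [MeasurableSpace Y] {v w : Y → ℝ} (hv : Measurable v)
    (hw : Measurable w) : Measurable fun y => klDensity (v y) (w y) := by
  unfold klDensity
  refine Measurable.ite (hw (measurableSet_singleton 0)) ?_ ?_
  · exact Measurable.ite (hv (measurableSet_singleton 0)) measurable_const measurable_const
  · fun_prop

theorem klDensity_zero_left (w : ℝ) : klDensity 0 w = ENNReal.ofReal w := by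
  by_cases h : w = 0 <;> simp [klDensity, h]

theorem klDensity_zero_right {v : ℝ} (hv : v ≠ 0) : klDensity v 0 = ⊤ := by simp [klDensity, hv]

theorem klDensity_of_ne {v w : ℝ} (hw : w ≠ 0) :
    klDensity v w = ENNReal.ofReal (v * Real.log (v / w) - v + w) := by simp [klDensity, hw]

theorem tangent_le_mul_log {v w s : ℝ} (hv : 0 ≤ v) (hw : 0 < w) (hs : 0 < s) :
    v * Real.log s + w * (1 - s) ≤ v * Real.log (v / w) - v + w := by
  rcases hv.eq_or_lt with rfl | hv
  · simp only [zero_mul, zero_add, sub_zero]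
    nlinarith
  · have h := Real.log_le_sub_one_of_pos (x := s * w / v) (by positivity)
    rw [Real.log_div (by positivity) hv.ne', Real.log_mul hs.ne' hw.ne'] at h
    rw [Real.log_div hv.ne' hw.ne']
    have h2 := mul_le_mul_of_nonneg_left h hv.le
    have h3 : v * (s * w / v - 1) = s * w - v := by field_simp
    rw [h3] at h2
    nlinarith

theorem mul_log_sub_add_nonneg {v w : ℝ} (hv : 0 ≤ v) (hw : 0 < w) :
    0 ≤ v * Real.log (v / w) - v + w := by
  simpa using tangent_le_mul_log hv hw one_pos

/-- Each slope `s` gives a linear minorant of `klDensity`. -/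
theorem ofReal_tangent_le_klDensity {v w s : ℝ} (hv : 0 ≤ v) (hw : 0 ≤ w) (hs : 0 < s) :
    ENNReal.ofReal (v * Real.log s + w * (1 - s)) ≤ klDensity v w := by
  rcases hw.eq_or_lt with rfl | hw
  · rcases hv.eq_or_lt with rfl | hv
    · simp
    · simp [klDensity_zero_right hv.ne']
  · rw [klDensity_of_ne hw.ne']
    exact ENNReal.ofReal_le_ofReal (tangent_le_mul_log hv hw hs)

/-- `klDensity` is the upper envelope of its linear minorants; convexity and lower semicontinuity
follow from this. -/
theorem klDensity_le_of_tangent_le {v w : ℝ} (hv : 0 ≤ v) (hw : 0 ≤ w) {c : ℝ≥0∞}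
    (h : ∀ s : ℝ, 0 < s → ENNReal.ofReal (v * Real.log s + w * (1 - s)) ≤ c) :
    klDensity v w ≤ c := by
  rcases hv.eq_or_lt with rfl | hv
  · rw [klDensity_zero_left]
    have ht : Tendsto (fun s : ℝ => ENNReal.ofReal (w * (1 - s))) (𝓝[>] 0)
        (𝓝 (ENNReal.ofReal w)) := by
      have : Tendsto (fun s : ℝ => ENNReal.ofReal (w * (1 - s))) (𝓝 0)
          (𝓝 (ENNReal.ofReal (w * (1 - 0)))) := by
        exact (ENNReal.continuous_ofReal.comp (by fun_prop)).tendsto _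
      simpa using this.mono_left nhdsWithin_le_nhds
    refine le_of_tendsto ht ?_
    filter_upwards [self_mem_nhdsWithin] with s hs
    simpa using h s hs
  · rcases hw.eq_or_lt with rfl | hw
    · have : c = ⊤ := by
        refine ENNReal.eq_top_of_forall_nnreal_le fun r => ?_
        have := h (Real.exp (r / v)) (Real.exp_pos _)
        rw [Real.log_exp, zero_mul, add_zero, mul_div_cancel₀ _ hv.ne',
          ENNReal.ofReal_coe_nnreal] at this
        exact this
      simp [this]
    · rw [klDensity_of_ne hw.ne']
      refine le_of_eq_of_le ?_ (h (v / w) (by positivity))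
      congr 1
      field_simp
      ring

theorem klDensity_le_liminf {v w : ℕ → ℝ} {v' w' : ℝ} (hv : ∀ n, 0 ≤ v n) (hw : ∀ n, 0 ≤ w n)
    (hvt : Tendsto v atTop (𝓝 v')) (hwt : Tendsto w atTop (𝓝 w')) :
    klDensity v' w' ≤ liminf (fun n => klDensity (v n) (w n)) atTop := by
  refine klDensity_le_of_tangent_le (ge_of_tendsto' hvt hv) (ge_of_tendsto' hwt hw)
    fun s hs => ?_
  have ht : Tendsto (fun n => ENNReal.ofReal (v n * Real.log s + w n * (1 - s))) atTop
      (𝓝 (ENNReal.ofReal (v' * Real.log s + w' * (1 - s)))) :=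
    (ENNReal.continuous_ofReal.tendsto _).comp
      ((hvt.mul_const _).add (hwt.mul_const _))
  rw [← ht.liminf_eq]
  exact liminf_le_liminf
    (Eventually.of_forall fun n => ofReal_tangent_le_klDensity (hv n) (hw n) hs)

theorem sum_klDensity_le {X : Type*} (s : Finset X) {p v w : X → ℝ} (hp : ∀ x ∈ s, 0 ≤ p x)
    (hv : ∀ x ∈ s, 0 ≤ v x) (hw : ∀ x ∈ s, 0 ≤ w x) :
    klDensity (∑ x ∈ s, p x * v x) (∑ x ∈ s, p x * w x) ≤
      ∑ x ∈ s, ENNReal.ofReal (p x) * klDensity (v x) (w x) := by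
  refine klDensity_le_of_tangent_le (Finset.sum_nonneg fun x hx => mul_nonneg (hp x hx) (hv x hx))
    (Finset.sum_nonneg fun x hx => mul_nonneg (hp x hx) (hw x hx)) fun t ht => ?_
  have : (∑ x ∈ s, p x * v x) * Real.log t + (∑ x ∈ s, p x * w x) * (1 - t)
      = ∑ x ∈ s, p x * (v x * Real.log t + w x * (1 - t)) := by
    rw [Finset.sum_mul, Finset.sum_mul, ← Finset.sum_add_distrib]
    exact Finset.sum_congr rfl fun x _ => by ring
  rw [this]
  calc ENNReal.ofReal (∑ x ∈ s, p x * (v x * Real.log t + w x * (1 - t)))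
      ≤ ∑ x ∈ s, ENNReal.ofReal (p x * (v x * Real.log t + w x * (1 - t))) := by
        refine Finset.le_sum_of_subadditive _ ENNReal.ofReal_zero.le
          (fun a b => ENNReal.ofReal_add_le) _ _
    _ ≤ _ := Finset.sum_le_sum fun x hx => by
        rw [ENNReal.ofReal_mul (hp x hx)]
        gcongr
        exact ofReal_tangent_le_klDensity (hv x hx) (hw x hx) ht

/-- The pointwise form of the compensation identity. -/
theorem sum_klDensity_eq {X : Type*} (s : Finset X) {p v : X → ℝ} {q : ℝ}
    (hp : ∀ x ∈ s, 0 ≤ p x) (hsum : ∑ x ∈ s, p x = 1) (hv : ∀ x ∈ s, 0 ≤ v x) (hq : 0 ≤ q) :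
    ∑ x ∈ s, ENNReal.ofReal (p x) * klDensity (v x) q =
      ∑ x ∈ s, ENNReal.ofReal (p x) * klDensity (v x) (∑ z ∈ s, p z * v z) +
        klDensity (∑ z ∈ s, p z * v z) q := by
  set m := ∑ z ∈ s, p z * v z with hm
  have hpv : ∀ x ∈ s, 0 ≤ p x * v x := fun x hx => mul_nonneg (hp x hx) (hv x hx)
  have hm0 : 0 ≤ m := Finset.sum_nonneg hpv
  rcases hm0.eq_or_lt with h0 | h0
  · have hz : ∀ x ∈ s, p x = 0 ∨ v x = 0 := fun x hx =>
      mul_eq_zero.1 ((Finset.sum_eq_zero_iff_of_nonneg hpv).1 (hm.symm.trans h0.symm) x hx)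
    have h1 : ∀ c : ℝ, 0 ≤ c → ∑ x ∈ s, ENNReal.ofReal (p x) * klDensity (v x) c
        = ENNReal.ofReal c := by
      intro c hc
      calc ∑ x ∈ s, ENNReal.ofReal (p x) * klDensity (v x) c
          = ∑ x ∈ s, ENNReal.ofReal (p x * c) := Finset.sum_congr rfl fun x hx => by
            rcases hz x hx with h | h
            · simp [h]
            · rw [h, klDensity_zero_left, ENNReal.ofReal_mul (hp x hx)]
        _ = ENNReal.ofReal c := by
            rw [← ENNReal.ofReal_sum_of_nonneg fun x hx => mul_nonneg (hp x hx) hc,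
              ← Finset.sum_mul, hsum, one_mul]
    rw [← h0, h1 q hq, h1 0 le_rfl, klDensity_zero_left]
    simp
  · rcases hq.eq_or_lt with rfl | hq
    · rw [klDensity_zero_right h0.ne', add_top]
      obtain ⟨x, hx, hxv⟩ := Finset.exists_ne_zero_of_sum_ne_zero (hm ▸ h0.ne')
      rw [mul_ne_zero_iff] at hxv
      refine ENNReal.sum_eq_top.2 ⟨x, hx, ?_⟩
      rw [klDensity_zero_right hxv.2, ENNReal.mul_top]
      simpa using lt_of_le_of_ne (hp x hx) (Ne.symm hxv.1)
    · have key : ∀ c : ℝ, 0 < c → ∑ x ∈ s, ENNReal.ofReal (p x) * klDensity (v x) c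
          = ENNReal.ofReal (∑ x ∈ s, p x * (v x * Real.log (v x / c) - v x + c)) := by
        intro c hc
        rw [ENNReal.ofReal_sum_of_nonneg fun x hx =>
          mul_nonneg (hp x hx) (mul_log_sub_add_nonneg (hv x hx) hc)]
        exact Finset.sum_congr rfl fun x hx => by
          rw [klDensity_of_ne hc.ne', ENNReal.ofReal_mul (hp x hx)]
      rw [key q hq, key m h0, klDensity_of_ne hq.ne', ← ENNReal.ofReal_add
        (Finset.sum_nonneg fun x hx =>
          mul_nonneg (hp x hx) (mul_log_sub_add_nonneg (hv x hx) h0))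
        (mul_log_sub_add_nonneg h0.le hq)]
      congr 1
      have h2 : ∀ x ∈ s, p x * (v x * Real.log (v x / q) - v x + q) =
          p x * (v x * Real.log (v x / m) - v x + m) + p x * v x * Real.log (m / q)
            + p x * (q - m) := by
        intro x hx
        rcases (hv x hx).eq_or_lt with h | h
        · rw [← h]; ring
        · rw [Real.log_div h.ne' hq.ne', Real.log_div h.ne' h0.ne', Real.log_div h0.ne' hq.ne']
          ring
      rw [Finset.sum_congr rfl h2, Finset.sum_add_distrib, Finset.sum_add_distrib,
        ← Finset.sum_mul, ← Finset.sum_mul, hsum, ← hm]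
      ring

/-- The squared Hellinger distance is dominated by the relative entropy. -/
theorem ofReal_sqrt_sub_sqrt_sq_le {v w : ℝ} (hv : 0 ≤ v) (hw : 0 ≤ w) :
    ENNReal.ofReal ((√v - √w) ^ 2) ≤ klDensity v w := by
  rcases hv.eq_or_lt with rfl | hv
  · rw [klDensity_zero_left]
    simp [Real.sq_sqrt hw]
  · rcases hw.eq_or_lt with rfl | hw
    · simp [klDensity_zero_right hv.ne']
    · rw [klDensity_of_ne hw.ne']
      refine ENNReal.ofReal_le_ofReal ?_
      obtain ⟨a, ha, rfl⟩ : ∃ a : ℝ, 0 < a ∧ a ^ 2 = v := ⟨√v, by positivity, Real.sq_sqrt hv.le⟩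
      obtain ⟨b, hb, rfl⟩ : ∃ b : ℝ, 0 < b ∧ b ^ 2 = w := ⟨√w, by positivity, Real.sq_sqrt hw.le⟩
      rw [Real.sqrt_sq ha.le, Real.sqrt_sq hb.le, ← div_pow, Real.log_pow]
      have h := Real.log_le_sub_one_of_pos (div_pos hb ha)
      rw [Real.log_div hb.ne' ha.ne'] at h
      rw [Real.log_div ha.ne' hb.ne']
      have h2 := mul_le_mul_of_nonneg_left h (sq_nonneg a)
      have h3 : a ^ 2 * (b / a - 1) = a * b - a ^ 2 := by field_simp
      rw [h3] at h2
      push_cast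
      nlinarith

/-- A component of a mixture has bounded density with respect to the mixture. -/
theorem klDensity_le_of_mul_le {p v m : ℝ} (hp : 0 < p) (hv : 0 ≤ v)
    (h : p * v ≤ m) : klDensity v m ≤ ENNReal.ofReal (v * -Real.log p + m) := by
  have hm : 0 ≤ m := (mul_nonneg hp.le hv).trans h
  rcases hv.eq_or_lt with rfl | hv
  · simp [klDensity_zero_left]
  · have hm : 0 < m := (mul_pos hp hv).trans_le h
    rw [klDensity_of_ne hm.ne']
    refine ENNReal.ofReal_le_ofReal ?_
    have : Real.log (v / m) ≤ -Real.log p := by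
      rw [← Real.log_inv]
      refine Real.log_le_log (by positivity) ?_
      rw [div_le_iff₀ hm, inv_mul_eq_div, le_div_iff₀ hp]
      linarith
    nlinarith [mul_le_mul_of_nonneg_left this hv.le]

/-- The pointwise form of the variational identity for the Rényi divergence: `Z` is the
normalization of the geometric mean of `w` and `q`. -/
theorem klDensity_geometric_mean {α v w q Z : ℝ} (h0 : 0 < α) (h1 : α < 1) (hv : 0 ≤ v)
    (hw : 0 ≤ w) (hq : 0 ≤ q) (hZ : 0 < Z) (hZ1 : Z ≤ 1) :
    ENNReal.ofReal α * klDensity v w + ENNReal.ofReal (1 - α) * klDensity v q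
        + ENNReal.ofReal (Z⁻¹ * (w ^ α * q ^ (1 - α))) =
      klDensity v (Z⁻¹ * (w ^ α * q ^ (1 - α))) + ENNReal.ofReal (v * -Real.log Z)
        + ENNReal.ofReal (α * w + (1 - α) * q) := by
  have h1' : 0 < 1 - α := by linarith
  have hlog : 0 ≤ -Real.log Z := by linarith [Real.log_nonpos hZ.le hZ1]
  rcases hv.eq_or_lt with rfl | hv
  · simp only [klDensity_zero_left, zero_mul, ENNReal.ofReal_zero, add_zero]
    rw [← ENNReal.ofReal_mul h0.le, ← ENNReal.ofReal_mul h1'.le,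
      ← ENNReal.ofReal_add (by positivity) (by positivity), add_comm]
  · rcases hw.eq_or_lt with rfl | hw
    · rw [klDensity_zero_right hv.ne', ENNReal.mul_top (by simpa using h0),
        Real.zero_rpow h0.ne', zero_mul, mul_zero, klDensity_zero_right hv.ne']
      simp
    rcases hq.eq_or_lt with rfl | hq
    · rw [klDensity_zero_right hv.ne', ENNReal.mul_top (by simpa using h1),
        Real.zero_rpow h1'.ne', mul_zero, mul_zero, klDensity_zero_right hv.ne']
      simp
    have hu : 0 < Z⁻¹ * (w ^ α * q ^ (1 - α)) := by positivity
    have hlu : Real.log (Z⁻¹ * (w ^ α * q ^ (1 - α)))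
        = -Real.log Z + (α * Real.log w + (1 - α) * Real.log q) := by
      rw [Real.log_mul (by positivity) (by positivity), Real.log_mul (by positivity)
        (by positivity), Real.log_rpow hw, Real.log_rpow hq, Real.log_inv]
    have n1 := mul_log_sub_add_nonneg hv.le hw
    have n2 := mul_log_sub_add_nonneg hv.le hq
    have n3 := mul_log_sub_add_nonneg hv.le hu
    rw [klDensity_of_ne hw.ne', klDensity_of_ne hq.ne', klDensity_of_ne hu.ne',
      ← ENNReal.ofReal_mul h0.le, ← ENNReal.ofReal_mul h1'.le,
      ← ENNReal.ofReal_add (by positivity) (by positivity),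
      ← ENNReal.ofReal_add (by positivity) (by positivity),
      ← ENNReal.ofReal_add (by positivity) (by positivity),
      ← ENNReal.ofReal_add (by positivity) (by positivity)]
    congr 1
    rw [Real.log_div hv.ne' hu.ne', hlu, Real.log_div hv.ne' hw.ne', Real.log_div hv.ne' hq.ne']
    ring

/-! ### Relative entropy through densities -/

/-- `v` is a nonnegative real-valued measurable density of `V` with respect to `μ`. -/
structure HasRealDensity {Y : Type*} [MeasurableSpace Y] (μ V : Measure Y) (v : Y → ℝ) : Prop where
  measurable : Measurable v
  nonneg : ∀ y, 0 ≤ v y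
  eq_withDensity : V = μ.withDensity fun y => ENNReal.ofReal (v y)

section Density

variable {X Y : Type*} [MeasurableSpace Y] {μ V W : Measure Y} {v w : Y → ℝ}

theorem HasRealDensity.rnDeriv [SigmaFinite μ] [IsFiniteMeasure V] (h : V ≪ μ) :
    HasRealDensity μ V fun y => (V.rnDeriv μ y).toReal where
  measurable := (Measure.measurable_rnDeriv _ _).ennreal_toReal
  nonneg _ := ENNReal.toReal_nonneg
  eq_withDensity := by
    conv_lhs => rw [← Measure.withDensity_rnDeriv_eq V μ h]
    refine withDensity_congr_ae ?_
    filter_upwards [V.rnDeriv_lt_top μ] with y hy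
    rw [ENNReal.ofReal_toReal hy.ne]

theorem HasRealDensity.lintegral (h : HasRealDensity μ V v) :
    ∫⁻ y, ENNReal.ofReal (v y) ∂μ = V univ := by
  rw [h.eq_withDensity, withDensity_apply _ MeasurableSet.univ, Measure.restrict_univ]

theorem HasRealDensity.sum {s : Finset X} {p : X → ℝ} {V : X → Measure Y} {v : X → Y → ℝ}
    (hp : ∀ x ∈ s, 0 ≤ p x) (h : ∀ x ∈ s, HasRealDensity μ (V x) (v x)) :
    HasRealDensity μ (∑ x ∈ s, ENNReal.ofReal (p x) • V x) fun y => ∑ x ∈ s, p x * v x y where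
  measurable := Finset.measurable_fun_sum _ fun x hx => (h x hx).measurable.const_mul _
  nonneg y := Finset.sum_nonneg fun x hx => mul_nonneg (hp x hx) ((h x hx).nonneg y)
  eq_withDensity := by
    ext A hA
    rw [withDensity_apply _ hA, Measure.finsetSum_apply]
    have : ∀ y, ENNReal.ofReal (∑ x ∈ s, p x * v x y)
        = ∑ x ∈ s, ENNReal.ofReal (p x) * ENNReal.ofReal (v x y) := fun y => by
      rw [ENNReal.ofReal_sum_of_nonneg fun x hx => mul_nonneg (hp x hx) ((h x hx).nonneg y)]
      exact Finset.sum_congr rfl fun x hx => ENNReal.ofReal_mul (hp x hx)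
    simp_rw [this]
    rw [lintegral_finsetSum' _ fun x hx =>
      ((h x hx).measurable.ennreal_ofReal.const_mul _).aemeasurable]
    refine Finset.sum_congr rfl fun x hx => ?_
    rw [lintegral_const_mul _ (h x hx).measurable.ennreal_ofReal, Measure.smul_apply, smul_eq_mul]
    conv_lhs => rw [(h x hx).eq_withDensity, withDensity_apply _ hA]

theorem klDiv_eq_lintegral_klDensity [SigmaFinite μ] [IsFiniteMeasure V] [IsFiniteMeasure W]
    (hv : HasRealDensity μ V v) (hw : HasRealDensity μ W w) :
    InformationTheory.klDiv V W = ∫⁻ y, klDensity (v y) (w y) ∂μ := by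
  have hd : Measurable fun y => v y / w y := hv.measurable.div hw.measurable
  have hk : Measurable fun y => ENNReal.ofReal (InformationTheory.klFun (v y / w y)) :=
    (InformationTheory.measurable_klFun.comp hd).ennreal_ofReal
  by_cases h : ∀ᵐ y ∂μ, w y = 0 → v y = 0
  · have hVW : V = W.withDensity fun y => ENNReal.ofReal (v y / w y) := by
      rw [hw.eq_withDensity, ← withDensity_mul _ hw.measurable.ennreal_ofReal
        hd.ennreal_ofReal]
      conv_lhs => rw [hv.eq_withDensity]
      refine withDensity_congr_ae ?_
      filter_upwards [h] with y hy
      rw [Pi.mul_apply, ← ENNReal.ofReal_mul (hw.nonneg y)]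
      by_cases h0 : w y = 0
      · simp [h0, hy h0]
      · rw [mul_div_cancel₀ _ h0]
    have hac : V ≪ W := by
      rw [hVW]; exact withDensity_absolutelyContinuous _ _
    rw [InformationTheory.klDiv_eq_lintegral_klFun_of_ac hac]
    have hrn : V.rnDeriv W =ᵐ[W] fun y => ENNReal.ofReal (v y / w y) := by
      conv_lhs => rw [hVW]
      exact Measure.rnDeriv_withDensity _ hd.ennreal_ofReal
    have : ∫⁻ y, ENNReal.ofReal (InformationTheory.klFun (V.rnDeriv W y).toReal) ∂W
        = ∫⁻ y, ENNReal.ofReal (InformationTheory.klFun (v y / w y)) ∂W := by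
      refine lintegral_congr_ae ?_
      filter_upwards [hrn] with y hy
      rw [hy, ENNReal.toReal_ofReal (div_nonneg (hv.nonneg y) (hw.nonneg y))]
    rw [this]
    conv_lhs => rw [hw.eq_withDensity]
    rw [lintegral_withDensity_eq_lintegral_mul _ hw.measurable.ennreal_ofReal hk]
    refine lintegral_congr_ae ?_
    filter_upwards [h] with y hy
    rw [Pi.mul_apply, ← ENNReal.ofReal_mul (hw.nonneg y)]
    by_cases h0 : w y = 0
    · simp [h0, hy h0, klDensity]
    · rw [klDensity_of_ne h0, InformationTheory.klFun_apply]
      congr 1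
      field_simp
      ring
  · have hac : ¬ V ≪ W := fun hac => h <| by
      have hS : MeasurableSet {y | w y = 0} := hw.measurable (measurableSet_singleton 0)
      have hW : W {y | w y = 0} = 0 := by
        rw [hw.eq_withDensity, withDensity_apply _ hS]
        rw [setLIntegral_congr_fun hS (g := fun _ => 0) fun y hy => by
          simp only [mem_ofPred_eq] at hy; simp [hy]]
        simp
      have hV := hac hW
      rw [hv.eq_withDensity, withDensity_apply _ hS,
        setLIntegral_eq_zero_iff hS hv.measurable.ennreal_ofReal] at hV
      filter_upwards [hV] with y hy h0
      exact le_antisymm (ENNReal.ofReal_eq_zero.1 (hy h0)) (hv.nonneg y)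
    rw [InformationTheory.klDiv_of_not_ac hac]
    by_contra hne
    refine h ?_
    filter_upwards [ae_lt_top (measurable_klDensity hv.measurable hw.measurable) (Ne.symm hne)]
      with y hy h0
    by_contra hv0
    rw [h0, klDensity_zero_right hv0] at hy
    exact lt_irrefl _ hy

end Density

/-! ### Conditional relative entropy and output distributions -/

section Mixture

variable {X Y : Type*} [MeasurableSpace Y]

/-- The conditional Kullback-Leibler divergence `∑ₓ P(x) D(V(x)‖W(x))`. -/
noncomputable def condKL (P : Convexity.StdSimplex ℝ X) (V W : X → ProbabilityMeasure Y) : ℝ≥0∞ :=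
  ∑ x ∈ P.weights.support, ENNReal.ofReal (P.weights x) * klDiv (V x : Measure Y) (W x)

theorem sum_support_weights (P : Convexity.StdSimplex ℝ X) :
    ∑ x ∈ P.weights.support, P.weights x = 1 := P.total

theorem weights_pos {P : Convexity.StdSimplex ℝ X} {x : X} (hx : x ∈ P.weights.support) :
    0 < P.weights x :=
  lt_of_le_of_ne (P.nonneg x) (Ne.symm (Finsupp.mem_support_iff.1 hx))

theorem sum_ofReal_weights (P : Convexity.StdSimplex ℝ X) :
    ∑ x ∈ P.weights.support, ENNReal.ofReal (P.weights x) = 1 := by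
  rw [← ENNReal.ofReal_sum_of_nonneg fun x _ => P.nonneg x, sum_support_weights,
    ENNReal.ofReal_one]

theorem isProbabilityMeasure_mixture (P : Convexity.StdSimplex ℝ X)
    (V : X → ProbabilityMeasure Y) :
    IsProbabilityMeasure
      (∑ x ∈ P.weights.support, ENNReal.ofReal (P.weights x) • (V x : Measure Y)) := by
  constructor
  simp [Measure.finsetSum_apply, sum_ofReal_weights]

/-- The output distribution `∑ₓ P(x) V(x)` of the channel `V` under the input distribution `P`. -/
noncomputable def mixture (P : Convexity.StdSimplex ℝ X) (V : X → ProbabilityMeasure Y) :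
    ProbabilityMeasure Y :=
  ⟨_, isProbabilityMeasure_mixture P V⟩

theorem coe_mixture (P : Convexity.StdSimplex ℝ X) (V : X → ProbabilityMeasure Y) :
    (mixture P V : Measure Y)
      = ∑ x ∈ P.weights.support, ENNReal.ofReal (P.weights x) • (V x : Measure Y) := rfl

theorem mixture_congr {P : Convexity.StdSimplex ℝ X} {V W : X → ProbabilityMeasure Y}
    (h : ∀ x ∈ P.weights.support, V x = W x) : mixture P V = mixture P W := by
  apply Subtype.ext
  change (mixture P V : Measure Y) = (mixture P W : Measure Y)
  rw [coe_mixture, coe_mixture]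
  exact Finset.sum_congr rfl fun x hx => by rw [h x hx]

theorem condKL_congr {P : Convexity.StdSimplex ℝ X} {V W V' W' : X → ProbabilityMeasure Y}
    (h : ∀ x ∈ P.weights.support, V x = V' x) (h' : ∀ x ∈ P.weights.support, W x = W' x) :
    condKL P V W = condKL P V' W' :=
  Finset.sum_congr rfl fun x hx => by rw [h x hx, h' x hx]

theorem absolutelyContinuous_mixture {P : Convexity.StdSimplex ℝ X}
    (V : X → ProbabilityMeasure Y) {x : X} (hx : x ∈ P.weights.support) :
    (V x : Measure Y) ≪ mixture P V := by
  refine Measure.AbsolutelyContinuous.mk fun A _ h => ?_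
  rw [coe_mixture, Measure.finsetSum_apply, Finset.sum_eq_zero_iff] at h
  have := h x hx
  rw [Measure.smul_apply, smul_eq_mul, mul_eq_zero] at this
  refine this.resolve_left ?_
  simpa using weights_pos hx

theorem condKL_ne_top_iff {P : Convexity.StdSimplex ℝ X} {V W : X → ProbabilityMeasure Y} :
    condKL P V W ≠ ⊤ ↔ ∀ x ∈ P.weights.support, klDiv (V x : Measure Y) (W x) ≠ ⊤ := by
  rw [condKL, Ne, ENNReal.sum_eq_top]
  push Not
  refine forall₂_congr fun x hx => ?_
  rw [Ne, ENNReal.mul_eq_top]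
  simp [weights_pos hx]

theorem condKL_eq_zero_iff {P : Convexity.StdSimplex ℝ X} {V W : X → ProbabilityMeasure Y} :
    condKL P V W = 0 ↔ ∀ x ∈ P.weights.support, V x = W x := by
  rw [condKL, Finset.sum_eq_zero_iff]
  refine forall₂_congr fun x hx => ?_
  rw [mul_eq_zero, InformationTheory.klDiv_eq_zero_iff]
  have : ¬ ENNReal.ofReal (P.weights x) = 0 := by simpa using weights_pos hx
  simp only [this, false_or]
  exact ⟨fun h => Subtype.ext h, fun h => by rw [h]⟩

theorem condKL_self (P : Convexity.StdSimplex ℝ X) (V : X → ProbabilityMeasure Y) :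
    condKL P V V = 0 := condKL_eq_zero_iff.2 fun _ _ => rfl

theorem absolutelyContinuous_of_condKL_ne_top {P : Convexity.StdSimplex ℝ X}
    {V W : X → ProbabilityMeasure Y} (h : condKL P V W ≠ ⊤) {x : X}
    (hx : x ∈ P.weights.support) : (V x : Measure Y) ≪ W x := by
  by_contra hac
  exact condKL_ne_top_iff.1 h x hx (InformationTheory.klDiv_of_not_ac hac)

variable {μ : Measure Y}

theorem HasRealDensity.mixture {P : Convexity.StdSimplex ℝ X} {V : X → ProbabilityMeasure Y}
    {v : X → Y → ℝ} (h : ∀ x ∈ P.weights.support, HasRealDensity μ (V x) (v x)) :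
    HasRealDensity μ (mixture P V) fun y => ∑ x ∈ P.weights.support, P.weights x * v x y :=
  HasRealDensity.sum (fun x _ => P.nonneg x) h

theorem condKL_eq_lintegral [SigmaFinite μ] {P : Convexity.StdSimplex ℝ X}
    {V W : X → ProbabilityMeasure Y} {v w : X → Y → ℝ}
    (hv : ∀ x ∈ P.weights.support, HasRealDensity μ (V x) (v x))
    (hw : ∀ x ∈ P.weights.support, HasRealDensity μ (W x) (w x)) :
    condKL P V W = ∫⁻ y, ∑ x ∈ P.weights.support,
      ENNReal.ofReal (P.weights x) * klDensity (v x y) (w x y) ∂μ := by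
  rw [lintegral_finsetSum' _ fun x hx => ((measurable_klDensity (hv x hx).measurable
    (hw x hx).measurable).const_mul _).aemeasurable]
  refine Finset.sum_congr rfl fun x hx => ?_
  rw [lintegral_const_mul _ (measurable_klDensity (hv x hx).measurable (hw x hx).measurable),
    klDiv_eq_lintegral_klDensity (hv x hx) (hw x hx)]

/-- A finite measure dominating finitely many probability measures. -/
theorem exists_dominating (P : Convexity.StdSimplex ℝ X) (V W : X → ProbabilityMeasure Y)
    (Q : ProbabilityMeasure Y) : ∃ μ : Measure Y, IsFiniteMeasure μ ∧ (Q : Measure Y) ≪ μ ∧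
      ∀ x ∈ P.weights.support, (V x : Measure Y) ≪ μ ∧ (W x : Measure Y) ≪ μ := by
  refine ⟨(mixture P V : Measure Y) + (mixture P W : Measure Y) + (Q : Measure Y),
    inferInstance, ?_, fun x hx => ⟨?_, ?_⟩⟩
  · rw [add_comm]; exact Measure.AbsolutelyContinuous.rfl.add_right _
  · exact ((absolutelyContinuous_mixture V hx).add_right _).add_right _
  · rw [add_comm (mixture P V : Measure Y)]
    exact ((absolutelyContinuous_mixture W hx).add_right _).add_right _

/-- The compensation identity: among all `Q`, the output distribution is the one closest to the
rows of the channel. -/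
theorem condKL_const_eq (P : Convexity.StdSimplex ℝ X) (V : X → ProbabilityMeasure Y)
    (Q : ProbabilityMeasure Y) :
    condKL P V (fun _ => Q) = condKL P V (fun _ => mixture P V)
      + klDiv (mixture P V : Measure Y) Q := by
  obtain ⟨μ, _, hQ, h⟩ := exists_dominating P V V Q
  have hv := fun x hx => HasRealDensity.rnDeriv (h x hx).1
  have hq := HasRealDensity.rnDeriv hQ
  have hm := HasRealDensity.mixture hv
  rw [condKL_eq_lintegral hv fun _ _ => hq, condKL_eq_lintegral hv fun _ _ => hm,
    klDiv_eq_lintegral_klDensity hm hq,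
    ← lintegral_add_right _ (measurable_klDensity hm.measurable hq.measurable)]
  exact lintegral_congr fun y => sum_klDensity_eq _ (fun x _ => P.nonneg x)
    (sum_support_weights P) (fun x hx => (hv x hx).nonneg y) (hq.nonneg y)

theorem condKL_mixture_le (P : Convexity.StdSimplex ℝ X) (V : X → ProbabilityMeasure Y)
    (Q : ProbabilityMeasure Y) :
    condKL P V (fun _ => mixture P V) ≤ condKL P V (fun _ => Q) := by
  rw [condKL_const_eq P V Q]; exact le_self_add

theorem klDiv_mixture_le (P : Convexity.StdSimplex ℝ X) (V W : X → ProbabilityMeasure Y) :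
    klDiv (mixture P V : Measure Y) (mixture P W) ≤ condKL P V W := by
  obtain ⟨μ, _, -, h⟩ := exists_dominating P V W (mixture P V)
  have hv := fun x hx => HasRealDensity.rnDeriv (h x hx).1
  have hw := fun x hx => HasRealDensity.rnDeriv (h x hx).2
  rw [condKL_eq_lintegral hv hw, klDiv_eq_lintegral_klDensity (HasRealDensity.mixture hv)
    (HasRealDensity.mixture hw)]
  exact lintegral_mono fun y => sum_klDensity_le _ (fun x _ => P.nonneg x)
    (fun x hx => (hv x hx).nonneg y) (fun x hx => (hw x hx).nonneg y)

/-- The mutual information is finite, since the input distribution has finite support. -/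
theorem condKL_mixture_ne_top (P : Convexity.StdSimplex ℝ X) (V : X → ProbabilityMeasure Y) :
    condKL P V (fun _ => mixture P V) ≠ ⊤ := by
  rw [condKL_ne_top_iff]
  intro x hx
  have hv := fun x (hx : x ∈ P.weights.support) =>
    HasRealDensity.rnDeriv (absolutelyContinuous_mixture V hx)
  have hm := HasRealDensity.mixture hv
  rw [klDiv_eq_lintegral_klDensity (hv x hx) hm]
  have hp := weights_pos hx
  have hlog : 0 ≤ -Real.log (P.weights x) := by
    rw [neg_nonneg]
    refine Real.log_nonpos hp.le ?_
    rw [← sum_support_weights P]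
    exact Finset.single_le_sum (fun x _ => P.nonneg x) hx
  refine ne_top_of_le_ne_top ?_ (lintegral_mono fun y => klDensity_le_of_mul_le hp
    ((hv x hx).nonneg y) (Finset.single_le_sum
      (fun x hx => mul_nonneg (P.nonneg x) ((hv x hx).nonneg y)) hx))
  have : ∀ y, ENNReal.ofReal (((V x : Measure Y).rnDeriv (mixture P V) y).toReal
        * -Real.log (P.weights x) + ∑ z ∈ P.weights.support, P.weights z
          * ((V z : Measure Y).rnDeriv (mixture P V) y).toReal)
      = ENNReal.ofReal (((V x : Measure Y).rnDeriv (mixture P V) y).toReal)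
          * ENNReal.ofReal (-Real.log (P.weights x))
        + ENNReal.ofReal (∑ z ∈ P.weights.support, P.weights z
          * ((V z : Measure Y).rnDeriv (mixture P V) y).toReal) := fun y => by
    rw [ENNReal.ofReal_add (mul_nonneg ((hv x hx).nonneg y) hlog) (hm.nonneg y),
      ENNReal.ofReal_mul ((hv x hx).nonneg y)]
  simp_rw [this]
  rw [lintegral_add_right _ hm.measurable.ennreal_ofReal,
    lintegral_mul_const _ (hv x hx).measurable.ennreal_ofReal, (hv x hx).lintegral, hm.lintegral]
  simp

end Mixture

/-! ### Mixtures of two channels -/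

section Binary

variable {X Y : Type*} [MeasurableSpace Y]

/-- The weights `1 - t` and `t` on `false` and `true`. -/
noncomputable def binaryWeights (t : ℝ) (h0 : 0 ≤ t) (h1 : t ≤ 1) : Convexity.StdSimplex ℝ Bool :=
  Convexity.StdSimplex.duple false true (sub_nonneg.2 h1) h0 (by ring)

theorem sum_binaryWeights {t : ℝ} (h0 : 0 ≤ t) (h1 : t ≤ 1) {M : Type*} [AddCommMonoid M]
    (F : ℝ → Bool → M) (hF : ∀ b, F 0 b = 0) :
    ∑ b ∈ (binaryWeights t h0 h1).weights.support, F ((binaryWeights t h0 h1).weights b) b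
      = F (1 - t) false + F t true := by
  rw [Finset.sum_subset (Finset.subset_univ _) fun b _ hb => by
    rw [Finsupp.notMem_support_iff.1 hb, hF]]
  simp [binaryWeights, Convexity.StdSimplex.duple, add_comm]

/-- The channel `(1 - t) V + t U`. -/
noncomputable def channelSegment (t : ℝ) (h0 : 0 ≤ t) (h1 : t ≤ 1) (V U : X → ProbabilityMeasure Y)
    (x : X) : ProbabilityMeasure Y :=
  mixture (binaryWeights t h0 h1) fun b => cond b (U x) (V x)

variable {t : ℝ} (h0 : 0 ≤ t) (h1 : t ≤ 1)

theorem coe_channelSegment (V U : X → ProbabilityMeasure Y) (x : X) :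
    (channelSegment t h0 h1 V U x : Measure Y)
      = ENNReal.ofReal (1 - t) • (V x : Measure Y) + ENNReal.ofReal t • (U x : Measure Y) := by
  rw [channelSegment, coe_mixture]
  exact sum_binaryWeights h0 h1
    (fun r b => ENNReal.ofReal r • ((cond b (U x) (V x) : ProbabilityMeasure Y) : Measure Y))
    (by simp)

theorem condKL_binaryWeights (V W : Bool → ProbabilityMeasure Y) :
    condKL (binaryWeights t h0 h1) V W =
      ENNReal.ofReal (1 - t) * klDiv (V false : Measure Y) (W false)
        + ENNReal.ofReal t * klDiv (V true : Measure Y) (W true) :=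
  sum_binaryWeights h0 h1 (fun r b => ENNReal.ofReal r * klDiv (V b : Measure Y) (W b)) (by simp)

theorem condKL_add_mul (P : Convexity.StdSimplex ℝ X) (V W V' W' : X → ProbabilityMeasure Y)
    (a b : ℝ≥0∞) :
    a * condKL P V W + b * condKL P V' W' = ∑ x ∈ P.weights.support,
      ENNReal.ofReal (P.weights x) * (a * klDiv (V x : Measure Y) (W x)
        + b * klDiv (V' x : Measure Y) (W' x)) := by
  rw [condKL, condKL, Finset.mul_sum, Finset.mul_sum, ← Finset.sum_add_distrib]
  exact Finset.sum_congr rfl fun x _ => by ring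

theorem condKL_segment (P : Convexity.StdSimplex ℝ X) (V U W : X → ProbabilityMeasure Y) :
    ENNReal.ofReal (1 - t) * condKL P V W + ENNReal.ofReal t * condKL P U W =
      ENNReal.ofReal (1 - t) * condKL P V (channelSegment t h0 h1 V U)
        + ENNReal.ofReal t * condKL P U (channelSegment t h0 h1 V U)
        + condKL P (channelSegment t h0 h1 V U) W := by
  rw [condKL_add_mul, condKL_add_mul, condKL, ← Finset.sum_add_distrib]
  refine Finset.sum_congr rfl fun x _ => ?_
  rw [← mul_add]
  congr 1
  have := condKL_const_eq (binaryWeights t h0 h1) (fun b => cond b (U x) (V x)) (W x)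
  rw [condKL_binaryWeights, condKL_binaryWeights] at this
  exact this

theorem mixture_channelSegment (P : Convexity.StdSimplex ℝ X) (V U : X → ProbabilityMeasure Y) :
    mixture P (channelSegment t h0 h1 V U) =
      mixture (binaryWeights t h0 h1) (fun b => cond b (mixture P U) (mixture P V)) := by
  apply Subtype.ext
  have h := coe_channelSegment h0 h1 (fun _ : Unit => mixture P V) (fun _ => mixture P U) ()
  rw [channelSegment] at h
  refine Eq.trans ?_ h.symm
  change (mixture P (channelSegment t h0 h1 V U) : Measure Y) = _
  simp_rw [coe_mixture, coe_channelSegment, smul_add, Finset.sum_add_distrib, Finset.smul_sum,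
    smul_smul, mul_comm]

/-- The mutual information is a convex function of the channel. -/
theorem condKL_mixture_segment_le (P : Convexity.StdSimplex ℝ X) (V U : X → ProbabilityMeasure Y) :
    condKL P (channelSegment t h0 h1 V U) (fun _ => mixture P (channelSegment t h0 h1 V U)) ≤
      ENNReal.ofReal (1 - t) * condKL P V (fun _ => mixture P V)
        + ENNReal.ofReal t * condKL P U (fun _ => mixture P U) := by
  rw [condKL_add_mul, mixture_channelSegment, condKL]
  refine Finset.sum_le_sum fun x _ => mul_le_mul_right ?_ _
  have := klDiv_mixture_le (binaryWeights t h0 h1) (fun b => cond b (U x) (V x))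
    (fun b => cond b (mixture P U) (mixture P V))
  rw [condKL_binaryWeights] at this
  exact this

end Binary

/-! ### The variational characterization of the Rényi divergence -/

section Variational

open SpherePacking

variable {Y : Type*} [MeasurableSpace Y]

theorem hasRealDensity_left (W Q : ProbabilityMeasure Y) :
    HasRealDensity ((W : Measure Y) + (Q : Measure Y)) W
      fun y => ((W : Measure Y).rnDeriv ((W : Measure Y) + (Q : Measure Y)) y).toReal :=
  HasRealDensity.rnDeriv (Measure.AbsolutelyContinuous.rfl.add_right _)

theorem hasRealDensity_right (W Q : ProbabilityMeasure Y) :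
    HasRealDensity ((W : Measure Y) + (Q : Measure Y)) Q
      fun y => ((Q : Measure Y).rnDeriv ((W : Measure Y) + (Q : Measure Y)) y).toReal :=
  HasRealDensity.rnDeriv (by rw [add_comm]; exact Measure.AbsolutelyContinuous.rfl.add_right _)

/-- The unnormalized tilted density as a real-valued function. -/
noncomputable def realTiltDensity (α : ℝ) (W Q : ProbabilityMeasure Y) (y : Y) : ℝ :=
  ((W : Measure Y).rnDeriv ((W : Measure Y) + (Q : Measure Y)) y).toReal ^ α *
    ((Q : Measure Y).rnDeriv ((W : Measure Y) + (Q : Measure Y)) y).toReal ^ (1 - α)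

theorem realTiltDensity_nonneg (α : ℝ) (W Q : ProbabilityMeasure Y) (y : Y) :
    0 ≤ realTiltDensity α W Q y := by unfold realTiltDensity; positivity

theorem measurable_realTiltDensity (α : ℝ) (W Q : ProbabilityMeasure Y) :
    Measurable (realTiltDensity α W Q) :=
  ((hasRealDensity_left W Q).measurable.pow_const _).mul
    ((hasRealDensity_right W Q).measurable.pow_const _)

theorem tiltDensity_ae_eq {α : ℝ} (h0 : 0 < α) (h1 : α < 1) (W Q : ProbabilityMeasure Y) :
    tiltDensity α W Q =ᵐ[(W : Measure Y) + (Q : Measure Y)]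
      fun y => ENNReal.ofReal (realTiltDensity α W Q y) := by
  filter_upwards [(W : Measure Y).rnDeriv_lt_top ((W : Measure Y) + (Q : Measure Y)),
    (Q : Measure Y).rnDeriv_lt_top ((W : Measure Y) + (Q : Measure Y))] with y hw hq
  rw [realTiltDensity, tiltDensity, ENNReal.ofReal_mul (by positivity),
    ← ENNReal.ofReal_rpow_of_nonneg ENNReal.toReal_nonneg h0.le,
    ← ENNReal.ofReal_rpow_of_nonneg ENNReal.toReal_nonneg (by linarith),
    ENNReal.ofReal_toReal hw.ne, ENNReal.ofReal_toReal hq.ne]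

theorem tiltMass_eq {α : ℝ} (h0 : 0 < α) (h1 : α < 1) (W Q : ProbabilityMeasure Y) :
    tiltMass α W Q = ∫⁻ y, ENNReal.ofReal (realTiltDensity α W Q y)
      ∂((W : Measure Y) + (Q : Measure Y)) :=
  lintegral_congr_ae (tiltDensity_ae_eq h0 h1 W Q)

theorem lintegral_arith_mean {α : ℝ} (h0 : 0 < α) (h1 : α < 1) (W Q : ProbabilityMeasure Y) :
    ∫⁻ y, ENNReal.ofReal (α * ((W : Measure Y).rnDeriv ((W : Measure Y) + (Q : Measure Y)) y).toReal
      + (1 - α) * ((Q : Measure Y).rnDeriv ((W : Measure Y) + (Q : Measure Y)) y).toReal)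
      ∂((W : Measure Y) + (Q : Measure Y)) = 1 := by
  have hw := hasRealDensity_left W Q
  have hq := hasRealDensity_right W Q
  have h1' : 0 ≤ 1 - α := by linarith
  simp_rw [fun y => ENNReal.ofReal_add (mul_nonneg h0.le (hw.nonneg y))
    (mul_nonneg h1' (hq.nonneg y)), ENNReal.ofReal_mul h0.le, ENNReal.ofReal_mul h1']
  rw [lintegral_add_right _ (hq.measurable.ennreal_ofReal.const_mul _),
    lintegral_const_mul _ hw.measurable.ennreal_ofReal,
    lintegral_const_mul _ hq.measurable.ennreal_ofReal, hw.lintegral, hq.lintegral,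
    measure_univ, measure_univ, mul_one, mul_one, ← ENNReal.ofReal_add h0.le h1']
  simp

theorem tiltMass_le_one {α : ℝ} (h0 : 0 < α) (h1 : α < 1) (W Q : ProbabilityMeasure Y) :
    tiltMass α W Q ≤ 1 := by
  rw [tiltMass_eq h0 h1, ← lintegral_arith_mean h0 h1 W Q]
  exact lintegral_mono fun y => ENNReal.ofReal_le_ofReal <|
    Real.geom_mean_le_arith_mean2_weighted h0.le (by linarith) ENNReal.toReal_nonneg
      ENNReal.toReal_nonneg (by ring)

theorem coe_tiltedMeasure {α : ℝ} (h0 : 0 < α) {W Q : ProbabilityMeasure Y}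
    (h : renyiDiv α W Q ≠ ⊤) : (tiltedMeasure α W Q : Measure Y) = tiltedRaw α W Q := by
  rw [tiltedMeasure, dif_pos ⟨h0, h⟩]; rfl

theorem renyiDiv_eq {α : ℝ} (h0 : 0 < α) (h1 : α < 1) {W Q : ProbabilityMeasure Y}
    (h : renyiDiv α W Q ≠ ⊤) :
    renyiDiv α W Q = (((1 - α)⁻¹ * -Real.log (tiltMass α W Q).toReal : ℝ) : EReal) := by
  obtain ⟨hz, ht⟩ := tiltMass_ne h0 h1.ne h
  rw [renyiDiv, if_neg h1.ne, ENNReal.log_pos_real hz ht, ← EReal.coe_mul, ← neg_sub, inv_neg]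
  congr 1
  ring

theorem hasRealDensity_tiltedMeasure {α : ℝ} (h0 : 0 < α) (h1 : α < 1)
    {W Q : ProbabilityMeasure Y} (h : renyiDiv α W Q ≠ ⊤) :
    HasRealDensity ((W : Measure Y) + (Q : Measure Y)) (tiltedMeasure α W Q)
      fun y => (tiltMass α W Q).toReal⁻¹ * realTiltDensity α W Q y where
  measurable := (measurable_realTiltDensity α W Q).const_mul _
  nonneg y := mul_nonneg (by positivity) (realTiltDensity_nonneg α W Q y)
  eq_withDensity := by
    obtain ⟨hz, ht⟩ := tiltMass_ne h0 h1.ne h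
    have hZ : 0 < (tiltMass α W Q).toReal := ENNReal.toReal_pos hz ht
    rw [coe_tiltedMeasure h0 h, tiltedRaw]
    refine withDensity_congr_ae ?_
    filter_upwards [tiltDensity_ae_eq h0 h1 W Q] with y hy
    rw [hy, ENNReal.ofReal_mul (by positivity), renyiDiv_eq h0 h1 h, ← EReal.coe_mul,
      EReal.exp_coe]
    congr 2
    rw [← mul_assoc, mul_inv_cancel₀ (by linarith), one_mul, Real.exp_neg, Real.exp_log hZ]

/-- For `0 < α < 1`, tilting solves the problem of minimizing `α D(V‖W) + (1-α) D(V‖Q)` over `V`;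
the minimum is `(1-α) D_α(W‖Q)` and the excess at `V` is the divergence of `V` from the tilted
measure. -/
theorem exists_variational {α : ℝ} (h0 : 0 < α) (h1 : α < 1) {W Q : ProbabilityMeasure Y}
    (h : renyiDiv α W Q ≠ ⊤) :
    ∃ A : ℝ, 0 ≤ A ∧ renyiDiv α W Q = (((1 - α)⁻¹ * A : ℝ) : EReal) ∧
      ∀ V : ProbabilityMeasure Y,
        ENNReal.ofReal α * klDiv (V : Measure Y) W
            + ENNReal.ofReal (1 - α) * klDiv (V : Measure Y) Q
          = klDiv (V : Measure Y) (tiltedMeasure α W Q) + ENNReal.ofReal A := by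
  obtain ⟨hz, ht⟩ := tiltMass_ne h0 h1.ne h
  have hZ : 0 < (tiltMass α W Q).toReal := ENNReal.toReal_pos hz ht
  have hZ1 : (tiltMass α W Q).toReal ≤ 1 :=
    ENNReal.toReal_le_of_le_ofReal zero_le_one (by simpa using tiltMass_le_one h0 h1 W Q)
  have hA : 0 ≤ -Real.log (tiltMass α W Q).toReal := by
    linarith [Real.log_nonpos hZ.le hZ1]
  refine ⟨-Real.log (tiltMass α W Q).toReal, hA, renyiDiv_eq h0 h1 h, fun V => ?_⟩
  have hw := hasRealDensity_left W Q
  have hq := hasRealDensity_right W Q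
  have hu := hasRealDensity_tiltedMeasure h0 h1 h
  by_cases hac : (V : Measure Y) ≪ (W : Measure Y) + (Q : Measure Y)
  · have hv := HasRealDensity.rnDeriv hac
    set v := fun y => ((V : Measure Y).rnDeriv ((W : Measure Y) + (Q : Measure Y)) y).toReal
    have key : ∫⁻ y, _ ∂((W : Measure Y) + (Q : Measure Y)) = ∫⁻ y, _ ∂((W : Measure Y)
        + (Q : Measure Y)) := lintegral_congr fun y => klDensity_geometric_mean h0 h1
      (hv.nonneg y) (hw.nonneg y) (hq.nonneg y) hZ hZ1
    have m1 := measurable_klDensity hv.measurable hw.measurable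
    have m2 := measurable_klDensity hv.measurable hq.measurable
    have m3 := measurable_klDensity hv.measurable hu.measurable
    have e1 := lintegral_arith_mean h0 h1 W Q
    have e2 := hu.lintegral
    rw [measure_univ] at e2
    simp_rw [realTiltDensity] at e2 m3
    rw [lintegral_add_right, lintegral_add_right, lintegral_add_right, lintegral_add_right, e1, e2,
      lintegral_const_mul _ m1, lintegral_const_mul _ m2] at key
    rotate_left
    · simp_rw [ENNReal.ofReal_mul (hv.nonneg _)]
      exact hv.measurable.ennreal_ofReal.mul_const _
    · exact ((hw.measurable.const_mul _).add (hq.measurable.const_mul _)).ennreal_ofReal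
    · exact m2.const_mul _
    · exact hu.measurable.ennreal_ofReal
    have e3 : ∫⁻ y, ENNReal.ofReal (v y * -Real.log (tiltMass α W Q).toReal)
        ∂((W : Measure Y) + (Q : Measure Y)) = ENNReal.ofReal
          (-Real.log (tiltMass α W Q).toReal) := by
      simp_rw [ENNReal.ofReal_mul (hv.nonneg _)]
      rw [lintegral_mul_const _ hv.measurable.ennreal_ofReal, hv.lintegral, measure_univ, one_mul]
    rw [e3] at key
    rw [klDiv_eq_lintegral_klDensity hv hw, klDiv_eq_lintegral_klDensity hv hq,
      klDiv_eq_lintegral_klDensity hv hu]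
    exact (ENNReal.add_left_inj ENNReal.one_ne_top).1 key
  · have hW : ¬ (V : Measure Y) ≪ W := fun h' => hac (h'.add_right _)
    have hT : ¬ (V : Measure Y) ≪ tiltedMeasure α W Q := fun h' => hac <| h'.trans <| by
      rw [coe_tiltedMeasure h0 h]; exact withDensity_absolutelyContinuous _ _
    rw [InformationTheory.klDiv_of_not_ac hW, InformationTheory.klDiv_of_not_ac hT,
      ENNReal.mul_top (by simpa using h0)]
    simp

/-- When the Rényi divergence is infinite, `W` and `Q` are mutually singular, so that no probability
measure is dominated by both. -/
theorem not_ac_of_renyiDiv_eq_top {α : ℝ} (h0 : 0 < α) (h1 : α < 1) {W Q : ProbabilityMeasure Y}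
    (h : renyiDiv α W Q = ⊤) (V : ProbabilityMeasure Y) (hW : (V : Measure Y) ≪ W) :
    ¬ (V : Measure Y) ≪ Q := by
  intro hQ
  have hz : tiltMass α W Q = 0 := by
    by_contra hz
    have ht : tiltMass α W Q ≠ ⊤ :=
      ne_top_of_le_ne_top ENNReal.one_ne_top (tiltMass_le_one h0 h1 W Q)
    rw [renyiDiv, if_neg h1.ne, ENNReal.log_pos_real hz ht, ← EReal.coe_mul] at h
    exact EReal.coe_ne_top _ h
  have hw := hasRealDensity_left W Q
  have hq := hasRealDensity_right W Q
  rw [tiltMass_eq h0 h1, lintegral_eq_zero_iff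
    (measurable_realTiltDensity α W Q).ennreal_ofReal] at hz
  have hV : (V : Measure Y) ≪ (W : Measure Y) + (Q : Measure Y) := hW.add_right _
  have key : ∀ {U : ProbabilityMeasure Y} {u : Y → ℝ},
      HasRealDensity ((W : Measure Y) + (Q : Measure Y)) U u → (V : Measure Y) ≪ U →
      ∀ᵐ y ∂(V : Measure Y), u y ≠ 0 := by
    intro U u hu hVU
    have hU : ∀ᵐ y ∂(U : Measure Y), u y ≠ 0 := by
      rw [hu.eq_withDensity, ae_withDensity_iff hu.measurable.ennreal_ofReal]
      refine Eventually.of_forall fun y hy h0 => hy ?_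
      rw [h0, ENNReal.ofReal_zero]
    exact hVU.ae_le hU
  have hF : ∀ᵐ y ∂(V : Measure Y), False := by
    filter_upwards [key hw hW, key hq hQ, hV.ae_le hz] with y h2 h3 h4
    have h5 := ENNReal.ofReal_eq_zero.1 h4
    have h2' := lt_of_le_of_ne (hw.nonneg y) (Ne.symm h2)
    have h3' := lt_of_le_of_ne (hq.nonneg y) (Ne.symm h3)
    have : 0 < realTiltDensity α W Q y := mul_pos (Real.rpow_pos_of_pos h2' _)
      (Real.rpow_pos_of_pos h3' _)
    linarith
  rw [ae_iff] at hF
  simp at hF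

theorem tiltedMeasure_one (W Q : ProbabilityMeasure Y) : tiltedMeasure 1 W Q = W := by
  by_cases h : 0 < (1 : ℝ) ∧ renyiDiv 1 W Q ≠ ⊤
  · apply Subtype.ext
    change (tiltedMeasure 1 W Q : Measure Y) = W
    rw [coe_tiltedMeasure h.1 h.2, tiltedRaw]
    conv_rhs => rw [← Measure.withDensity_rnDeriv_eq (W : Measure Y)
      ((W : Measure Y) + (Q : Measure Y)) (Measure.AbsolutelyContinuous.rfl.add_right _)]
    congr 1
    ext y
    simp [tiltDensity]
  · rw [tiltedMeasure, dif_neg h]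

end Variational

/-! ### Lower semicontinuity and completeness -/

section Convergence

variable {X Y : Type*} [MeasurableSpace Y] {μ : Measure Y}

/-- Convergence of probability measures in the sense that suitable densities with respect to `μ`
converge almost everywhere. -/
def DensityTendsto (μ : Measure Y) (V : ℕ → ProbabilityMeasure Y) (V' : ProbabilityMeasure Y) :
    Prop :=
  ∃ (v : ℕ → Y → ℝ) (v' : Y → ℝ), (∀ n, HasRealDensity μ (V n) (v n)) ∧ HasRealDensity μ V' v' ∧
    ∀ᵐ y ∂μ, Tendsto (fun n => v n y) atTop (𝓝 (v' y))

theorem DensityTendsto.const [SigmaFinite μ] {V : ProbabilityMeasure Y} (h : (V : Measure Y) ≪ μ) :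
    DensityTendsto μ (fun _ => V) V :=
  ⟨_, _, fun _ => HasRealDensity.rnDeriv h, HasRealDensity.rnDeriv h,
    Eventually.of_forall fun _ => tendsto_const_nhds⟩

theorem DensityTendsto.mixture {P : Convexity.StdSimplex ℝ X} {V : ℕ → X → ProbabilityMeasure Y}
    {V' : X → ProbabilityMeasure Y}
    (h : ∀ x ∈ P.weights.support, DensityTendsto μ (fun n => V n x) (V' x)) :
    DensityTendsto μ (fun n => mixture P (V n)) (mixture P V') := by
  choose! v v' hv hv' ht using h
  refine ⟨_, _, fun n => HasRealDensity.mixture (v := fun x => v x n) fun x hx => hv x hx n,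
    HasRealDensity.mixture hv', ?_⟩
  filter_upwards [(Finset.eventually_all _).2 ht] with y hy
  exact tendsto_finsetSum _ fun x hx => (hy x hx).const_mul _

theorem klDiv_le_liminf [SigmaFinite μ] {V W : ℕ → ProbabilityMeasure Y}
    {V' W' : ProbabilityMeasure Y} (hV : DensityTendsto μ V V') (hW : DensityTendsto μ W W') :
    klDiv (V' : Measure Y) W' ≤ liminf (fun n => klDiv (V n : Measure Y) (W n)) atTop := by
  obtain ⟨v, v', hv, hv', htv⟩ := hV
  obtain ⟨w, w', hw, hw', htw⟩ := hW
  rw [klDiv_eq_lintegral_klDensity hv' hw']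
  simp_rw [fun n => klDiv_eq_lintegral_klDensity (hv n) (hw n)]
  refine le_trans (lintegral_mono_ae ?_)
    (lintegral_liminf_le fun n => measurable_klDensity (hv n).measurable (hw n).measurable)
  filter_upwards [htv, htw] with y h1 h2
  exact klDensity_le_liminf (fun n => (hv n).nonneg y) (fun n => (hw n).nonneg y) h1 h2

theorem liminf_add_liminf_le (u v : ℕ → ℝ≥0∞) :
    liminf u atTop + liminf v atTop ≤ liminf (fun n => u n + v n) atTop := by
  simp_rw [liminf_eq_iSup_iInf_of_nat]
  rw [ENNReal.iSup_add_iSup_of_monotone]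
  · exact iSup_mono fun n => le_iInf₂ fun i hi => add_le_add (iInf₂_le i hi) (iInf₂_le i hi)
  · exact fun m n h => le_iInf₂ fun i hi => iInf₂_le i (h.trans hi)
  · exact fun m n h => le_iInf₂ fun i hi => iInf₂_le i (h.trans hi)

theorem mul_liminf_le (a : ℝ≥0∞) (v : ℕ → ℝ≥0∞) :
    a * liminf v atTop ≤ liminf (fun n => a * v n) atTop := by
  have := ENNReal.le_liminf_mul (u := fun _ : ℕ => a) (v := v) (f := atTop)
  rw [liminf_const] at this
  exact this

theorem sum_liminf_le (s : Finset X) (u : X → ℕ → ℝ≥0∞) :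
    ∑ x ∈ s, liminf (u x) atTop ≤ liminf (fun n => ∑ x ∈ s, u x n) atTop := by
  classical
  induction s using Finset.induction_on with
  | empty => simp
  | insert x s hx ih =>
    simp_rw [Finset.sum_insert hx]
    exact (add_le_add_right ih _).trans (liminf_add_liminf_le _ _)

theorem condKL_le_liminf [SigmaFinite μ] {P : Convexity.StdSimplex ℝ X}
    {V W : ℕ → X → ProbabilityMeasure Y} {V' W' : X → ProbabilityMeasure Y}
    (hV : ∀ x ∈ P.weights.support, DensityTendsto μ (fun n => V n x) (V' x))
    (hW : ∀ x ∈ P.weights.support, DensityTendsto μ (fun n => W n x) (W' x)) :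
    condKL P V' W' ≤ liminf (fun n => condKL P (V n) (W n)) atTop := by
  refine le_trans ?_ (sum_liminf_le _ _)
  exact Finset.sum_le_sum fun x hx =>
    (mul_le_mul_right (klDiv_le_liminf (hV x hx) (hW x hx)) _).trans (mul_liminf_le _ _)

theorem DensityTendsto.channelSegment [SigmaFinite μ] {V U : X → ProbabilityMeasure Y} {x : X}
    (hV : (V x : Measure Y) ≪ μ) (hU : (U x : Measure Y) ≪ μ) {t : ℕ → ℝ} (h0 : ∀ n, 0 ≤ t n)
    (h1 : ∀ n, t n ≤ 1) (ht : Tendsto t atTop (𝓝 0)) :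
    DensityTendsto μ (fun n => channelSegment (t n) (h0 n) (h1 n) V U x) (V x) := by
  have hv := HasRealDensity.rnDeriv hV
  have hu := HasRealDensity.rnDeriv hU
  refine ⟨fun n y => (1 - t n) * ((V x : Measure Y).rnDeriv μ y).toReal
    + t n * ((U x : Measure Y).rnDeriv μ y).toReal, _, fun n => ?_, hv, ?_⟩
  · have := HasRealDensity.mixture (μ := μ) (P := binaryWeights (t n) (h0 n) (h1 n))
      (V := fun b => cond b (U x) (V x))
      (v := fun b => cond b (fun y => ((U x : Measure Y).rnDeriv μ y).toReal)
        (fun y => ((V x : Measure Y).rnDeriv μ y).toReal))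
      (fun b _ => by cases b <;> assumption)
    convert this using 1
    · rfl
    funext y
    exact (sum_binaryWeights (h0 n) (h1 n) (fun r b => r * (cond b
      (fun y => ((U x : Measure Y).rnDeriv μ y).toReal)
        (fun y => ((V x : Measure Y).rnDeriv μ y).toReal) : Y → ℝ) y) (by simp)).symm
  · refine Eventually.of_forall fun y => ?_
    have h : Tendsto (fun n => (1 - t n) * ((V x : Measure Y).rnDeriv μ y).toReal
        + t n * ((U x : Measure Y).rnDeriv μ y).toReal) atTop
        (𝓝 ((1 - 0) * ((V x : Measure Y).rnDeriv μ y).toReal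
          + 0 * ((U x : Measure Y).rnDeriv μ y).toReal)) :=
      ((ht.const_sub _).mul_const _).add (ht.mul_const _)
    simpa using h

/-- The square roots of the joint densities `P(x) v(x, ·)`, as a vector-valued function. For a
channel it is an element of norm at most one of `L²`, and distances in `L²` are dominated by the
relative entropy. -/
noncomputable def sqrtDensity (P : Convexity.StdSimplex ℝ X) (v : X → Y → ℝ) (y : Y) :
    P.weights.support → ℝ :=
  fun x => √(P.weights x * v x y)

theorem enorm_sq_le_sum {ι : Type*} [Fintype ι] (F : ι → ℝ) :
    ‖F‖ₑ ^ (2 : ℝ) ≤ ∑ i, ENNReal.ofReal (F i ^ 2) := by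
  rw [← ENNReal.ofReal_sum_of_nonneg fun i _ => sq_nonneg _, ← ofReal_norm,
    ENNReal.ofReal_rpow_of_nonneg (norm_nonneg _) (by norm_num)]
  refine ENNReal.ofReal_le_ofReal ?_
  rw [Real.rpow_two]
  refine (Real.le_sqrt (norm_nonneg _) (Finset.sum_nonneg fun i _ => sq_nonneg _)).1 ?_
  refine (pi_norm_le_iff_of_nonneg (Real.sqrt_nonneg _)).2 fun i => ?_
  rw [Real.norm_eq_abs]
  refine Real.abs_le_sqrt ?_
  exact Finset.single_le_sum (f := fun i => F i ^ 2) (fun i _ => sq_nonneg _) (Finset.mem_univ i)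

theorem eLpNorm_two_sq_le {ι : Type*} [Fintype ι] (F : Y → ι → ℝ) :
    eLpNorm F 2 μ ^ (2 : ℝ) ≤ ∫⁻ y, ∑ i, ENNReal.ofReal (F y i ^ 2) ∂μ := by
  have h := eLpNorm_nnreal_pow_eq_lintegral (μ := μ) (f := F) (p := 2) two_ne_zero
  refine (le_of_eq ?_).trans (lintegral_mono fun y => enorm_sq_le_sum (F y))
  simpa using h

theorem lintegral_ofReal_sq (f : Y → ℝ) :
    ∫⁻ y, ENNReal.ofReal (f y ^ 2) ∂μ = eLpNorm f 2 μ ^ (2 : ℝ) := by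
  have h := eLpNorm_nnreal_pow_eq_lintegral (μ := μ) (f := f) (p := 2) two_ne_zero
  refine Eq.trans (lintegral_congr fun y => ?_) h.symm
  rw [← ofReal_norm, ENNReal.ofReal_rpow_of_nonneg (norm_nonneg _) (by norm_num)]
  simp

theorem measurable_sqrtDensity {P : Convexity.StdSimplex ℝ X} {V : X → ProbabilityMeasure Y}
    {v : X → Y → ℝ} (hv : ∀ x ∈ P.weights.support, HasRealDensity μ (V x) (v x)) :
    Measurable (sqrtDensity P v) :=
  measurable_pi_lambda _ fun x => ((hv x x.2).measurable.const_mul _).sqrt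

theorem memLp_sqrtDensity {P : Convexity.StdSimplex ℝ X} {V : X → ProbabilityMeasure Y}
    {v : X → Y → ℝ} (hv : ∀ x ∈ P.weights.support, HasRealDensity μ (V x) (v x)) :
    MemLp (sqrtDensity P v) 2 μ := by
  refine ⟨(measurable_sqrtDensity hv).aestronglyMeasurable, ?_⟩
  have h : eLpNorm (sqrtDensity P v) 2 μ ^ (2 : ℝ) ≤ 1 := by
    refine (eLpNorm_two_sq_le _).trans ?_
    have hm : ∀ x, Measurable fun y => ENNReal.ofReal (sqrtDensity P v y x ^ 2) := fun x =>
      (((measurable_pi_apply x).comp (measurable_sqrtDensity hv)).pow_const 2).ennreal_ofReal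
    rw [lintegral_finsetSum _ fun x _ => hm x, ← sum_ofReal_weights P,
      ← Finset.sum_coe_sort P.weights.support]
    refine Finset.sum_le_sum fun x _ => le_of_eq ?_
    have : ∀ y, ENNReal.ofReal (sqrtDensity P v y x ^ 2)
        = ENNReal.ofReal (P.weights x) * ENNReal.ofReal (v x y) := fun y => by
      rw [sqrtDensity, Real.sq_sqrt (mul_nonneg (P.nonneg x) ((hv x x.2).nonneg y)),
        ENNReal.ofReal_mul (P.nonneg x)]
    simp_rw [this]
    rw [lintegral_const_mul _ (hv x x.2).measurable.ennreal_ofReal, (hv x x.2).lintegral,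
      measure_univ, mul_one]
  by_contra htop
  rw [not_lt, top_le_iff] at htop
  rw [htop] at h
  simp at h

theorem eLpNorm_sqrtDensity_sub_le [SigmaFinite μ] {P : Convexity.StdSimplex ℝ X}
    {V U : X → ProbabilityMeasure Y}
    {v u : X → Y → ℝ} (hv : ∀ x ∈ P.weights.support, HasRealDensity μ (V x) (v x))
    (hu : ∀ x ∈ P.weights.support, HasRealDensity μ (U x) (u x)) :
    eLpNorm (sqrtDensity P v - sqrtDensity P u) 2 μ ≤ condKL P V U ^ (1 / 2 : ℝ) := by
  rw [← ENNReal.rpow_le_rpow_iff (z := 2) (by norm_num), ← ENNReal.rpow_mul]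
  norm_num
  rw [condKL_eq_lintegral hv hu]
  have := eLpNorm_two_sq_le (μ := μ) (sqrtDensity P v - sqrtDensity P u)
  norm_num at this
  refine this.trans (lintegral_mono fun y => ?_)
  rw [← Finset.sum_coe_sort P.weights.support]
  refine Finset.sum_le_sum fun x _ => ?_
  have h0 := P.nonneg x
  rw [sqrtDensity, sqrtDensity, Real.sqrt_mul h0, Real.sqrt_mul h0, ← mul_sub, mul_pow,
    Real.sq_sqrt h0, ENNReal.ofReal_mul h0]
  gcongr
  exact ofReal_sqrt_sub_sqrt_sq_le ((hv x x.2).nonneg y) ((hu x x.2).nonneg y)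

/-- Convergence in relative entropy yields almost everywhere convergence of densities along a
subsequence. -/
theorem exists_densityTendsto_of_condKL_tendsto [SigmaFinite μ] {P : Convexity.StdSimplex ℝ X}
    {V : ℕ → X → ProbabilityMeasure Y} {U : X → ProbabilityMeasure Y}
    (hV : ∀ n, ∀ x ∈ P.weights.support, (V n x : Measure Y) ≪ μ)
    (hU : ∀ x ∈ P.weights.support, (U x : Measure Y) ≪ μ)
    (h : Tendsto (fun n => condKL P (V n) U) atTop (𝓝 0)) :
    ∃ φ : ℕ → ℕ, StrictMono φ ∧
      ∀ x ∈ P.weights.support, DensityTendsto μ (fun n => V (φ n) x) (U x) := by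
  have hv := fun n x hx => HasRealDensity.rnDeriv (hV n x hx)
  have hu := fun x hx => HasRealDensity.rnDeriv (hU x hx)
  have ht : Tendsto (fun n => eLpNorm (sqrtDensity P
        (fun x y => ((V n x : Measure Y).rnDeriv μ y).toReal) - sqrtDensity P
          (fun x y => ((U x : Measure Y).rnDeriv μ y).toReal)) 2 μ) atTop (𝓝 0) := by
    refine tendsto_of_tendsto_of_tendsto_of_le_of_le tendsto_const_nhds ?_ (fun _ => zero_le)
      fun n => eLpNorm_sqrtDensity_sub_le (hv n) hu
    have := (ENNReal.continuous_rpow_const (y := (1 / 2 : ℝ))).tendsto 0 |>.comp h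
    simpa [Function.comp_def] using this
  obtain ⟨φ, hφ, hae⟩ := (tendstoInMeasure_of_tendsto_eLpNorm two_ne_zero
    (fun n => (measurable_sqrtDensity (hv n)).aestronglyMeasurable)
    (measurable_sqrtDensity hu).aestronglyMeasurable ht).exists_seq_tendsto_ae
  refine ⟨φ, hφ, fun x hx => ⟨_, _, fun n => hv (φ n) x hx, hu x hx, ?_⟩⟩
  filter_upwards [hae] with y hy
  have h1 := ((tendsto_pi_nhds.1 hy ⟨x, hx⟩).pow 2).const_mul (P.weights x)⁻¹
  have hp := weights_pos hx
  have e : ∀ r : ℝ, 0 ≤ r → (P.weights x)⁻¹ * √(P.weights x * r) ^ 2 = r := fun r hr => by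
    rw [Real.sq_sqrt (by positivity), inv_mul_cancel_left₀ hp.ne']
  simpa only [sqrtDensity, e _ ENNReal.toReal_nonneg] using h1

/-- Completeness: a sequence of channels any two late members of which are close, in relative
entropy, to a common third channel has a subsequence whose densities converge to those of a
channel. -/
theorem exists_densityTendsto_of_cauchy [SigmaFinite μ] {P : Convexity.StdSimplex ℝ X}
    {V : ℕ → X → ProbabilityMeasure Y}
    (hV : ∀ n, ∀ x ∈ P.weights.support, (V n x : Measure Y) ≪ μ)
    (h : ∀ ε : ℝ≥0∞, 0 < ε → ∃ N, ∀ m ≥ N, ∀ n ≥ N, ∃ M : X → ProbabilityMeasure Y,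
      (∀ x ∈ P.weights.support, (M x : Measure Y) ≪ μ) ∧
        condKL P (V m) M ≤ ε ∧ condKL P (V n) M ≤ ε) :
    ∃ (φ : ℕ → ℕ) (U : X → ProbabilityMeasure Y), StrictMono φ ∧
      ∀ x ∈ P.weights.support, DensityTendsto μ (fun n => V (φ n) x) (U x) := by
  classical
  have hv := fun n x hx => HasRealDensity.rnDeriv (hV n x hx)
  set v : ℕ → X → Y → ℝ := fun n x y => ((V n x : Measure Y).rnDeriv μ y).toReal with hvdef
  set F : ℕ → Lp (P.weights.support → ℝ) 2 μ := fun n => (memLp_sqrtDensity (hv n)).toLp _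
  have hc : CauchySeq F := by
    rw [EMetric.cauchySeq_iff]
    intro ε hε
    obtain ⟨δ, hδ, hδε⟩ : ∃ δ : ℝ≥0∞, 0 < δ ∧ δ ^ (1 / 2 : ℝ) + δ ^ (1 / 2 : ℝ) < ε := by
      have ht : Tendsto (fun δ : ℝ≥0∞ => δ ^ (1 / 2 : ℝ) + δ ^ (1 / 2 : ℝ)) (𝓝[>] 0) (𝓝 0) := by
        have := (ENNReal.continuous_rpow_const (y := (1 / 2 : ℝ))).tendsto 0
        have := this.add this
        simp only [one_div, inv_pos, Nat.ofNat_pos, ENNReal.zero_rpow_of_pos, add_zero] at this ⊢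
        exact this.mono_left nhdsWithin_le_nhds
      obtain ⟨δ, h1, h2⟩ := ((ht.eventually_lt_const hε).and self_mem_nhdsWithin).exists
      exact ⟨δ, h2, h1⟩
    obtain ⟨N, hN⟩ := h δ hδ
    refine ⟨N, fun m hm n hn => lt_of_le_of_lt ?_ hδε⟩
    obtain ⟨M, hM, h1, h2⟩ := hN m hm n hn
    have hM' := fun x hx => HasRealDensity.rnDeriv (hM x hx)
    calc edist (F m) (F n)
        ≤ edist (F m) ((memLp_sqrtDensity hM').toLp _)
          + edist (F n) ((memLp_sqrtDensity hM').toLp _) := edist_triangle_right _ _ _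
      _ ≤ δ ^ (1 / 2 : ℝ) + δ ^ (1 / 2 : ℝ) := by
          rw [Lp.edist_toLp_toLp, Lp.edist_toLp_toLp]
          gcongr
          · exact (eLpNorm_sqrtDensity_sub_le (hv m) hM').trans (by gcongr)
          · exact (eLpNorm_sqrtDensity_sub_le (hv n) hM').trans (by gcongr)
  obtain ⟨G, hG⟩ := cauchySeq_tendsto_of_complete hc
  obtain ⟨φ, hφ, hae⟩ := (tendstoInMeasure_of_tendsto_Lp hG).exists_seq_tendsto_ae
  have hae' : ∀ᵐ y ∂μ, Tendsto (fun n => sqrtDensity P (v (φ n)) y) atTop (𝓝 (G y)) := by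
    filter_upwards [hae, ae_all_iff.2 fun n => (memLp_sqrtDensity (hv (φ n))).coeFn_toLp]
      with y h1 h2
    simpa only [F, h2] using h1
  have hGm : Measurable G := (Lp.stronglyMeasurable G).measurable
  -- the limit of the square roots, squared and divided by the weights, is the limiting density
  set u : X → Y → ℝ := fun x y =>
    if hx : x ∈ P.weights.support then (P.weights x)⁻¹ * G y ⟨x, hx⟩ ^ 2 else 0 with hudef
  have hu : ∀ x (hx : x ∈ P.weights.support), u x = fun y => (P.weights x)⁻¹ * G y ⟨x, hx⟩ ^ 2 :=
    fun x hx => by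
      funext y; simp only [hudef, dif_pos hx]
  have hum : ∀ x ∈ P.weights.support, Measurable (u x) := fun x hx => by
    rw [hu x hx]; exact (((measurable_pi_apply _).comp hGm).pow_const 2).const_mul _
  -- `u x` is a probability density because norms, here the masses, pass to the limit in `L²`
  have hmass : ∀ x ∈ P.weights.support, ∫⁻ y, ENNReal.ofReal (u x y) ∂μ = 1 := by
    intro x hx
    have hp := weights_pos hx
    set c : ℝ≥0∞ := ENNReal.ofReal (P.weights x) ^ (1 / 2 : ℝ)
    set g : Y → ℝ := fun y => G y ⟨x, hx⟩
    set s : ℕ → Y → ℝ := fun n y => sqrtDensity P (v n) y ⟨x, hx⟩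
    have hgm : AEStronglyMeasurable g μ :=
      ((measurable_pi_apply _).comp hGm).aestronglyMeasurable
    have hsm : ∀ n, AEStronglyMeasurable (s n) μ := fun n =>
      ((measurable_pi_apply _).comp (measurable_sqrtDensity (hv n))).aestronglyMeasurable
    have hs : ∀ n, eLpNorm (s n) 2 μ = c := by
      intro n
      have h2 : eLpNorm (s n) 2 μ ^ (2 : ℝ) = ENNReal.ofReal (P.weights x) := by
        rw [← lintegral_ofReal_sq]
        have : ∀ y, ENNReal.ofReal (s n y ^ 2)
            = ENNReal.ofReal (P.weights x) * ENNReal.ofReal (v n x y) := fun y => by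
          simp only [s, sqrtDensity]
          rw [Real.sq_sqrt (mul_nonneg hp.le ((hv n x hx).nonneg y)), ENNReal.ofReal_mul hp.le]
        simp_rw [this]
        rw [lintegral_const_mul _ (hv n x hx).measurable.ennreal_ofReal, (hv n x hx).lintegral,
          measure_univ, mul_one]
      change _ = ENNReal.ofReal (P.weights x) ^ (1 / 2 : ℝ)
      rw [← h2, ← ENNReal.rpow_mul]
      norm_num
    have he : Tendsto (fun n => eLpNorm (s n - g) 2 μ) atTop (𝓝 0) := by
      refine tendsto_of_tendsto_of_tendsto_of_le_of_le tendsto_const_nhds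
        (tendsto_iff_edist_tendsto_0.1 hG) (fun _ => zero_le) fun n => ?_
      rw [Lp.edist_def]
      refine eLpNorm_mono_ae ?_
      filter_upwards [(memLp_sqrtDensity (hv n)).coeFn_toLp] with y hy
      simp only [F, Pi.sub_apply, hy]
      exact norm_le_pi_norm (sqrtDensity P (v n) y - G y) ⟨x, hx⟩
    have hge : c ≤ eLpNorm g 2 μ := by
      have : Tendsto (fun n => eLpNorm (s n - g) 2 μ + eLpNorm g 2 μ) atTop
          (𝓝 (0 + eLpNorm g 2 μ)) := he.add_const _
      rw [zero_add] at this
      refine ge_of_tendsto' this fun n => ?_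
      rw [← hs n]
      simpa using eLpNorm_add_le ((hsm n).sub hgm) hgm one_le_two (f := s n - g) (g := g)
    have hle : eLpNorm g 2 μ ≤ c := by
      have : Tendsto (fun n => c + eLpNorm (s n - g) 2 μ) atTop (𝓝 (c + 0)) := he.const_add _
      rw [add_zero] at this
      refine ge_of_tendsto' this fun n => ?_
      rw [← hs n]
      simpa using eLpNorm_sub_le (hsm n) ((hsm n).sub hgm) one_le_two (f := s n) (g := s n - g)
    have h2 : ∫⁻ y, ENNReal.ofReal (g y ^ 2) ∂μ = ENNReal.ofReal (P.weights x) := by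
      rw [lintegral_ofReal_sq, le_antisymm hle hge, ← ENNReal.rpow_mul]
      norm_num
    have hg2 : Measurable fun y => ENNReal.ofReal (G y ⟨x, hx⟩ ^ 2) :=
      (((measurable_pi_apply _).comp hGm).pow_const 2).ennreal_ofReal
    simp_rw [hu x hx, ENNReal.ofReal_mul (inv_nonneg.2 hp.le)]
    rw [lintegral_const_mul _ hg2]
    change _ * ∫⁻ y, ENNReal.ofReal (g y ^ 2) ∂μ = 1
    rw [h2, ← ENNReal.ofReal_mul (inv_nonneg.2 hp.le), inv_mul_cancel₀ hp.ne', ENNReal.ofReal_one]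
  have hU : ∀ x, ∃ U : ProbabilityMeasure Y, x ∈ P.weights.support →
      (U : Measure Y) = μ.withDensity fun y => ENNReal.ofReal (u x y) := by
    intro x
    by_cases hx : x ∈ P.weights.support
    · refine ⟨⟨μ.withDensity fun y => ENNReal.ofReal (u x y), ⟨?_⟩⟩, fun _ => rfl⟩
      rw [withDensity_apply _ MeasurableSet.univ, Measure.restrict_univ, hmass x hx]
    · exact ⟨V 0 x, fun h => absurd h hx⟩
  choose U hU using hU
  refine ⟨φ, U, hφ, fun x hx => ⟨fun n => v (φ n) x, u x, fun n => hv (φ n) x hx,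
    ⟨hum x hx, fun y => ?_, hU x hx⟩, ?_⟩⟩
  · rw [hu x hx]
    exact mul_nonneg (inv_nonneg.2 (P.nonneg x)) (sq_nonneg _)
  · filter_upwards [hae'] with y hy
    have h1 := ((tendsto_pi_nhds.1 hy ⟨x, hx⟩).pow 2).const_mul (P.weights x)⁻¹
    have hp := weights_pos hx
    have e : ∀ r : ℝ, 0 ≤ r → (P.weights x)⁻¹ * √(P.weights x * r) ^ 2 = r := fun r hr => by
      rw [Real.sq_sqrt (by positivity), inv_mul_cancel_left₀ hp.ne']
    rw [hu x hx]
    simpa only [sqrtDensity, hvdef, e _ ENNReal.toReal_nonneg] using h1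

end Convergence

/-! ### The trade-off functional and its minimizers -/

section Tradeoff

variable {X Y : Type*} [MeasurableSpace Y]

/-- The mutual information of the channel `V` with input distribution `P`. -/
noncomputable def mutualInfo (P : Convexity.StdSimplex ℝ X) (V : X → ProbabilityMeasure Y) :
    ℝ≥0∞ :=
  condKL P V fun _ => mixture P V

/-- The functional `α D(V‖W|P) + (1-α) I(P;V)` of the channel `V`, whose minimum over `V` is
`(1-α) I_α(P;W)`. -/
noncomputable def tradeoff (α : ℝ) (P : Convexity.StdSimplex ℝ X) (W V : X → ProbabilityMeasure Y) :
    ℝ≥0∞ :=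
  ENNReal.ofReal α * condKL P V W + ENNReal.ofReal (1 - α) * mutualInfo P V

/-- `V` minimizes the functional `tradeoff`. -/
def IsTradeoffMin (α : ℝ) (P : Convexity.StdSimplex ℝ X) (W V : X → ProbabilityMeasure Y) : Prop :=
  ∀ U, tradeoff α P W V ≤ tradeoff α P W U

variable {α : ℝ} {P : Convexity.StdSimplex ℝ X} {W V U : X → ProbabilityMeasure Y}

theorem mutualInfo_ne_top : mutualInfo P V ≠ ⊤ := condKL_mixture_ne_top P V

theorem mutualInfo_congr (h : ∀ x ∈ P.weights.support, V x = U x) :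
    mutualInfo P V = mutualInfo P U :=
  condKL_congr h fun _ _ => mixture_congr h

theorem tradeoff_self : tradeoff α P W W = ENNReal.ofReal (1 - α) * mutualInfo P W := by
  rw [tradeoff, condKL_self]; simp

theorem tradeoff_self_ne_top : tradeoff α P W W ≠ ⊤ := by
  rw [tradeoff_self]; exact ENNReal.mul_ne_top ENNReal.ofReal_ne_top mutualInfo_ne_top

theorem condKL_ne_top_of_tradeoff_ne_top (h0 : 0 < α) (h : tradeoff α P W V ≠ ⊤) :
    condKL P V W ≠ ⊤ := fun htop => h <| by
  rw [tradeoff, htop, ENNReal.mul_top (by simpa using h0), top_add]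

theorem tradeoff_ne_top (h : condKL P V W ≠ ⊤) : tradeoff α P W V ≠ ⊤ :=
  ENNReal.add_ne_top.2 ⟨ENNReal.mul_ne_top ENNReal.ofReal_ne_top h,
    ENNReal.mul_ne_top ENNReal.ofReal_ne_top mutualInfo_ne_top⟩

theorem IsTradeoffMin.ne_top (h : IsTradeoffMin α P W V) : tradeoff α P W V ≠ ⊤ :=
  ne_top_of_le_ne_top tradeoff_self_ne_top (h W)

theorem IsTradeoffMin.condKL_ne_top (h0 : 0 < α) (h : IsTradeoffMin α P W V) :
    condKL P V W ≠ ⊤ := condKL_ne_top_of_tradeoff_ne_top h0 h.ne_top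

/-- Every channel at finite divergence from `W` is dominated by the output distribution of `W`. -/
theorem absolutelyContinuous_mixture_of_condKL_ne_top (h : condKL P V W ≠ ⊤) {x : X}
    (hx : x ∈ P.weights.support) : (V x : Measure Y) ≪ mixture P W :=
  (absolutelyContinuous_of_condKL_ne_top h hx).trans (absolutelyContinuous_mixture W hx)

theorem channelSegment_absolutelyContinuous {μ : Measure Y} {t : ℝ} (h0 : 0 ≤ t) (h1 : t ≤ 1)
    {x : X} (hV : (V x : Measure Y) ≪ μ) (hU : (U x : Measure Y) ≪ μ) :
    (channelSegment t h0 h1 V U x : Measure Y) ≪ μ := by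
  rw [coe_channelSegment]
  exact (hV.smul_left _).add_left (hU.smul_left _)

/-- Strong convexity of the functional, measured in relative entropy. -/
theorem tradeoff_segment_le {t : ℝ} (h0 : 0 ≤ t) (h1 : t ≤ 1) :
    tradeoff α P W (channelSegment t h0 h1 V U) + ENNReal.ofReal α *
        (ENNReal.ofReal (1 - t) * condKL P V (channelSegment t h0 h1 V U)
          + ENNReal.ofReal t * condKL P U (channelSegment t h0 h1 V U)) ≤
      ENNReal.ofReal (1 - t) * tradeoff α P W V + ENNReal.ofReal t * tradeoff α P W U := by
  have e1 := condKL_segment h0 h1 P V U W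
  have e2 := condKL_mixture_segment_le h0 h1 P V U
  calc _ = ENNReal.ofReal α * (ENNReal.ofReal (1 - t) * condKL P V (channelSegment t h0 h1 V U)
          + ENNReal.ofReal t * condKL P U (channelSegment t h0 h1 V U)
          + condKL P (channelSegment t h0 h1 V U) W) + ENNReal.ofReal (1 - α)
          * mutualInfo P (channelSegment t h0 h1 V U) := by rw [tradeoff]; ring
    _ ≤ ENNReal.ofReal α * (ENNReal.ofReal (1 - t) * condKL P V W
          + ENNReal.ofReal t * condKL P U W) + ENNReal.ofReal (1 - α) *
          (ENNReal.ofReal (1 - t) * mutualInfo P V + ENNReal.ofReal t * mutualInfo P U) := by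
        rw [← e1]
        gcongr
        exact e2
    _ = _ := by rw [tradeoff, tradeoff]; ring

theorem tradeoff_le_liminf {μ : Measure Y} [SigmaFinite μ] {V : ℕ → X → ProbabilityMeasure Y}
    (hV : ∀ x ∈ P.weights.support, DensityTendsto μ (fun n => V n x) (U x))
    (hW : ∀ x ∈ P.weights.support, (W x : Measure Y) ≪ μ) :
    tradeoff α P W U ≤ liminf (fun n => tradeoff α P W (V n)) atTop := by
  have h1 : condKL P U W ≤ liminf (fun n => condKL P (V n) W) atTop :=
    condKL_le_liminf (W := fun _ => W) hV fun x hx => DensityTendsto.const (hW x hx)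
  have h2 : mutualInfo P U ≤ liminf (fun n => mutualInfo P (V n)) atTop :=
    condKL_le_liminf (W := fun n _ => mixture P (V n)) hV fun _ _ => DensityTendsto.mixture hV
  calc tradeoff α P W U
      ≤ ENNReal.ofReal α * liminf (fun n => condKL P (V n) W) atTop
        + ENNReal.ofReal (1 - α) * liminf (fun n => mutualInfo P (V n)) atTop :=
        add_le_add (mul_le_mul_right h1 _) (mul_le_mul_right h2 _)
    _ ≤ liminf (fun n => ENNReal.ofReal α * condKL P (V n) W) atTop
        + liminf (fun n => ENNReal.ofReal (1 - α) * mutualInfo P (V n)) atTop :=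
        add_le_add (mul_liminf_le _ _) (mul_liminf_le _ _)
    _ ≤ _ := liminf_add_liminf_le _ _

/-- A minimizer exists: by strong convexity the midpoints of a minimizing sequence show that it
satisfies the Cauchy condition of `exists_densityTendsto_of_cauchy`. -/
theorem exists_isTradeoffMin (h0 : 0 < α) (P : Convexity.StdSimplex ℝ X)
    (W : X → ProbabilityMeasure Y) : ∃ V, IsTradeoffMin α P W V := by
  set J := ⨅ U, tradeoff α P W U with hJ
  have hJle : ∀ U, J ≤ tradeoff α P W U := fun U => iInf_le _ U
  have hJtop : J ≠ ⊤ := ne_top_of_le_ne_top tradeoff_self_ne_top (hJle W)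
  have hex : ∀ n : ℕ, ∃ V, tradeoff α P W V < J + ((n : ℝ≥0∞) + 1)⁻¹ := fun n =>
    iInf_lt_iff.1 (ENNReal.lt_add_right hJtop (by simp))
  choose V hV using hex
  have hfin : ∀ n, condKL P (V n) W ≠ ⊤ := fun n =>
    condKL_ne_top_of_tradeoff_ne_top h0 (hV n).ne_top
  have hac : ∀ n, ∀ x ∈ P.weights.support, (V n x : Measure Y) ≪ mixture P W := fun n x hx =>
    absolutelyContinuous_mixture_of_condKL_ne_top (hfin n) hx
  have hlim : Tendsto (fun n : ℕ => ((n : ℝ≥0∞) + 1)⁻¹) atTop (𝓝 0) := by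
    have := ENNReal.tendsto_inv_nat_nhds_zero.comp (tendsto_add_atTop_nat 1)
    simpa [Function.comp_def] using this
  obtain ⟨φ, U, hφ, hU⟩ := exists_densityTendsto_of_cauchy hac <| by
    intro ε hε
    have hδ : 0 < ENNReal.ofReal α * (ENNReal.ofReal (1 / 2) * ε) := by
      have h1 : 0 < ENNReal.ofReal α := by simpa using h0
      have h2 : 0 < ENNReal.ofReal (1 / 2) := by simp
      exact ENNReal.mul_pos h1.ne' (ENNReal.mul_pos h2.ne' hε.ne').ne'
    obtain ⟨N, hN⟩ := eventually_atTop.1 (hlim.eventually_lt_const hδ)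
    refine ⟨N, fun m hm n hn => ⟨channelSegment (1 / 2) (by norm_num) (by norm_num) (V m) (V n),
      fun x hx => channelSegment_absolutelyContinuous _ _ (hac m x hx) (hac n x hx), ?_⟩⟩
    have hseg := tradeoff_segment_le (α := α) (P := P) (W := W) (V := V m) (U := V n)
      (t := 1 / 2) (by norm_num) (by norm_num)
    set M := channelSegment (1 / 2) (by norm_num) (by norm_num) (V m) (V n)
    have hb : ∀ k ≥ N, tradeoff α P W (V k) ≤
        J + ENNReal.ofReal α * (ENNReal.ofReal (1 / 2) * ε) := fun k hk =>
      (hV k).le.trans (add_le_add_right (hN k hk).le _)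
    have hhalf : (1 : ℝ) - 1 / 2 = 1 / 2 := by norm_num
    rw [hhalf] at hseg
    have h2 : ENNReal.ofReal (1 / 2) + ENNReal.ofReal (1 / 2) = 1 := by
      rw [← ENNReal.ofReal_add (by norm_num) (by norm_num)]; norm_num
    have h3 : J + ENNReal.ofReal α * (ENNReal.ofReal (1 / 2) * condKL P (V m) M
        + ENNReal.ofReal (1 / 2) * condKL P (V n) M) ≤
        J + ENNReal.ofReal α * (ENNReal.ofReal (1 / 2) * ε) :=
      calc _ ≤ _ := add_le_add_left (hJle M) _
        _ ≤ _ := hseg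
        _ ≤ ENNReal.ofReal (1 / 2) * (J + ENNReal.ofReal α * (ENNReal.ofReal (1 / 2) * ε))
            + ENNReal.ofReal (1 / 2) * (J + ENNReal.ofReal α * (ENNReal.ofReal (1 / 2) * ε)) := by
            gcongr
            exacts [hb m hm, hb n hn]
        _ = _ := by rw [← add_mul, h2, one_mul]
    have h4 := (ENNReal.add_le_add_iff_left hJtop).1 h3
    have h5 := (ENNReal.mul_le_mul_iff_right (by simpa using h0) ENNReal.ofReal_ne_top).1 h4
    exact ⟨(ENNReal.mul_le_mul_iff_right (by simp) ENNReal.ofReal_ne_top).1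
      (le_self_add.trans h5), (ENNReal.mul_le_mul_iff_right (by simp) ENNReal.ofReal_ne_top).1
      (le_add_self.trans h5)⟩
  refine ⟨U, fun U' => le_trans ?_ (hJle U')⟩
  refine (tradeoff_le_liminf hU fun x hx => absolutelyContinuous_mixture W hx).trans ?_
  have h1 : Tendsto (fun n : ℕ => J + ((φ n : ℝ≥0∞) + 1)⁻¹) atTop (𝓝 (J + 0)) :=
    (hlim.comp hφ.tendsto_atTop).const_add J
  rw [add_zero] at h1
  rw [← h1.liminf_eq]
  exact liminf_le_liminf (Eventually.of_forall fun n => (hV (φ n)).le)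

/-- The functional grows away from a minimizer `V` at least as fast as `α` times the divergence
from `V`. This follows from strong convexity on the segments from `V` by shrinking them to `V`. -/
theorem IsTradeoffMin.add_condKL_le (h0 : 0 < α) (hV : IsTradeoffMin α P W V)
    (U : X → ProbabilityMeasure Y) :
    tradeoff α P W V + ENNReal.ofReal α * condKL P U V ≤ tradeoff α P W U := by
  by_cases hU : tradeoff α P W U = ⊤
  · rw [hU]; exact le_top
  have hacV : ∀ x ∈ P.weights.support, (V x : Measure Y) ≪ mixture P W := fun x hx =>
    absolutelyContinuous_mixture_of_condKL_ne_top (hV.condKL_ne_top h0) hx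
  have hacU : ∀ x ∈ P.weights.support, (U x : Measure Y) ≪ mixture P W := fun x hx =>
    absolutelyContinuous_mixture_of_condKL_ne_top (condKL_ne_top_of_tradeoff_ne_top h0 hU) hx
  set t : ℕ → ℝ := fun n => 1 / ((n : ℝ) + 1) with ht
  have ht0 : ∀ n, 0 < t n := fun n => by simp only [ht]; positivity
  have ht1 : ∀ n, t n ≤ 1 := fun n => by
    simp only [ht]
    rw [div_le_one (by positivity)]
    linarith [(Nat.cast_nonneg n : (0 : ℝ) ≤ n)]
  have hstep : ∀ n, tradeoff α P W V + ENNReal.ofReal α * condKL P U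
      (channelSegment (t n) (ht0 n).le (ht1 n) V U) ≤ tradeoff α P W U := by
    intro n
    have hseg := tradeoff_segment_le (α := α) (P := P) (W := W) (V := V) (U := U)
      (ht0 n).le (ht1 n)
    set S := channelSegment (t n) (ht0 n).le (ht1 n) V U
    have h1 : ENNReal.ofReal (1 - t n) + ENNReal.ofReal (t n) = 1 := by
      rw [← ENNReal.ofReal_add (by linarith [ht1 n]) (ht0 n).le]; simp
    have h2 : ENNReal.ofReal (1 - t n) * tradeoff α P W V + ENNReal.ofReal (t n) *
        (tradeoff α P W V + ENNReal.ofReal α * condKL P U S) ≤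
        ENNReal.ofReal (1 - t n) * tradeoff α P W V + ENNReal.ofReal (t n) * tradeoff α P W U :=
      calc _ = (ENNReal.ofReal (1 - t n) + ENNReal.ofReal (t n)) * tradeoff α P W V
            + ENNReal.ofReal α * (ENNReal.ofReal (t n) * condKL P U S) := by ring
        _ ≤ tradeoff α P W S + ENNReal.ofReal α * (ENNReal.ofReal (1 - t n) * condKL P V S
            + ENNReal.ofReal (t n) * condKL P U S) := by
            rw [h1, one_mul]
            gcongr
            · exact hV S
            · exact le_add_self
        _ ≤ _ := hseg
    have h3 := (ENNReal.add_le_add_iff_left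
      (ENNReal.mul_ne_top ENNReal.ofReal_ne_top hV.ne_top)).1 h2
    exact (ENNReal.mul_le_mul_iff_right (by simpa using ht0 n) ENNReal.ofReal_ne_top).1 h3
  have hlsc : condKL P U V ≤ liminf (fun n => condKL P U
      (channelSegment (t n) (ht0 n).le (ht1 n) V U)) atTop :=
    condKL_le_liminf (V := fun _ => U) (μ := (mixture P W : Measure Y))
      (fun x hx => DensityTendsto.const (hacU x hx))
      fun x hx => DensityTendsto.channelSegment (hacV x hx) (hacU x hx) _ _
        tendsto_one_div_add_atTop_nhds_zero_nat
  calc _ ≤ liminf (fun _ : ℕ => tradeoff α P W V) atTop + liminf (fun n => ENNReal.ofReal α *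
        condKL P U (channelSegment (t n) (ht0 n).le (ht1 n) V U)) atTop := by
        rw [liminf_const]
        gcongr
        exact (mul_le_mul_right hlsc _).trans (mul_liminf_le _ _)
    _ ≤ _ := liminf_add_liminf_le _ _
    _ ≤ liminf (fun _ : ℕ => tradeoff α P W U) atTop :=
        liminf_le_liminf (Eventually.of_forall hstep)
    _ = _ := liminf_const _

theorem IsTradeoffMin.eq_of_tradeoff_le (h0 : 0 < α) (hV : IsTradeoffMin α P W V)
    (h : tradeoff α P W U ≤ tradeoff α P W V) : ∀ x ∈ P.weights.support, U x = V x := by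
  have h1 := (hV.add_condKL_le h0 U).trans h
  have h2 : ENNReal.ofReal α * condKL P U V = 0 := by
    have := (ENNReal.add_le_add_iff_left hV.ne_top).1 (h1.trans_eq (add_zero _).symm)
    exact le_antisymm this zero_le
  refine condKL_eq_zero_iff.1 ((mul_eq_zero.1 h2).resolve_left ?_)
  simpa using h0

end Tradeoff

/-! ### Augustin information and Augustin means -/

section Augustin

open SpherePacking

variable {X Y : Type*} [MeasurableSpace Y] {α β : ℝ} {P : Convexity.StdSimplex ℝ X}
  {W V U : X → ProbabilityMeasure Y} {Q : ProbabilityMeasure Y}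

theorem coe_ennreal_sum {ι : Type*} (s : Finset ι) (F : ι → ℝ≥0∞) :
    ((∑ i ∈ s, F i : ℝ≥0∞) : EReal) = ∑ i ∈ s, (F i : EReal) := by
  classical
  induction s using Finset.induction_on with
  | empty => simp
  | insert i s hi ih => rw [Finset.sum_insert hi, Finset.sum_insert hi, EReal.coe_ennreal_add, ih]

theorem coe_real_sum {ι : Type*} (s : Finset ι) (F : ι → ℝ) :
    ((∑ i ∈ s, F i : ℝ) : EReal) = ∑ i ∈ s, (F i : EReal) := by
  classical
  induction s using Finset.induction_on with
  | empty => simp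
  | insert i s hi ih => rw [Finset.sum_insert hi, Finset.sum_insert hi, EReal.coe_add, ih]

theorem eq_of_klDiv_eq_zero {V U : ProbabilityMeasure Y} (h : klDiv (V : Measure Y) U = 0) :
    V = U := by
  have : (V : Measure Y) = (U : Measure Y) := InformationTheory.klDiv_eq_zero_iff.1 h
  exact Subtype.ext this

theorem condRenyiDiv_one (V W : X → ProbabilityMeasure Y) :
    condRenyiDiv 1 V W P = (condKL P V W : EReal) := by
  rw [condRenyiDiv, condKL, coe_ennreal_sum]
  refine Finset.sum_congr rfl fun x _ => ?_
  rw [renyiDiv, if_pos rfl, EReal.coe_ennreal_mul, EReal.coe_ennreal_ofReal,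
    max_eq_left (show (0 : ℝ) ≤ P.weights x from P.nonneg x)]

theorem augustinInfo_one (P : Convexity.StdSimplex ℝ X) (V : X → ProbabilityMeasure Y) :
    augustinInfo 1 P V = (mutualInfo P V : EReal) := by
  refine le_antisymm (iInf_le_of_le (mixture P V) (condRenyiDiv_one _ _).le) (le_iInf fun Q => ?_)
  rw [condRenyiDiv_one]
  exact EReal.coe_ennreal_le_coe_ennreal_iff.2 (condKL_mixture_le P V Q)

theorem isAugustinMean_one_iff : IsAugustinMean 1 P V Q ↔ Q = mixture P V := by
  rw [IsAugustinMean, condRenyiDiv_one, augustinInfo_one, EReal.coe_ennreal_eq_coe_ennreal_iff,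
    condKL_const_eq]
  constructor
  · intro h
    have h1 : klDiv (mixture P V : Measure Y) Q = 0 :=
      (ENNReal.add_right_inj mutualInfo_ne_top).1 (h.trans (add_zero _).symm)
    exact (eq_of_klDiv_eq_zero h1).symm
  · rintro rfl
    rw [InformationTheory.klDiv_self, add_zero]; rfl

/-- The variational identity for channels; compare `exists_variational`. -/
theorem exists_condKL_variational (h0 : 0 < α) (h1 : α < 1)
    (h : ∀ x ∈ P.weights.support, renyiDiv α (W x) Q ≠ ⊤) :
    ∃ A : ℝ, 0 ≤ A ∧ condRenyiDiv α W (fun _ => Q) P = (((1 - α)⁻¹ * A : ℝ) : EReal) ∧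
      ∀ V : X → ProbabilityMeasure Y,
        ENNReal.ofReal α * condKL P V W + ENNReal.ofReal (1 - α) * condKL P V (fun _ => Q)
          = condKL P V (tiltedChannel α W Q) + ENNReal.ofReal A := by
  choose! A hA0 hA hAV using fun x hx => exists_variational h0 h1 (h x hx)
  have hpA : ∀ x ∈ P.weights.support, 0 ≤ P.weights x * A x := fun x hx =>
    mul_nonneg (P.nonneg x) (hA0 x hx)
  refine ⟨∑ x ∈ P.weights.support, P.weights x * A x, Finset.sum_nonneg hpA, ?_, fun V => ?_⟩
  · rw [condRenyiDiv, Finset.mul_sum, coe_real_sum]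
    refine Finset.sum_congr rfl fun x hx => ?_
    rw [hA x hx, ← EReal.coe_mul]
    congr 1
    ring
  · rw [condKL_add_mul, ENNReal.ofReal_sum_of_nonneg hpA, condKL, ← Finset.sum_add_distrib]
    refine Finset.sum_congr rfl fun x hx => ?_
    rw [hAV x hx, ENNReal.ofReal_mul (P.nonneg x), ← mul_add]
    rfl

theorem renyiDiv_nonneg (h0 : 0 < α) (h1 : α < 1) (W Q : ProbabilityMeasure Y) :
    0 ≤ renyiDiv α W Q := by
  by_cases h : renyiDiv α W Q = ⊤
  · rw [h]; exact le_top
  · obtain ⟨A, hA, e, -⟩ := exists_variational h0 h1 h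
    rw [e]
    have : 0 ≤ (1 - α)⁻¹ * A := mul_nonneg (inv_nonneg.2 (by linarith)) hA
    exact_mod_cast this

theorem condRenyiDiv_eq_top (h0 : 0 < α) (h1 : α < 1) {x : X} (hx : x ∈ P.weights.support)
    (h : renyiDiv α (W x) Q = ⊤) : condRenyiDiv α W (fun _ => Q) P = ⊤ := by
  classical
  rw [condRenyiDiv, ← Finset.add_sum_erase _ _ hx, h,
    EReal.coe_mul_top_of_pos (weights_pos hx)]
  refine EReal.top_add_of_ne_bot fun hbot => ?_
  have : (0 : EReal) ≤ ∑ z ∈ P.weights.support.erase x,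
      ((P.weights z : ℝ) : EReal) * renyiDiv α (W z) Q :=
    Finset.sum_nonneg fun z _ => mul_nonneg (by exact_mod_cast P.nonneg z)
      (renyiDiv_nonneg h0 h1 _ _)
  rw [hbot] at this
  simp at this

theorem renyiDiv_ne_top_of_condKL (h0 : 0 < α) (h1 : α < 1) (hW : condKL P V W ≠ ⊤)
    (hQ : condKL P V (fun _ => Q) ≠ ⊤) :
    ∀ x ∈ P.weights.support, renyiDiv α (W x) Q ≠ ⊤ := fun x hx htop =>
  not_ac_of_renyiDiv_eq_top h0 h1 htop (V x) (absolutelyContinuous_of_condKL_ne_top hW hx)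
    (absolutelyContinuous_of_condKL_ne_top hQ hx)

/-- A minimizer is the tilting of `W` by its own output distribution, and the minimum is determined
by the variational identity for that distribution. -/
theorem IsTradeoffMin.variational (h0 : 0 < α) (h1 : α ≤ 1) (hV : IsTradeoffMin α P W V) :
    (∀ x ∈ P.weights.support, tiltedChannel α W (mixture P V) x = V x) ∧
      ∀ U, ENNReal.ofReal α * condKL P U W
          + ENNReal.ofReal (1 - α) * condKL P U (fun _ => mixture P V)
        = condKL P U V + tradeoff α P W V := by
  rcases h1.eq_or_lt with rfl | h1
  · have hWV : ∀ x ∈ P.weights.support, W x = V x :=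
      hV.eq_of_tradeoff_le h0 (by rw [tradeoff_self]; simp)
    refine ⟨fun x hx => (tiltedMeasure_one _ _).trans (hWV x hx), fun U => ?_⟩
    rw [tradeoff, condKL_congr (fun x _ => rfl) hWV, condKL_congr (V := V) (fun x _ => rfl) hWV,
      condKL_self]
    simp
  · have hfin := renyiDiv_ne_top_of_condKL h0 h1 (hV.condKL_ne_top h0)
      (condKL_mixture_ne_top P V)
    obtain ⟨A, hA, -, hid⟩ := exists_condKL_variational h0 h1 hfin
    set T := tiltedChannel α W (mixture P V)
    have e1 : tradeoff α P W V = condKL P V T + ENNReal.ofReal A := hid V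
    have e2 : tradeoff α P W T ≤ ENNReal.ofReal A := by
      calc tradeoff α P W T ≤ _ := add_le_add_right
            (mul_le_mul_right (condKL_mixture_le P T (mixture P V)) _) _
        _ = _ := hid T
        _ = _ := by rw [condKL_self, zero_add]
    have hT := hV.eq_of_tradeoff_le h0 (e2.trans (e1 ▸ le_add_self))
    refine ⟨hT, fun U => ?_⟩
    rw [e1, condKL_congr (fun x hx => (hT x hx).symm) fun _ _ => rfl, condKL_self, zero_add, hid U,
      condKL_congr (fun x _ => rfl) hT]

theorem IsTradeoffMin.condRenyiDiv_eq (h0 : 0 < α) (h1 : α < 1) (hV : IsTradeoffMin α P W V) :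
    condRenyiDiv α W (fun _ => mixture P V) P
      = (((1 - α)⁻¹ * (tradeoff α P W V).toReal : ℝ) : EReal) := by
  have hfin := renyiDiv_ne_top_of_condKL h0 h1 (hV.condKL_ne_top h0) (condKL_mixture_ne_top P V)
  obtain ⟨A, hA, e, hid⟩ := exists_condKL_variational h0 h1 hfin
  have hT := (hV.variational h0 h1.le).1
  have e1 : tradeoff α P W V = ENNReal.ofReal A := by
    refine (hid V).trans ?_
    rw [condKL_congr (fun x hx => (hT x hx).symm) fun _ _ => rfl, condKL_self, zero_add]
  rw [e, e1, ENNReal.toReal_ofReal hA]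

/-- No output distribution does better than that of a minimizer, and no other one does as well. -/
theorem IsTradeoffMin.le_condRenyiDiv (h0 : 0 < α) (h1 : α < 1) (hV : IsTradeoffMin α P W V)
    (Q : ProbabilityMeasure Y) :
    condRenyiDiv α W (fun _ => mixture P V) P ≤ condRenyiDiv α W (fun _ => Q) P ∧
      (condRenyiDiv α W (fun _ => Q) P = condRenyiDiv α W (fun _ => mixture P V) P →
        Q = mixture P V) := by
  have h1' : 0 < 1 - α := by linarith
  rw [hV.condRenyiDiv_eq h0 h1]
  by_cases hfin : ∀ x ∈ P.weights.support, renyiDiv α (W x) Q ≠ ⊤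
  · obtain ⟨A, hA, e, hid⟩ := exists_condKL_variational h0 h1 hfin
    set T := tiltedChannel α W Q
    have e1 := hid T
    rw [condKL_self, zero_add, condKL_const_eq, mul_add, ← add_assoc] at e1
    have e2 : tradeoff α P W T + ENNReal.ofReal (1 - α) * klDiv (mixture P T : Measure Y) Q
      = ENNReal.ofReal A := e1
    rw [e, EReal.coe_le_coe_iff, EReal.coe_eq_coe_iff]
    have hle : (tradeoff α P W V).toReal ≤ A :=
      ENNReal.toReal_le_of_le_ofReal hA ((hV T).trans (e2 ▸ le_self_add))
    refine ⟨mul_le_mul_of_nonneg_left hle (inv_nonneg.2 h1'.le), fun heq => ?_⟩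
    have hA' : A = (tradeoff α P W V).toReal := mul_left_cancel₀ (inv_pos.2 h1').ne' heq
    rw [hA', ENNReal.ofReal_toReal hV.ne_top] at e2
    have hT := hV.eq_of_tradeoff_le h0 (e2 ▸ le_self_add : tradeoff α P W T ≤ tradeoff α P W V)
    have hz : ENNReal.ofReal (1 - α) * klDiv (mixture P T : Measure Y) Q = 0 := by
      have h3 := (add_le_add_left (hV T) _).trans_eq e2
      exact le_antisymm ((ENNReal.add_le_add_iff_left hV.ne_top).1
        (h3.trans_eq (add_zero _).symm)) zero_le
    have h4 := (mul_eq_zero.1 hz).resolve_left (by simpa using h1)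
    have h5 : mixture P T = Q := eq_of_klDiv_eq_zero h4
    rw [← h5]
    exact mixture_congr hT
  · push Not at hfin
    obtain ⟨x, hx, htop⟩ := hfin
    rw [condRenyiDiv_eq_top h0 h1 hx htop]
    exact ⟨le_top, fun h => absurd h.symm (EReal.coe_ne_top _)⟩

theorem IsTradeoffMin.augustinInfo_eq (h0 : 0 < α) (h1 : α < 1) (hV : IsTradeoffMin α P W V) :
    augustinInfo α P W = (((1 - α)⁻¹ * (tradeoff α P W V).toReal : ℝ) : EReal) := by
  rw [← hV.condRenyiDiv_eq h0 h1]
  exact le_antisymm (iInf_le _ _) (le_iInf fun Q => (hV.le_condRenyiDiv h0 h1 Q).1)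

theorem IsTradeoffMin.isAugustinMean_iff (h0 : 0 < α) (h1 : α ≤ 1) (hV : IsTradeoffMin α P W V) :
    IsAugustinMean α P W Q ↔ Q = mixture P V := by
  rcases h1.eq_or_lt with rfl | h1
  · rw [isAugustinMean_one_iff, mixture_congr (hV.eq_of_tradeoff_le h0
      (by rw [tradeoff_self]; simp : tradeoff 1 P W W ≤ tradeoff 1 P W V))]
  · rw [IsAugustinMean, hV.augustinInfo_eq h0 h1, ← hV.condRenyiDiv_eq h0 h1]
    exact ⟨(hV.le_condRenyiDiv h0 h1 Q).2, fun h => by rw [h]⟩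

theorem IsTradeoffMin.augustinMean_eq (h0 : 0 < α) (h1 : α ≤ 1) (hV : IsTradeoffMin α P W V) :
    augustinMean α P W = mixture P V :=
  (hV.isAugustinMean_iff h0 h1).1 <| @Classical.epsilon_spec _ (IsAugustinMean α P W)
    ⟨_, (hV.isAugustinMean_iff h0 h1).2 rfl⟩

theorem IsTradeoffMin.tiltedChannel_eq (h0 : 0 < α) (h1 : α ≤ 1) (hV : IsTradeoffMin α P W V) :
    ∀ x ∈ P.weights.support, tiltedChannel α W (augustinMean α P W) x = V x := by
  rw [hV.augustinMean_eq h0 h1]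
  exact (hV.variational h0 h1).1

/-- If the same channel is a minimizer at two orders, then it is `W`, and `W` has the smallest
mutual information among all channels at finite divergence from it. -/
theorem IsTradeoffMin.mutualInfo_le_of_two_orders (h0 : 0 < α) (hαβ : α < β) (hβ : β ≤ 1)
    (hVα : IsTradeoffMin α P W V) (hVβ : IsTradeoffMin β P W V) (hU : condKL P U W ≠ ⊤) :
    mutualInfo P W ≤ mutualInfo P U := by
  have h1 : α < 1 := hαβ.trans_le hβ
  have hidα := (hVα.variational h0 h1.le).2
  have hidβ := (hVβ.variational (h0.trans hαβ) hβ).2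
  have hofα : ENNReal.ofReal (1 - α) ≠ 0 := by simpa using h1
  have hWV : condKL P W V ≠ ⊤ := fun htop => tradeoff_self_ne_top (α := α) (P := P) (W := W) <| by
    have := hVα.add_condKL_le h0 W
    rw [htop, ENNReal.mul_top (by simpa using h0), add_top] at this
    exact top_le_iff.1 this
  have hWq : condKL P W (fun _ => mixture P V) ≠ ⊤ := fun htop => by
    have := hidα W
    rw [htop, ENNReal.mul_top hofα, add_top] at this
    exact ENNReal.add_ne_top.2 ⟨hWV, hVα.ne_top⟩ this.symm
  -- comparing the two identities at `V` and at `W` forces `V = W`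
  have hVW : condKL P V W = 0 := by
    have a1 := congrArg ENNReal.toReal (hidα W)
    have a2 := congrArg ENNReal.toReal (hidβ W)
    have a3 := congrArg ENNReal.toReal (hidα V)
    have a4 := congrArg ENNReal.toReal (hidβ V)
    have hVWt := hVα.condKL_ne_top h0
    have hVq := condKL_mixture_ne_top P V
    have ht : ∀ {r : ℝ} {c : ℝ≥0∞}, c ≠ ⊤ → ENNReal.ofReal r * c ≠ ⊤ := fun h =>
      ENNReal.mul_ne_top ENNReal.ofReal_ne_top h
    rw [condKL_self, ENNReal.toReal_add (ht (by simp)) (ht hWq), ENNReal.toReal_add hWV hVα.ne_top,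
      ENNReal.toReal_mul, ENNReal.toReal_mul, ENNReal.toReal_ofReal h0.le,
      ENNReal.toReal_ofReal (by linarith)] at a1
    rw [condKL_self, ENNReal.toReal_add (ht (by simp)) (ht hWq), ENNReal.toReal_add hWV hVβ.ne_top,
      ENNReal.toReal_mul, ENNReal.toReal_mul, ENNReal.toReal_ofReal (h0.trans hαβ).le,
      ENNReal.toReal_ofReal (by linarith)] at a2
    rw [condKL_self, ENNReal.toReal_add (ht hVWt) (ht hVq), zero_add,
      ENNReal.toReal_mul, ENNReal.toReal_mul, ENNReal.toReal_ofReal h0.le,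
      ENNReal.toReal_ofReal (by linarith)] at a3
    rw [condKL_self, ENNReal.toReal_add (ht hVWt) (ht hVq), zero_add,
      ENNReal.toReal_mul, ENNReal.toReal_mul, ENNReal.toReal_ofReal (h0.trans hαβ).le,
      ENNReal.toReal_ofReal (by linarith)] at a4
    rw [← (ENNReal.toReal_eq_zero_iff _).trans (or_iff_left hVWt)]
    have n1 : 0 ≤ (condKL P V W).toReal := ENNReal.toReal_nonneg
    have n2 : 0 ≤ (condKL P W V).toReal := ENNReal.toReal_nonneg
    simp only [ENNReal.toReal_zero, mul_zero, zero_add] at a1 a2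
    set x := (condKL P V W).toReal
    set y := (condKL P V fun _ => mixture P V).toReal
    set z := (condKL P W fun _ => mixture P V).toReal
    set u := (condKL P W V).toReal
    have b1 : (1 - α) * (z - y) = u + α * x := by linarith
    have b2 : (1 - β) * (z - y) = u + β * x := by linarith
    have b3 : 0 ≤ z - y := by
      have : 0 ≤ (1 - α) * (z - y) := by rw [b1]; positivity
      exact nonneg_of_mul_nonneg_right this (by linarith)
    have b4 : (β - α) * x ≤ 0 := by nlinarith
    exact le_antisymm (nonpos_of_mul_nonpos_right b4 (by linarith)) n1
  have hV := condKL_eq_zero_iff.1 hVW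
  have hJ : tradeoff α P W V = ENNReal.ofReal (1 - α) * mutualInfo P W := by
    rw [tradeoff, hVW, mul_zero, zero_add, mutualInfo_congr hV]
  -- hence the divergences from `W` and from its output distribution differ by a constant
  have h2 := hidα U
  rw [condKL_congr (V := U) (W := V) (fun _ _ => rfl) hV, hJ, mixture_congr hV, condKL_const_eq,
    mul_add] at h2
  have h3 := klDiv_mixture_le P U W
  have h4 : ENNReal.ofReal α * condKL P U W + ENNReal.ofReal (1 - α) * condKL P U W
      = condKL P U W := by
    rw [← add_mul, ← ENNReal.ofReal_add h0.le (by linarith)]; simp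
  have h5 : condKL P U W + ENNReal.ofReal (1 - α) * mutualInfo P W ≤
      condKL P U W + ENNReal.ofReal (1 - α) * mutualInfo P U := by
    rw [← h2]
    conv_rhs => rw [← h4]
    calc _ ≤ ENNReal.ofReal α * condKL P U W + (ENNReal.ofReal (1 - α) * mutualInfo P U
          + ENNReal.ofReal (1 - α) * condKL P U W) := by
          gcongr; exact le_rfl
      _ = _ := by ring
  exact (ENNReal.mul_le_mul_iff_right hofα ENNReal.ofReal_ne_top).1
    ((ENNReal.add_le_add_iff_left hU).1 h5)

theorem toReal_tradeoff (h0 : 0 ≤ α) (h1 : α ≤ 1) (h : condKL P V W ≠ ⊤) :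
    (tradeoff α P W V).toReal
      = α * (condKL P V W).toReal + (1 - α) * (mutualInfo P V).toReal := by
  rw [tradeoff, ENNReal.toReal_add (ENNReal.mul_ne_top ENNReal.ofReal_ne_top h)
    (ENNReal.mul_ne_top ENNReal.ofReal_ne_top mutualInfo_ne_top), ENNReal.toReal_mul,
    ENNReal.toReal_mul, ENNReal.toReal_ofReal h0, ENNReal.toReal_ofReal (by linarith)]

theorem IsTradeoffMin.toReal_le (h0 : 0 < α) (h1 : α ≤ 1) (hV : IsTradeoffMin α P W V)
    (hU : condKL P U W ≠ ⊤) :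
    α * (condKL P V W).toReal + (1 - α) * (mutualInfo P V).toReal ≤
      α * (condKL P U W).toReal + (1 - α) * (mutualInfo P U).toReal := by
  rw [← toReal_tradeoff h0.le h1 hU, ← toReal_tradeoff h0.le h1 (hV.condKL_ne_top h0)]
  exact ENNReal.toReal_mono (tradeoff_ne_top hU) (hV U)

theorem IsTradeoffMin.mutualInfo_le (h0 : 0 < α) (h1 : α ≤ 1) (hV : IsTradeoffMin α P W V) :
    mutualInfo P V ≤ mutualInfo P W := by
  rcases h1.eq_or_lt with rfl | h1
  · refine (mutualInfo_congr fun x hx => ?_).le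
    exact (hV.eq_of_tradeoff_le h0 (by rw [tradeoff_self]; simp) x hx).symm
  · have h := hV W
    rw [tradeoff_self, tradeoff] at h
    exact (ENNReal.mul_le_mul_iff_right (by simpa using h1) ENNReal.ofReal_ne_top).1
      (le_add_self.trans h)

/-- Minimizers depend continuously on the order, so that the divergence and the mutual information
of the minimizers are lower semicontinuous functions of the order. -/
theorem IsTradeoffMin.lsc {V : ℕ → X → ProbabilityMeasure Y} {b : ℕ → ℝ} (h0 : 0 < α) (h1 : α ≤ 1)
    (hb : ∀ n, b n ∈ Ioc (0 : ℝ) 1) (hbα : Tendsto b atTop (𝓝 α))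
    (hV : ∀ n, IsTradeoffMin (b n) P W (V n)) (hU : IsTradeoffMin α P W U) :
    (∀ C, (∀ n, condKL P (V n) W ≤ C) → condKL P U W ≤ C) ∧
      ∀ C, (∀ n, mutualInfo P (V n) ≤ C) → mutualInfo P U ≤ C := by
  have hVt : ∀ n, condKL P (V n) W ≠ ⊤ := fun n => (hV n).condKL_ne_top (hb n).1
  have hUt := hU.condKL_ne_top h0
  -- adding optimality of `V n` at order `b n` to the growth bound at `U` bounds the divergence of
  -- `V n` from `U` by a multiple of `|α - b n|`; the constant `K` is uniform once `b n > α / 2`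
  have hD : ∀ n, condKL P (V n) U ≠ ⊤ := fun n htop => tradeoff_ne_top (α := α) (hVt n) <| by
    have := hU.add_condKL_le h0 (V n)
    rw [htop, ENNReal.mul_top (by simpa using h0), add_top] at this
    exact top_le_iff.1 this
  set K : ℝ := (2 / α + 1) * ((condKL P U W).toReal + (mutualInfo P U).toReal)
    + (mutualInfo P W).toReal
  have hbound : ∀ᶠ n in atTop, condKL P (V n) U ≤ ENNReal.ofReal (α⁻¹ * (|α - b n| * K)) := by
    filter_upwards [hbα.eventually_const_lt (half_lt_self h0)] with n hn
    rw [← ENNReal.ofReal_toReal (hD n)]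
    refine ENNReal.ofReal_le_ofReal ?_
    have e1 := (hV n).toReal_le (hb n).1 (hb n).2 hUt
    have e2 := ENNReal.toReal_mono (tradeoff_ne_top (hVt n)) (hU.add_condKL_le h0 (V n))
    rw [ENNReal.toReal_add hU.ne_top (ENNReal.mul_ne_top ENNReal.ofReal_ne_top (hD n)),
      toReal_tradeoff h0.le h1 (hVt n), toReal_tradeoff h0.le h1 hUt, ENNReal.toReal_mul,
      ENNReal.toReal_ofReal h0.le] at e2
    have e3 := ENNReal.toReal_mono mutualInfo_ne_top ((hV n).mutualInfo_le (hb n).1 (hb n).2)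
    have n1 : 0 ≤ (condKL P (V n) W).toReal := ENNReal.toReal_nonneg
    have n2 : 0 ≤ (mutualInfo P (V n)).toReal := ENNReal.toReal_nonneg
    have n3 : 0 ≤ (condKL P U W).toReal := ENNReal.toReal_nonneg
    have n4 : 0 ≤ (mutualInfo P U).toReal := ENNReal.toReal_nonneg
    obtain ⟨b0, b1⟩ := hb n
    set β := b n
    set c := (condKL P (V n) W).toReal
    set d := (mutualInfo P (V n)).toReal
    set c' := (condKL P U W).toReal
    set d' := (mutualInfo P U).toReal
    have e4 : c ≤ 2 / α * (c' + d') := by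
      rw [div_mul_eq_mul_div, le_div_iff₀ h0]
      nlinarith
    have e5 : |c - c' - d + d'| ≤ K := by
      have : K = 2 / α * (c' + d') + (c' + d') + (mutualInfo P W).toReal := by
        simp only [K]; ring
      rw [this, abs_le]
      constructor <;> linarith
    have e6 : α * (condKL P (V n) U).toReal ≤ |α - β| * K :=
      calc _ ≤ (α - β) * (c - c' - d + d') := by linarith
        _ ≤ |(α - β) * (c - c' - d + d')| := le_abs_self _
        _ = |α - β| * |c - c' - d + d'| := abs_mul _ _
        _ ≤ _ := mul_le_mul_of_nonneg_left e5 (abs_nonneg _)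
    rw [← inv_mul_cancel_left₀ h0.ne' (condKL P (V n) U).toReal]
    exact mul_le_mul_of_nonneg_left e6 (inv_nonneg.2 h0.le)
  have hlim : Tendsto (fun n => ENNReal.ofReal (α⁻¹ * (|α - b n| * K))) atTop (𝓝 0) := by
    have h2 : Tendsto (fun n => α⁻¹ * (|α - b n| * K)) atTop (𝓝 (α⁻¹ * (|α - α| * K))) :=
      ((hbα.const_sub α).abs.mul_const K).const_mul _
    have h3 := (ENNReal.continuous_ofReal.tendsto _).comp h2
    simpa [Function.comp_def] using h3
  obtain ⟨φ, -, hφ⟩ := exists_densityTendsto_of_condKL_tendsto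
    (fun n x hx => absolutelyContinuous_mixture_of_condKL_ne_top (hVt n) hx)
    (fun x hx => absolutelyContinuous_mixture_of_condKL_ne_top hUt hx)
    (tendsto_of_tendsto_of_tendsto_of_le_of_le' tendsto_const_nhds hlim
      (Eventually.of_forall fun _ => zero_le) hbound)
  have hliminf : ∀ {F : ℕ → ℝ≥0∞} {C : ℝ≥0∞}, (∀ n, F n ≤ C) →
      liminf (fun n => F (φ n)) atTop ≤ C := fun {F C} h =>
    (liminf_le_liminf (Eventually.of_forall fun n => h (φ n))).trans_eq
      (liminf_const (f := atTop) C)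
  exact ⟨fun C hC => (condKL_le_liminf (W := fun _ => W) hφ fun x hx =>
      DensityTendsto.const (absolutelyContinuous_mixture W hx)).trans (hliminf hC),
    fun C hC => (condKL_le_liminf (W := fun n _ => mixture P (V (φ n))) hφ fun _ _ =>
      DensityTendsto.mixture hφ).trans (hliminf (F := fun n => mutualInfo P (V n)) hC)⟩

end Augustin

/-! ### The curve of optimal pairs -/

section Curve

/-- Two functions `f`, `g` of the order `α ∈ (0,1]` such that `(g α, f α)` minimizes
`α g + (1-α) f` along the curve `(g, f)`, and which are lower semicontinuous. In the application
`f α` and `g α` are the mutual information and the divergence from `W` of the minimizer of order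
`α`, so that the curve is the lower boundary of the achievable pairs. -/
structure OptimalCurve (f g : ℝ → ℝ) : Prop where
  f_nonneg : ∀ α ∈ Ioc (0 : ℝ) 1, 0 ≤ f α
  g_nonneg : ∀ α ∈ Ioc (0 : ℝ) 1, 0 ≤ g α
  g_one : g 1 = 0
  optimal : ∀ α ∈ Ioc (0 : ℝ) 1, ∀ β ∈ Ioc (0 : ℝ) 1,
    α * g α + (1 - α) * f α ≤ α * g β + (1 - α) * f β
  f_lsc : ∀ α ∈ Ioc (0 : ℝ) 1, ∀ b : ℕ → ℝ, (∀ n, b n ∈ Ioc (0 : ℝ) 1) →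
    Tendsto b atTop (𝓝 α) → ∀ C, (∀ n, f (b n) ≤ C) → f α ≤ C
  g_lsc : ∀ α ∈ Ioc (0 : ℝ) 1, ∀ b : ℕ → ℝ, (∀ n, b n ∈ Ioc (0 : ℝ) 1) →
    Tendsto b atTop (𝓝 α) → ∀ C, (∀ n, g (b n) ≤ C) → g α ≤ C

/-- The infimum of the rates on the curve. -/
noncomputable def lowRate (f : ℝ → ℝ) : ℝ := sInf (f '' Ioc 0 1)

/-- The supporting line of slope `-(1-α)/α` of the curve, at rate `R`. -/
noncomputable def supportLine (f g : ℝ → ℝ) (α R : ℝ) : ℝ := g α + (1 - α) / α * (f α - R)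

/-- The upper envelope of the supporting lines. -/
noncomputable def lineEnvelope (f g : ℝ → ℝ) (R : ℝ) : EReal :=
  ⨆ α ∈ Ioo (0 : ℝ) 1, (supportLine f g α R : EReal)

variable {f g : ℝ → ℝ}

theorem one_mem_Ioc : (1 : ℝ) ∈ Ioc (0 : ℝ) 1 := ⟨one_pos, le_rfl⟩

namespace OptimalCurve

theorem monotoneOn (h : OptimalCurve f g) : MonotoneOn f (Ioc 0 1) := by
  intro α hα β hβ hαβ
  rcases hαβ.eq_or_lt with rfl | hlt
  · exact le_rfl
  have h1 := h.optimal α hα β hβ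
  have h2 := h.optimal β hβ α hα
  have h3 := mul_le_mul_of_nonneg_left h1 hβ.1.le
  have h4 := mul_le_mul_of_nonneg_left h2 hα.1.le
  have h5 : (β - α) * f α ≤ (β - α) * f β := by nlinarith
  exact le_of_mul_le_mul_left h5 (by linarith)

theorem antitoneOn (h : OptimalCurve f g) : AntitoneOn g (Ioc 0 1) := by
  intro α hα β hβ hαβ
  have h2 := h.optimal β hβ α hα
  have h3 := h.monotoneOn hα hβ hαβ
  have h4 : β * g β ≤ β * g α := by nlinarith [mul_le_mul_of_nonneg_left h3 (sub_nonneg.2 hβ.2)]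
  exact le_of_mul_le_mul_left h4 hβ.1

theorem bddBelow (h : OptimalCurve f g) : BddBelow (f '' Ioc 0 1) :=
  ⟨0, by rintro _ ⟨α, hα, rfl⟩; exact h.f_nonneg α hα⟩

theorem lowRate_le (h : OptimalCurve f g) {α : ℝ} (hα : α ∈ Ioc (0 : ℝ) 1) : lowRate f ≤ f α :=
  csInf_le h.bddBelow (mem_image_of_mem f hα)

theorem le_lowRate {c : ℝ} (hc : ∀ α ∈ Ioc (0 : ℝ) 1, c ≤ f α) : c ≤ lowRate f :=
  le_csInf ⟨f 1, mem_image_of_mem f one_mem_Ioc⟩ (by rintro _ ⟨α, hα, rfl⟩; exact hc α hα)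

theorem exists_lt {R : ℝ} (hR : lowRate f < R) :
    ∃ α ∈ Ioc (0 : ℝ) 1, f α < R := by
  by_contra! hcon
  exact absurd (le_lowRate hcon) (not_le.2 hR)

theorem eventually_mem_Ioo : ∀ᶠ α : ℝ in 𝓝[>] 0, α ∈ Ioo (0 : ℝ) 1 :=
  Ioo_mem_nhdsGT one_pos

theorem tendsto_f (h : OptimalCurve f g) : Tendsto f (𝓝[>] 0) (𝓝 (lowRate f)) := by
  refine tendsto_order.2 ⟨fun c hc => ?_, fun c hc => ?_⟩
  · filter_upwards [eventually_mem_Ioo] with α hα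
    exact hc.trans_le (h.lowRate_le (Ioo_subset_Ioc_self hα))
  · obtain ⟨β, hβ, hβc⟩ := exists_lt hc
    filter_upwards [Ioo_mem_nhdsGT hβ.1] with α hα
    exact (h.monotoneOn ⟨hα.1, hα.2.le.trans hβ.2⟩ hβ hα.2.le).trans_lt hβc

/-- The normalized minimum values have the same limit as the rates. -/
theorem tendsto_value (h : OptimalCurve f g) :
    Tendsto (fun α => (1 - α)⁻¹ * (α * g α + (1 - α) * f α)) (𝓝[>] 0) (𝓝 (lowRate f)) := by
  refine tendsto_order.2 ⟨fun c hc => ?_, fun c hc => ?_⟩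
  · filter_upwards [eventually_mem_Ioo] with α hα
    have h1 : 0 < 1 - α := by linarith [hα.2]
    have h2 := h.lowRate_le (Ioo_subset_Ioc_self hα)
    have h3 := mul_nonneg hα.1.le (h.g_nonneg α (Ioo_subset_Ioc_self hα))
    rw [inv_mul_eq_div, lt_div_iff₀ h1]
    nlinarith
  · obtain ⟨β, hβ, hβc⟩ := exists_lt hc
    have ht : Tendsto (fun α : ℝ => (1 - α)⁻¹ * (α * g β + (1 - α) * f β)) (𝓝[>] 0)
        (𝓝 ((1 - 0)⁻¹ * (0 * g β + (1 - 0) * f β))) := by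
      have hc : ContinuousAt (fun α : ℝ => (1 - α)⁻¹ * (α * g β + (1 - α) * f β)) 0 := by
        have : (1 : ℝ) - 0 ≠ 0 := by norm_num
        fun_prop (disch := assumption)
      exact hc.tendsto.mono_left nhdsWithin_le_nhds
    simp only [sub_zero, inv_one, zero_mul, one_mul, zero_add] at ht
    filter_upwards [ht.eventually_lt_const hβc, eventually_mem_Ioo] with α h1 hα
    refine lt_of_le_of_lt ?_ h1
    have : 0 ≤ (1 - α)⁻¹ := inv_nonneg.2 (by linarith [hα.2])
    exact mul_le_mul_of_nonneg_left (h.optimal α (Ioo_subset_Ioc_self hα) β hβ) this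

/-- Lower semicontinuity, monotonicity and optimality make the rate a continuous function of the
order. -/
theorem continuousOn (h : OptimalCurve f g) : ContinuousOn f (Ioc 0 1) := by
  -- lower semicontinuity in terms of filters
  have key : ∀ F : ℝ → ℝ, (∀ α ∈ Ioc (0 : ℝ) 1, ∀ b : ℕ → ℝ, (∀ n, b n ∈ Ioc (0 : ℝ) 1) →
      Tendsto b atTop (𝓝 α) → ∀ C, (∀ n, F (b n) ≤ C) → F α ≤ C) →
      ∀ α ∈ Ioc (0 : ℝ) 1, ∀ c < F α, ∀ᶠ β in 𝓝[Ioc 0 1] α, c < F β := by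
    intro F hF α hα c hc
    by_contra hcon
    obtain ⟨b, hb, hbF⟩ := exists_seq_forall_of_frequently (not_eventually.1 hcon
      |>.and_eventually self_mem_nhdsWithin)
    exact absurd (hF α hα b (fun n => (hbF n).2) (tendsto_nhds_of_tendsto_nhdsWithin hb) c
      fun n => not_lt.1 (hbF n).1) (not_le.2 hc)
  intro α hα
  refine tendsto_order.2 ⟨fun c hc => key f h.f_lsc α hα c hc, fun c hc => ?_⟩
  rcases hα.2.eq_or_lt with rfl | h1
  · filter_upwards [self_mem_nhdsWithin] with β hβ
    exact (h.monotoneOn hβ hα hβ.2).trans_lt hc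
  · have h1' : 0 < 1 - α := by linarith
    -- `f β` is controlled by the lower bound on `g β` through optimality at `β` against `α`
    set δ := (c - f α) * (1 - α) / (2 * α) with hδ
    have hδ0 : 0 < δ := div_pos (mul_pos (by linarith) h1') (by linarith [hα.1])
    have hev : ∀ᶠ β : ℝ in 𝓝[Ioc 0 1] α,
        β * δ < (1 - β) * (c - f α) := by
      have ht : ContinuousAt (fun β : ℝ => (1 - β) * (c - f α) - β * δ) α := by fun_prop
      have hpos : 0 < (1 - α) * (c - f α) - α * δ := by
        have : α * δ = (c - f α) * (1 - α) / 2 := by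
          rw [hδ]; field_simp [hα.1.ne']
        rw [this]
        have := mul_pos (sub_pos.2 hc) h1'
        linarith
      filter_upwards [(ht.tendsto.eventually_const_lt hpos).filter_mono nhdsWithin_le_nhds]
        with β hβ
      linarith
    filter_upwards [key g h.g_lsc α hα (g α - δ) (by linarith), hev, self_mem_nhdsWithin]
      with β hg hβ1 hβ
    have h2 := h.optimal β hβ α hα
    have h3 : 0 < 1 - β := by
      rcases hβ.2.eq_or_lt with rfl | h4
      · linarith
      · linarith
    have h4 : (1 - β) * f β < (1 - β) * c := by
      have := mul_lt_mul_of_pos_left hg hβ.1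
      nlinarith
    exact lt_of_mul_lt_mul_left h4 h3.le

end OptimalCurve

end Curve

/-! ### The envelope of the supporting lines -/

section Support

variable {E s : ℝ → ℝ} {D : Set ℝ} {R : ℝ}

/-- A function with a supporting line at each point is differentiable where the slope is
continuous. -/
theorem hasDerivAt_of_support (hD : D ∈ 𝓝 R)
    (hsub : ∀ x ∈ D, ∀ y ∈ D, E x + s x * (y - x) ≤ E y) (hs : ContinuousAt s R) :
    HasDerivAt E (s R) R := by
  rw [hasDerivAt_iff_tendsto_slope, tendsto_iff_norm_sub_tendsto_zero]
  have h0 : Tendsto (fun y => ‖s y - s R‖) (𝓝[≠] R) (𝓝 0) :=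
    (tendsto_iff_norm_sub_tendsto_zero.1 hs.tendsto).mono_left nhdsWithin_le_nhds
  refine squeeze_zero' (Eventually.of_forall fun _ => norm_nonneg _) ?_ h0
  filter_upwards [mem_nhdsWithin_of_mem_nhds hD, self_mem_nhdsWithin] with y hy hne
  have hRD : R ∈ D := mem_of_mem_nhds hD
  have h1 := hsub R hRD y hy
  have h2 := hsub y hy R hRD
  have hyR : y - R ≠ 0 := sub_ne_zero.2 hne
  rw [slope_def_field, Real.norm_eq_abs, Real.norm_eq_abs]
  have e : (E y - E R) / (y - R) - s R = (E y - E R - s R * (y - R)) / (y - R) := by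
    field_simp
  rw [e, abs_div, div_le_iff₀ (abs_pos.2 hyR), ← abs_mul]
  have h3 : 0 ≤ E y - E R - s R * (y - R) := by linarith
  rw [abs_of_nonneg h3]
  exact le_trans (by linarith) (le_abs_self _)

theorem convexOn_of_support (hD : Convex ℝ D)
    (hsub : ∀ x ∈ D, ∀ y ∈ D, E x + s x * (y - x) ≤ E y) : ConvexOn ℝ D E := by
  refine ⟨hD, fun x hx y hy a b ha hb hab => ?_⟩
  have hz := hD hx hy ha hb hab
  simp only [smul_eq_mul] at hz ⊢
  have h1 := mul_le_mul_of_nonneg_left (hsub _ hz x hx) ha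
  have h2 := mul_le_mul_of_nonneg_left (hsub _ hz y hy) hb
  have e : a * (E (a * x + b * y) + s (a * x + b * y) * (x - (a * x + b * y)))
      + b * (E (a * x + b * y) + s (a * x + b * y) * (y - (a * x + b * y)))
      = E (a * x + b * y) := by
    have : b = 1 - a := by linarith
    subst this
    ring
  linarith

end Support

section Envelope

variable {f g : ℝ → ℝ}

namespace OptimalCurve

theorem supportLine_le (h : OptimalCurve f g) {α β R : ℝ} (hα : α ∈ Ioo (0 : ℝ) 1)
    (hβ : β ∈ Ioc (0 : ℝ) 1) :
    supportLine f g α R ≤ g β + (1 - α) / α * (f β - R) := by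
  have h1 := h.optimal α (Ioo_subset_Ioc_self hα) β hβ
  have h0 := hα.1
  have e : ∀ c d : ℝ, c + (1 - α) / α * (d - R) = (α * c + (1 - α) * d) / α - (1 - α) / α * R := by
    intro c d; field_simp; ring
  rw [supportLine, e, e]
  gcongr

theorem supportLine_le_of_le (h : OptimalCurve f g) {α β R : ℝ} (hα : α ∈ Ioo (0 : ℝ) 1)
    (hβ : β ∈ Ioc (0 : ℝ) 1) (hR : f β ≤ R) : supportLine f g α R ≤ g β := by
  refine (h.supportLine_le hα hβ).trans ?_
  have : (1 - α) / α * (f β - R) ≤ 0 :=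
    mul_nonpos_of_nonneg_of_nonpos (div_nonneg (by linarith [hα.2]) hα.1.le) (by linarith)
  linarith

theorem supportLine_le_lineEnvelope {α R : ℝ} (hα : α ∈ Ioo (0 : ℝ) 1) :
    (supportLine f g α R : EReal) ≤ lineEnvelope f g R :=
  le_iSup₂ (f := fun α (_ : α ∈ Ioo (0 : ℝ) 1) => (supportLine f g α R : EReal)) α hα

theorem lineEnvelope_le (h : OptimalCurve f g) {β R : ℝ} (hβ : β ∈ Ioc (0 : ℝ) 1)
    (hR : f β ≤ R) : lineEnvelope f g R ≤ (g β : EReal) :=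
  iSup₂_le fun _ hα => EReal.coe_le_coe_iff.2 (h.supportLine_le_of_le hα hβ hR)

theorem lineEnvelope_nonneg (h : OptimalCurve f g) (R : ℝ) : 0 ≤ lineEnvelope f g R := by
  have ht : Tendsto (fun α : ℝ => (((1 - α) / α * (0 - R) : ℝ) : EReal)) (𝓝[<] 1) (𝓝 0) := by
    have hc : ContinuousAt (fun α : ℝ => (1 - α) / α * (0 - R)) 1 := by
      have : (1 : ℝ) ≠ 0 := one_ne_zero
      fun_prop (disch := assumption)
    have := (continuous_coe_real_ereal.tendsto _).comp hc.tendsto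
    simp only [sub_self, zero_div, zero_mul, EReal.coe_zero] at this
    exact this.mono_left nhdsWithin_le_nhds
  refine le_of_tendsto ht ?_
  filter_upwards [Ioo_mem_nhdsLT (zero_lt_one' ℝ)] with α hα
  refine le_trans (EReal.coe_le_coe_iff.2 ?_) (supportLine_le_lineEnvelope hα)
  have h1 := h.f_nonneg α (Ioo_subset_Ioc_self hα)
  have h2 := h.g_nonneg α (Ioo_subset_Ioc_self hα)
  have h3 : 0 ≤ (1 - α) / α := div_nonneg (by linarith [hα.2]) hα.1.le
  rw [supportLine]
  nlinarith

theorem lineEnvelope_f (h : OptimalCurve f g) {β : ℝ} (hβ : β ∈ Ioc (0 : ℝ) 1) :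
    lineEnvelope f g (f β) = (g β : EReal) := by
  refine le_antisymm (h.lineEnvelope_le hβ le_rfl) ?_
  rcases hβ.2.eq_or_lt with rfl | h1
  · rw [h.g_one]; exact h.lineEnvelope_nonneg _
  · refine le_of_eq_of_le ?_ (supportLine_le_lineEnvelope ⟨hβ.1, h1⟩)
    simp [supportLine]

/-- The upper envelope is finite above the lowest rate. -/
theorem coe_toReal_lineEnvelope (h : OptimalCurve f g) {R : ℝ} (hR : lowRate f < R) :
    ((lineEnvelope f g R).toReal : EReal) = lineEnvelope f g R := by
  obtain ⟨β, hβ, hβR⟩ := exists_lt hR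
  refine EReal.coe_toReal (fun htop => ?_) (fun hbot => ?_)
  · have := h.lineEnvelope_le hβ hβR.le
    rw [htop, top_le_iff] at this
    exact EReal.coe_ne_top _ this
  · have := h.lineEnvelope_nonneg R
    rw [hbot] at this
    simp at this

theorem toReal_lineEnvelope_nonneg (h : OptimalCurve f g) (R : ℝ) :
    0 ≤ (lineEnvelope f g R).toReal := EReal.toReal_nonneg (h.lineEnvelope_nonneg R)

theorem toReal_lineEnvelope_f (h : OptimalCurve f g) {β : ℝ} (hβ : β ∈ Ioc (0 : ℝ) 1) :
    (lineEnvelope f g (f β)).toReal = g β := by rw [h.lineEnvelope_f hβ, EReal.toReal_coe]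

theorem toReal_lineEnvelope_of_ge (h : OptimalCurve f g) {R : ℝ} (hR : f 1 ≤ R) :
    (lineEnvelope f g R).toReal = 0 := by
  have h1 := h.lineEnvelope_le one_mem_Ioc hR
  rw [h.g_one] at h1
  rw [le_antisymm h1 (h.lineEnvelope_nonneg R)]
  rfl

/-- At the lowest rate, the envelope is the limit of the divergences along the curve. -/
theorem tendsto_g (h : OptimalCurve f g) :
    Tendsto (fun α => (g α : EReal)) (𝓝[>] 0) (𝓝 (lineEnvelope f g (lowRate f))) := by
  refine tendsto_order.2 ⟨fun c hc => ?_, fun c hc => ?_⟩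
  · obtain ⟨α, hc⟩ := lt_iSup_iff.1 hc
    obtain ⟨hα, hc⟩ := lt_iSup_iff.1 hc
    induction c with
    | bot => exact Eventually.of_forall fun _ => EReal.bot_lt_coe _
    | top => exact absurd hc (not_lt.2 le_top)
    | coe c =>
      rw [EReal.coe_lt_coe_iff] at hc
      have ht : Tendsto (fun β => (1 - α) / α * (f β - lowRate f)) (𝓝[>] 0) (𝓝 0) := by
        have := (h.tendsto_f.sub_const (lowRate f)).const_mul ((1 - α) / α)
        simpa using this
      filter_upwards [ht.eventually_lt_const (sub_pos.2 hc), eventually_mem_Ioo] with β h1 hβ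
      have h2 := h.supportLine_le (R := lowRate f) hα (Ioo_subset_Ioc_self hβ)
      rw [EReal.coe_lt_coe_iff]
      linarith
  · filter_upwards [eventually_mem_Ioo] with β hβ
    refine lt_of_le_of_lt (le_trans (EReal.coe_le_coe_iff.2 ?_)
      (supportLine_le_lineEnvelope hβ)) hc
    have h1 := h.lowRate_le (Ioo_subset_Ioc_self hβ)
    have h3 : 0 ≤ (1 - β) / β := div_nonneg (by linarith [hβ.2]) hβ.1.le
    rw [supportLine]
    nlinarith [mul_nonneg h3 (sub_nonneg.2 h1)]

end OptimalCurve

/-- The order of a rate: the inverse of `f`, extended by `1` beyond the rate `f 1`. -/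
noncomputable def rateOrder (f : ℝ → ℝ) (R : ℝ) : ℝ := Function.invFunOn f (Ioc 0 1) (min R (f 1))

namespace OptimalCurve

theorem strictMonoOn (h : OptimalCurve f g) (hinj : InjOn f (Ioc 0 1)) :
    StrictMonoOn f (Ioc 0 1) := h.monotoneOn.strictMonoOn_of_injOn hinj

theorem image_eq (h : OptimalCurve f g) (hinj : InjOn f (Ioc 0 1)) :
    f '' Ioc 0 1 = Ioc (lowRate f) (f 1) := by
  have hs := h.strictMonoOn hinj
  refine Subset.antisymm ?_ fun R hR => ?_
  · rintro _ ⟨α, hα, rfl⟩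
    have h2 : α / 2 ∈ Ioc (0 : ℝ) 1 := ⟨half_pos hα.1, (half_le_self hα.1.le).trans hα.2⟩
    exact ⟨(h.lowRate_le h2).trans_lt (hs h2 hα (half_lt_self hα.1)),
      h.monotoneOn hα one_mem_Ioc hα.2⟩
  · obtain ⟨β, hβ, hβR⟩ := exists_lt hR.1
    have hsub : Icc β 1 ⊆ Ioc 0 1 := fun x hx => ⟨hβ.1.trans_le hx.1, hx.2⟩
    obtain ⟨α, hα, e⟩ := intermediate_value_Icc hβ.2 (h.continuousOn.mono hsub) ⟨hβR.le, hR.2⟩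
    exact ⟨α, hsub hα, e⟩

theorem lowRate_lt (h : OptimalCurve f g) (hinj : InjOn f (Ioc 0 1)) : lowRate f < f 1 :=
  ((h.image_eq hinj).subset (mem_image_of_mem f one_mem_Ioc)).1

theorem min_mem_image (h : OptimalCurve f g) (hinj : InjOn f (Ioc 0 1)) {R : ℝ}
    (hR : lowRate f < R) : min R (f 1) ∈ f '' Ioc 0 1 := by
  rw [h.image_eq hinj]
  exact ⟨lt_min hR (h.lowRate_lt hinj), min_le_right _ _⟩

theorem rateOrder_mem (h : OptimalCurve f g) (hinj : InjOn f (Ioc 0 1)) {R : ℝ}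
    (hR : lowRate f < R) : rateOrder f R ∈ Ioc (0 : ℝ) 1 :=
  Function.invFunOn_mem (h.min_mem_image hinj hR)

theorem f_rateOrder (h : OptimalCurve f g) (hinj : InjOn f (Ioc 0 1)) {R : ℝ}
    (hR : lowRate f < R) : f (rateOrder f R) = min R (f 1) :=
  Function.invFunOn_eq (h.min_mem_image hinj hR)

theorem f_rateOrder_of_mem (h : OptimalCurve f g) (hinj : InjOn f (Ioc 0 1)) {R : ℝ}
    (hR : R ∈ Ioc (lowRate f) (f 1)) : f (rateOrder f R) = R := by
  rw [h.f_rateOrder hinj hR.1, min_eq_left hR.2]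

theorem rateOrder_of_ge (h : OptimalCurve f g) (hinj : InjOn f (Ioc 0 1)) {R : ℝ}
    (hR : f 1 ≤ R) : rateOrder f R = 1 := by
  have h1 := (h.lowRate_lt hinj).trans_le hR
  refine hinj (h.rateOrder_mem hinj h1) one_mem_Ioc ?_
  rw [h.f_rateOrder hinj h1, min_eq_right hR]

theorem rateOrder_f (h : OptimalCurve f g) (hinj : InjOn f (Ioc 0 1)) {α : ℝ}
    (hα : α ∈ Ioc (0 : ℝ) 1) : rateOrder f (f α) = α := by
  have h1 := (h.image_eq hinj).subset (mem_image_of_mem f hα)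
  exact hinj (h.rateOrder_mem hinj h1.1) hα (h.f_rateOrder_of_mem hinj h1)

theorem strictMonoOn_rateOrder (h : OptimalCurve f g) (hinj : InjOn f (Ioc 0 1)) :
    StrictMonoOn (rateOrder f) (Ioc (lowRate f) (f 1)) := by
  intro R hR R' hR' hlt
  rw [← (h.strictMonoOn hinj).lt_iff_lt (h.rateOrder_mem hinj hR.1) (h.rateOrder_mem hinj hR'.1),
    h.f_rateOrder_of_mem hinj hR, h.f_rateOrder_of_mem hinj hR']
  exact hlt

theorem bijOn_rateOrder (h : OptimalCurve f g) (hinj : InjOn f (Ioc 0 1)) :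
    BijOn (rateOrder f) (Ioc (lowRate f) (f 1)) (Ioc 0 1) :=
  ⟨fun _ hR => h.rateOrder_mem hinj hR.1, (h.strictMonoOn_rateOrder hinj).injOn, fun α hα =>
    ⟨f α, (h.image_eq hinj).subset (mem_image_of_mem f hα), h.rateOrder_f hinj hα⟩⟩

/-- The order is a continuous function of the rate, as a monotone bijection between intervals. -/
theorem continuousOn_rateOrder (h : OptimalCurve f g) (hinj : InjOn f (Ioc 0 1)) :
    ContinuousOn (rateOrder f) (Ioi (lowRate f)) := by
  have hb := h.bijOn_rateOrder hinj
  have h1 : ContinuousOn (rateOrder f) (Ioc (lowRate f) (f 1)) := by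
    have hm : Monotone (hb.mapsTo.restrict (rateOrder f) _ _) := fun x y hxy =>
      (h.strictMonoOn_rateOrder hinj).monotoneOn x.2 y.2 hxy
    have hs : Function.Surjective (hb.mapsTo.restrict (rateOrder f) _ _) :=
      (MapsTo.restrict_surjective_iff hb.mapsTo).2 hb.surjOn
    exact continuousOn_iff_continuous_domRestrict.2
      (continuous_subtype_val.comp (hm.continuous_of_surjective hs))
  have h2 : MapsTo (fun R => min R (f 1)) (Ioi (lowRate f)) (Ioc (lowRate f) (f 1)) :=
    fun R hR => ⟨lt_min hR (h.lowRate_lt hinj), min_le_right _ _⟩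
  refine (h1.comp (by fun_prop) h2).congr fun R _ => ?_
  simp only [Function.comp_apply, rateOrder, min_assoc, min_self]

/-- The line with slope `-(1-α)/α`, where `α` is the order of the rate `R`, supports the envelope
at `R`. -/
theorem lineEnvelope_support (h : OptimalCurve f g) (hinj : InjOn f (Ioc 0 1)) :
    ∀ R ∈ Ioi (lowRate f), ∀ R' ∈ Ioi (lowRate f),
      (lineEnvelope f g R).toReal + (rateOrder f R - 1) / rateOrder f R * (R' - R) ≤
        (lineEnvelope f g R').toReal := by
  intro R hR R' hR'
  rcases le_or_gt (f 1) R with h1 | h1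
  · rw [h.rateOrder_of_ge hinj h1, h.toReal_lineEnvelope_of_ge h1]
    simpa using h.toReal_lineEnvelope_nonneg R'
  · have hα := h.rateOrder_mem hinj hR
    have e := h.f_rateOrder_of_mem hinj ⟨hR, h1.le⟩
    set α := rateOrder f R
    have hα1 : α < 1 := lt_of_le_of_ne hα.2 fun h2 => by rw [h2] at e; linarith
    have h3 : (lineEnvelope f g R).toReal = g α := by rw [← e, h.toReal_lineEnvelope_f hα]
    have h4 := supportLine_le_lineEnvelope (f := f) (g := g) (R := R') ⟨hα.1, hα1⟩
    rw [← h.coe_toReal_lineEnvelope hR', EReal.coe_le_coe_iff, supportLine, e] at h4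
    rw [h3]
    refine le_of_eq_of_le ?_ h4
    have := hα.1.ne'
    field_simp
    ring

theorem hasDerivAt_lineEnvelope (h : OptimalCurve f g) (hinj : InjOn f (Ioc 0 1)) {R : ℝ}
    (hR : lowRate f < R) :
    HasDerivAt (fun R => (lineEnvelope f g R).toReal) ((rateOrder f R - 1) / rateOrder f R) R := by
  refine hasDerivAt_of_support (Ioi_mem_nhds hR) (h.lineEnvelope_support hinj) ?_
  have hc := (h.continuousOn_rateOrder hinj).continuousAt (Ioi_mem_nhds hR)
  exact (hc.sub continuousAt_const).div hc (h.rateOrder_mem hinj hR).1.ne'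

theorem convexOn_lineEnvelope (h : OptimalCurve f g) (hinj : InjOn f (Ioc 0 1)) :
    ConvexOn ℝ (Ioi (lowRate f)) fun R => (lineEnvelope f g R).toReal :=
  convexOn_of_support (convex_Ioi _) (h.lineEnvelope_support hinj)

theorem contDiffOn_lineEnvelope (h : OptimalCurve f g) (hinj : InjOn f (Ioc 0 1)) :
    ContDiffOn ℝ 1 (fun R => (lineEnvelope f g R).toReal) (Ioi (lowRate f)) := by
  rw [contDiffOn_one_iff_derivWithin isOpen_Ioi.uniqueDiffOn]
  refine ⟨fun R hR => (h.hasDerivAt_lineEnvelope hinj hR).differentiableAt.differentiableWithinAt,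
    ?_⟩
  have hc := h.continuousOn_rateOrder hinj
  have hs : ContinuousOn (fun R => (rateOrder f R - 1) / rateOrder f R) (Ioi (lowRate f)) :=
    (hc.sub continuousOn_const).div hc fun R hR => (h.rateOrder_mem hinj hR).1.ne'
  refine hs.congr fun R hR => ?_
  rw [derivWithin_of_isOpen isOpen_Ioi hR, (h.hasDerivAt_lineEnvelope hinj hR).deriv]

theorem strictAntiOn_lineEnvelope (h : OptimalCurve f g) (hinj : InjOn f (Ioc 0 1)) :
    StrictAntiOn (fun R => (lineEnvelope f g R).toReal) (Ioc (lowRate f) (f 1)) := by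
  have hlt : ∀ R ∈ Ioi (lowRate f), ∀ R' ∈ Ioo (lowRate f) (f 1), R < R' →
      (lineEnvelope f g R').toReal < (lineEnvelope f g R).toReal := by
    intro R hR R' hR' hRR
    have h1 := h.lineEnvelope_support hinj R' hR'.1 R hR
    have hα := h.rateOrder_mem hinj hR'.1
    have e := h.f_rateOrder_of_mem hinj (Ioo_subset_Ioc_self hR')
    have hα1 : rateOrder f R' < 1 :=
      lt_of_le_of_ne hα.2 fun h2 => by rw [h2] at e; linarith [hR'.2]
    have h3 : 0 < (rateOrder f R' - 1) / rateOrder f R' * (R - R') :=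
      mul_pos_of_neg_of_neg (div_neg_of_neg_of_pos (by linarith) hα.1) (by linarith)
    linarith
  intro R hR R' hR' hRR
  have hmid : (R + R') / 2 ∈ Ioo (lowRate f) (f 1) := ⟨by linarith [hR.1], by linarith [hR'.2]⟩
  refine lt_of_le_of_lt ?_ (hlt R hR.1 _ hmid (by linarith))
  -- the slope of the supporting line is nonpositive everywhere
  have h1 := h.lineEnvelope_support hinj R' hR'.1 _ hmid.1
  have hα := h.rateOrder_mem hinj hR'.1
  have h3 : 0 ≤ (rateOrder f R' - 1) / rateOrder f R' * ((R + R') / 2 - R') :=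
    mul_nonneg_of_nonpos_of_nonpos (div_nonpos_of_nonpos_of_nonneg (by linarith [hα.2]) hα.1.le)
      (by linarith)
  linarith

end OptimalCurve

end Envelope

/-! ### The curve of a channel -/

section ChannelCurve

open SpherePacking

variable {X Y : Type*} [MeasurableSpace Y] {P : Convexity.StdSimplex ℝ X}
  {W : X → ProbabilityMeasure Y} {V : ℝ → X → ProbabilityMeasure Y}

/-- The mutual information of the members of a family of channels. -/
noncomputable def infoCurve (P : Convexity.StdSimplex ℝ X) (V : ℝ → X → ProbabilityMeasure Y)
    (α : ℝ) : ℝ :=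
  (mutualInfo P (V α)).toReal

/-- The divergence from `W` of the members of a family of channels. -/
noncomputable def divCurve (P : Convexity.StdSimplex ℝ X) (W : X → ProbabilityMeasure Y)
    (V : ℝ → X → ProbabilityMeasure Y) (α : ℝ) : ℝ :=
  (condKL P (V α) W).toReal

theorem coe_ennreal_toReal_of_ne_top {x : ℝ≥0∞} (hx : x ≠ ⊤) : ((x.toReal : ℝ) : EReal) = x := by
  rw [← EReal.toReal_coe_ennreal]
  exact EReal.coe_toReal (by simpa using hx) (EReal.coe_ennreal_ne_bot x)

theorem coe_infoCurve (P : Convexity.StdSimplex ℝ X) (V : ℝ → X → ProbabilityMeasure Y) (α : ℝ) :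
    (infoCurve P V α : EReal) = mutualInfo P (V α) := coe_ennreal_toReal_of_ne_top mutualInfo_ne_top

theorem coe_divCurve (hV : ∀ α ∈ Ioc (0 : ℝ) 1, IsTradeoffMin α P W (V α)) {α : ℝ}
    (hα : α ∈ Ioc (0 : ℝ) 1) : (divCurve P W V α : EReal) = condKL P (V α) W :=
  coe_ennreal_toReal_of_ne_top ((hV α hα).condKL_ne_top hα.1)

theorem toReal_le_of_forall {F : ℕ → ℝ≥0∞} {a : ℝ≥0∞} {C : ℝ} (hF : ∀ n, F n ≠ ⊤)
    (h : ∀ C, (∀ n, F n ≤ C) → a ≤ C) (hC : ∀ n, (F n).toReal ≤ C) : a.toReal ≤ C := by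
  have hC0 : 0 ≤ C := ENNReal.toReal_nonneg.trans (hC 0)
  refine ENNReal.toReal_le_of_le_ofReal hC0 (h _ fun n => ?_)
  rw [← ENNReal.ofReal_toReal (hF n)]
  exact ENNReal.ofReal_le_ofReal (hC n)

theorem optimalCurve_of_isTradeoffMin (hV : ∀ α ∈ Ioc (0 : ℝ) 1, IsTradeoffMin α P W (V α)) :
    OptimalCurve (infoCurve P V) (divCurve P W V) where
  f_nonneg _ _ := ENNReal.toReal_nonneg
  g_nonneg _ _ := ENNReal.toReal_nonneg
  g_one := by
    have h := (hV 1 one_mem_Ioc).eq_of_tradeoff_le (U := W) one_pos (by rw [tradeoff_self]; simp)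
    rw [divCurve, condKL_eq_zero_iff.2 fun x hx => (h x hx).symm, ENNReal.toReal_zero]
  optimal α hα β hβ := (hV α hα).toReal_le hα.1 hα.2 ((hV β hβ).condKL_ne_top hβ.1)
  f_lsc α hα b hb hbα C hC := toReal_le_of_forall (fun _ => mutualInfo_ne_top)
    (IsTradeoffMin.lsc hα.1 hα.2 hb hbα (fun n => hV _ (hb n)) (hV α hα)).2 hC
  g_lsc α hα b hb hbα C hC := toReal_le_of_forall
    (fun n => (hV _ (hb n)).condKL_ne_top (hb n).1)
    (IsTradeoffMin.lsc hα.1 hα.2 hb hbα (fun n => hV _ (hb n)) (hV α hα)).1 hC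

theorem mutualInfo_one (hV : ∀ α ∈ Ioc (0 : ℝ) 1, IsTradeoffMin α P W (V α)) :
    mutualInfo P (V 1) = mutualInfo P W :=
  (mutualInfo_congr ((hV 1 one_mem_Ioc).eq_of_tradeoff_le (U := W) one_pos
    (by rw [tradeoff_self]; simp))).symm

/-- If two orders had the same rate, they would share a minimizer, and all rates would agree. -/
theorem injOn_infoCurve (hV : ∀ α ∈ Ioc (0 : ℝ) 1, IsTradeoffMin α P W (V α))
    (hlt : lowRate (infoCurve P V) < infoCurve P V 1) : InjOn (infoCurve P V) (Ioc 0 1) := by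
  have h := optimalCurve_of_isTradeoffMin hV
  have key : ∀ α ∈ Ioc (0 : ℝ) 1, ∀ β ∈ Ioc (0 : ℝ) 1, α < β →
      infoCurve P V α ≠ infoCurve P V β := by
    intro α hα β hβ hαβ heq
    have hg : divCurve P W V α = divCurve P W V β := by
      refine le_antisymm ?_ (h.antitoneOn hα hβ hαβ.le)
      have := h.optimal α hα β hβ
      rw [heq] at this
      exact le_of_mul_le_mul_left (by linarith) hα.1
    have hβα : IsTradeoffMin α P W (V β) := by
      have e : tradeoff α P W (V β) = tradeoff α P W (V α) := by
        have h1 := (hV α hα).condKL_ne_top hα.1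
        have h2 := (hV β hβ).condKL_ne_top hβ.1
        rw [← ENNReal.toReal_eq_toReal_iff' (tradeoff_ne_top h2) (tradeoff_ne_top h1),
          toReal_tradeoff hα.1.le hα.2 h1, toReal_tradeoff hα.1.le hα.2 h2]
        change α * divCurve P W V β + (1 - α) * infoCurve P V β
          = α * divCurve P W V α + (1 - α) * infoCurve P V α
        rw [hg, heq]
      intro U
      rw [e]
      exact hV α hα U
    refine absurd hlt (not_lt.2 (OptimalCurve.le_lowRate fun t ht => ?_))
    rw [infoCurve, mutualInfo_one hV]
    exact ENNReal.toReal_mono mutualInfo_ne_top (hβα.mutualInfo_le_of_two_orders hα.1 hαβ hβ.2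
      (hV β hβ) ((hV t ht).condKL_ne_top ht.1))
  intro α hα β hβ heq
  rcases lt_trichotomy α β with hlt | heq' | hlt
  · exact absurd heq (key α hα β hβ hlt)
  · exact heq'
  · exact absurd heq.symm (key β hβ α hα hlt)

theorem augustinInfo_eq_curve (hV : ∀ α ∈ Ioc (0 : ℝ) 1, IsTradeoffMin α P W (V α)) {α : ℝ}
    (hα : α ∈ Ioo (0 : ℝ) 1) : augustinInfo α P W =
      (((1 - α)⁻¹ * (α * divCurve P W V α + (1 - α) * infoCurve P V α) : ℝ) : EReal) := by
  have hα' := Ioo_subset_Ioc_self hα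
  rw [(hV α hα').augustinInfo_eq hα.1 hα.2,
    toReal_tradeoff hα.1.le hα.2.le ((hV α hα').condKL_ne_top hα.1)]
  rfl

theorem tendsto_augustinInfo (hV : ∀ α ∈ Ioc (0 : ℝ) 1, IsTradeoffMin α P W (V α)) :
    Tendsto (fun α => augustinInfo α P W) (𝓝[>] 0) (𝓝 (lowRate (infoCurve P V) : EReal)) := by
  refine ((continuous_coe_real_ereal.tendsto _).comp
    (optimalCurve_of_isTradeoffMin hV).tendsto_value).congr' ?_
  filter_upwards [OptimalCurve.eventually_mem_Ioo] with α hα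
  exact (augustinInfo_eq_curve hV hα).symm

theorem spherePackingExponent_eq (hV : ∀ α ∈ Ioc (0 : ℝ) 1, IsTradeoffMin α P W (V α)) (R : ℝ) :
    spherePackingExponent R W {P} = lineEnvelope (infoCurve P V) (divCurve P W V) R := by
  refine iSup_congr fun α => iSup_congr fun hα => ?_
  have h0 := hα.1.ne'
  have h1 : 1 - α ≠ 0 := by linarith [hα.2]
  rw [augustinCapacity, iSup_singleton, augustinInfo_eq_curve hV hα, ← EReal.coe_sub,
    ← EReal.coe_mul, supportLine]
  congr 1
  field_simp
  ring

/-- The midpoint of two minimizers has rate at most the larger of their rates, hence divergence from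
`W` at least the smaller of their divergences; strong convexity then bounds the distance. -/
theorem exists_near_minimizers (hV : ∀ α ∈ Ioc (0 : ℝ) 1, IsTradeoffMin α P W (V α)) {α β : ℝ}
    (hα : α ∈ Ioc (0 : ℝ) 1) (hβ : β ∈ Ioc (0 : ℝ) 1) (hαβ : α ≤ β) :
    ∃ M : X → ProbabilityMeasure Y,
      (∀ x ∈ P.weights.support, (M x : Measure Y) ≪ mixture P W) ∧
      condKL P (V α) M ≤ ENNReal.ofReal (divCurve P W V α - divCurve P W V β) ∧
      condKL P (V β) M ≤ ENNReal.ofReal (divCurve P W V α - divCurve P W V β) := by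
  have h := optimalCurve_of_isTradeoffMin hV
  have hVα := (hV α hα).condKL_ne_top hα.1
  have hVβ := (hV β hβ).condKL_ne_top hβ.1
  refine ⟨channelSegment (1 / 2) (by norm_num) (by norm_num) (V α) (V β), fun x hx =>
    channelSegment_absolutelyContinuous _ _
      (absolutelyContinuous_mixture_of_condKL_ne_top hVα hx)
      (absolutelyContinuous_mixture_of_condKL_ne_top hVβ hx), ?_⟩
  have h1 := condKL_segment (t := 1 / 2) (by norm_num) (by norm_num) P (V α) (V β) W
  have h2 := condKL_mixture_segment_le (t := 1 / 2) (by norm_num) (by norm_num) P (V α) (V β)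
  set M := channelSegment (1 / 2) (by norm_num) (by norm_num) (V α) (V β)
  have hhalf : (1 : ℝ) - 1 / 2 = 1 / 2 := by norm_num
  rw [hhalf] at h1 h2
  have hlhs : ENNReal.ofReal (1 / 2) * condKL P (V α) W + ENNReal.ofReal (1 / 2) *
      condKL P (V β) W ≠ ⊤ := ENNReal.add_ne_top.2 ⟨ENNReal.mul_ne_top ENNReal.ofReal_ne_top hVα,
    ENNReal.mul_ne_top ENNReal.ofReal_ne_top hVβ⟩
  have hpos : ENNReal.ofReal (1 / 2) ≠ 0 := by simp
  have hrhs := h1 ▸ hlhs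
  obtain ⟨h3, hM⟩ := ENNReal.add_ne_top.1 hrhs
  obtain ⟨h4, h5⟩ := ENNReal.add_ne_top.1 h3
  have hDα : condKL P (V α) M ≠ ⊤ := fun ht => h4 (by rw [ht, ENNReal.mul_top hpos])
  have hDβ : condKL P (V β) M ≠ ⊤ := fun ht => h5 (by rw [ht, ENNReal.mul_top hpos])
  have e1 := congrArg ENNReal.toReal h1
  rw [ENNReal.toReal_add h3 hM, ENNReal.toReal_add h4 h5, ENNReal.toReal_add
    (ENNReal.mul_ne_top ENNReal.ofReal_ne_top hVα) (ENNReal.mul_ne_top ENNReal.ofReal_ne_top hVβ)]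
    at e1
  have e2 := ENNReal.toReal_mono (ENNReal.add_ne_top.2
    ⟨ENNReal.mul_ne_top ENNReal.ofReal_ne_top (mutualInfo_ne_top (P := P) (V := V α)),
      ENNReal.mul_ne_top ENNReal.ofReal_ne_top (mutualInfo_ne_top (P := P) (V := V β))⟩) h2
  rw [ENNReal.toReal_add (ENNReal.mul_ne_top ENNReal.ofReal_ne_top mutualInfo_ne_top)
    (ENNReal.mul_ne_top ENNReal.ofReal_ne_top mutualInfo_ne_top)] at e2
  simp only [ENNReal.toReal_mul, ENNReal.toReal_ofReal (show (0 : ℝ) ≤ 1 / 2 by norm_num)] at e1 e2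
  have e3 := (hV β hβ).toReal_le hβ.1 hβ.2 hM
  have e4 := h.monotoneOn hα hβ hαβ
  have n1 : 0 ≤ (condKL P (V α) M).toReal := ENNReal.toReal_nonneg
  have n2 : 0 ≤ (condKL P (V β) M).toReal := ENNReal.toReal_nonneg
  change 1 / 2 * divCurve P W V α + 1 / 2 * divCurve P W V β = _ at e1
  change (mutualInfo P M).toReal ≤ 1 / 2 * infoCurve P V α + 1 / 2 * infoCurve P V β at e2
  change β * divCurve P W V β + (1 - β) * infoCurve P V β ≤ _ at e3
  have e5 : divCurve P W V β ≤ (condKL P M W).toReal := by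
    have : (1 - β) * (mutualInfo P M).toReal ≤ (1 - β) * infoCurve P V β :=
      mul_le_mul_of_nonneg_left (by linarith) (sub_nonneg.2 hβ.2)
    exact le_of_mul_le_mul_left (by linarith) hβ.1
  rw [← ENNReal.ofReal_toReal hDα, ← ENNReal.ofReal_toReal hDβ]
  exact ⟨ENNReal.ofReal_le_ofReal (by linarith), ENNReal.ofReal_le_ofReal (by linarith)⟩

/-- If the divergences stay bounded as the order decreases to zero, then the minimizers converge to
a channel which attains both limits. -/
theorem exists_limit_channel (hV : ∀ α ∈ Ioc (0 : ℝ) 1, IsTradeoffMin α P W (V α)) {L : ℝ}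
    (hL : Tendsto (divCurve P W V) (𝓝[>] 0) (𝓝 L)) :
    ∃ U : X → ProbabilityMeasure Y,
      (mutualInfo P U : EReal) = (lowRate (infoCurve P V) : EReal) ∧
        (condKL P U W : EReal) = (L : EReal) := by
  have h := optimalCurve_of_isTradeoffMin hV
  set b : ℕ → ℝ := fun n => 1 / ((n : ℝ) + 1) with hb
  have hb1 : ∀ n, b n ∈ Ioc (0 : ℝ) 1 := fun n => by
    refine ⟨by simp only [hb]; positivity, ?_⟩
    simp only [hb]
    rw [div_le_one (by positivity)]
    linarith [(Nat.cast_nonneg n : (0 : ℝ) ≤ n)]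
  have hb0 : Tendsto b atTop (𝓝[>] 0) := tendsto_nhdsWithin_iff.2
    ⟨tendsto_one_div_add_atTop_nhds_zero_nat, Eventually.of_forall fun n => (hb1 n).1⟩
  have hfin : ∀ n, condKL P (V (b n)) W ≠ ⊤ := fun n => (hV _ (hb1 n)).condKL_ne_top (hb1 n).1
  have hLb := hL.comp hb0
  have hLge : ∀ α ∈ Ioc (0 : ℝ) 1, divCurve P W V α ≤ L := fun α hα => by
    refine ge_of_tendsto hL ?_
    filter_upwards [Ioo_mem_nhdsGT hα.1] with β hβ
    exact h.antitoneOn ⟨hβ.1, hβ.2.le.trans hα.2⟩ hα hβ.2.le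
  have hL0 : 0 ≤ L := (h.g_nonneg 1 one_mem_Ioc).trans (hLge 1 one_mem_Ioc)
  obtain ⟨φ, U, hφ, hU⟩ := exists_densityTendsto_of_cauchy
    (fun n x hx => absolutelyContinuous_mixture_of_condKL_ne_top (hfin n) hx) <| by
    intro ε hε
    have hz : Tendsto (fun n => ENNReal.ofReal (L - divCurve P W V (b n))) atTop (𝓝 0) := by
      have := (ENNReal.continuous_ofReal.tendsto _).comp (hLb.const_sub L)
      simpa [Function.comp_def] using this
    obtain ⟨N, hN⟩ := eventually_atTop.1 (hz.eventually_lt_const hε)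
    have hbd : ∀ m, ∀ n ≥ N, ENNReal.ofReal (divCurve P W V (b m) - divCurve P W V (b n)) ≤ ε :=
      fun m n hn => (ENNReal.ofReal_le_ofReal (sub_le_sub_right (hLge _ (hb1 m)) _)).trans
        (hN n hn).le
    refine ⟨N, fun m hm n hn => ?_⟩
    rcases le_total (b m) (b n) with hmn | hmn
    · obtain ⟨M, h1, h2, h3⟩ := exists_near_minimizers hV (hb1 m) (hb1 n) hmn
      exact ⟨M, h1, h2.trans (hbd m n hn), h3.trans (hbd m n hn)⟩
    · obtain ⟨M, h1, h2, h3⟩ := exists_near_minimizers hV (hb1 n) (hb1 m) hmn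
      exact ⟨M, h1, h3.trans (hbd n m hm), h2.trans (hbd n m hm)⟩
  have hUW : condKL P U W ≤ ENNReal.ofReal L := by
    refine (condKL_le_liminf (W := fun _ => W) hU fun x hx =>
      DensityTendsto.const (absolutelyContinuous_mixture W hx)).trans ?_
    refine (liminf_le_liminf (Eventually.of_forall fun n => ?_)).trans_eq
      (liminf_const (f := atTop) (ENNReal.ofReal L))
    rw [← ENNReal.ofReal_toReal (hfin (φ n))]
    exact ENNReal.ofReal_le_ofReal (hLge _ (hb1 _))
  have hUt : condKL P U W ≠ ⊤ := ne_top_of_le_ne_top ENNReal.ofReal_ne_top hUW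
  have hlow : 0 ≤ lowRate (infoCurve P V) := OptimalCurve.le_lowRate h.f_nonneg
  have hUI : mutualInfo P U ≤ ENNReal.ofReal (lowRate (infoCurve P V)) := by
    have ht := (ENNReal.continuous_ofReal.tendsto _).comp
      ((h.tendsto_f.comp hb0).comp hφ.tendsto_atTop)
    rw [← ht.liminf_eq]
    refine (condKL_le_liminf (W := fun n _ => mixture P (V (b (φ n)))) hU fun _ _ =>
      DensityTendsto.mixture hU).trans (liminf_le_liminf (Eventually.of_forall fun n => ?_))
    exact (ENNReal.ofReal_toReal (mutualInfo_ne_top (P := P) (V := V (b (φ n))))).ge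
  have hUI' : (mutualInfo P U).toReal ≤ lowRate (infoCurve P V) :=
    ENNReal.toReal_le_of_le_ofReal hlow hUI
  have hopt := fun α (hα : α ∈ Ioc (0 : ℝ) 1) => (hV α hα).toReal_le hα.1 hα.2 hUt
  have hg : ∀ α ∈ Ioc (0 : ℝ) 1, divCurve P W V α ≤ (condKL P U W).toReal := fun α hα => by
    have h1 : α * divCurve P W V α + (1 - α) * infoCurve P V α ≤ _ := hopt α hα
    have h2 : (1 - α) * (mutualInfo P U).toReal ≤ (1 - α) * infoCurve P V α :=
      mul_le_mul_of_nonneg_left (hUI'.trans (h.lowRate_le hα)) (sub_nonneg.2 hα.2)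
    exact le_of_mul_le_mul_left (by linarith) hα.1
  refine ⟨U, ?_, ?_⟩
  · rw [← coe_ennreal_toReal_of_ne_top mutualInfo_ne_top, EReal.coe_eq_coe_iff]
    refine le_antisymm hUI' ?_
    -- the rate of any channel at finite divergence is at least the limit of the minimum values
    have hc : ContinuousAt (fun α : ℝ => (1 - α)⁻¹ * (α * (condKL P U W).toReal
        + (1 - α) * (mutualInfo P U).toReal)) 0 := by
      have : (1 : ℝ) - 0 ≠ 0 := by norm_num
      fun_prop (disch := assumption)
    have hc' := hc.tendsto.mono_left (nhdsWithin_le_nhds (s := Ioi (0 : ℝ)))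
    simp only [sub_zero, inv_one, zero_mul, one_mul, zero_add] at hc'
    refine le_of_tendsto_of_tendsto h.tendsto_value hc' ?_
    filter_upwards [OptimalCurve.eventually_mem_Ioo] with α hα
    exact mul_le_mul_of_nonneg_left (hopt α (Ioo_subset_Ioc_self hα))
      (inv_nonneg.2 (by linarith [hα.2]))
  · rw [← coe_ennreal_toReal_of_ne_top hUt, EReal.coe_eq_coe_iff]
    refine le_antisymm (ENNReal.toReal_le_of_le_ofReal hL0 hUW) (le_of_tendsto hL ?_)
    filter_upwards [OptimalCurve.eventually_mem_Ioo] with α hα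
    exact hg α (Ioo_subset_Ioc_self hα)

end ChannelCurve

/-! ### The sphere packing exponent below capacity -/

theorem lemma2 {X : Type*} {Y : Type*} [MeasurableSpace Y]
    (W : X → ProbabilityMeasure Y) (P : Convexity.StdSimplex ℝ X)
    (hne : SpherePacking.augustinInfoZero P W ≠ SpherePacking.augustinInfo 1 P W) :
    -- the Augustin means of orders in `(0,1]` exist and are unique
    (∀ α ∈ Ioc (0 : ℝ) 1,
      SpherePacking.IsAugustinMean α P W (SpherePacking.augustinMean α P W) ∧
      ∀ Q, SpherePacking.IsAugustinMean α P W Q → Q = SpherePacking.augustinMean α P W) ∧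
    -- `R₀ = I_{0+}(P;W)`, the limit exists, and `R₁ = I_1(P;W)`; both are finite
    ∃ R₀ R₁ : ℝ,
      SpherePacking.augustinInfoZero P W = (R₀ : EReal) ∧
      Tendsto (fun α => SpherePacking.augustinInfo α P W) (𝓝[>] 0) (𝓝 (R₀ : EReal)) ∧
      SpherePacking.augustinInfo 1 P W = (R₁ : EReal) ∧
      0 ≤ R₀ ∧ R₀ < R₁ ∧
      -- every rate in `(R₀, R₁]` determines its order
      (∀ R ∈ Ioc R₀ R₁, ∃! α : ℝ, α ∈ Ioc (0 : ℝ) 1 ∧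
        (R : EReal) = SpherePacking.augustinInfo 1 P
          (SpherePacking.tiltedChannel α W (SpherePacking.augustinMean α P W))) ∧
      -- `a` is the order as a function of the rate, `E` the exponent as a real-valued function
      (∃ a E : ℝ → ℝ,
        (∀ R ∈ Ioc R₀ R₁, a R ∈ Ioc (0 : ℝ) 1 ∧
          (R : EReal) = SpherePacking.augustinInfo 1 P
            (SpherePacking.tiltedChannel (a R) W (SpherePacking.augustinMean (a R) P W))) ∧
        StrictMonoOn a (Ioc R₀ R₁) ∧
        ContinuousOn a (Ioc R₀ R₁) ∧
        BijOn a (Ioc R₀ R₁) (Ioc (0 : ℝ) 1) ∧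
        (∀ R, R₀ < R → SpherePacking.spherePackingExponent R W {P} = (E R : EReal)) ∧
        (∀ R ∈ Ioc R₀ R₁,
          SpherePacking.spherePackingExponent R W {P} =
            SpherePacking.condRenyiDiv 1
              (SpherePacking.tiltedChannel (a R) W (SpherePacking.augustinMean (a R) P W)) W P) ∧
        (∀ R ∈ Ioc R₀ R₁, HasDerivAt E ((a R - 1) / a R) R) ∧
        ConvexOn ℝ (Ioc R₀ R₁) E ∧
        ContDiffOn ℝ 1 E (Ioc R₀ R₁) ∧
        StrictAntiOn E (Ioc R₀ R₁)) ∧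
      -- the limiting case
      Tendsto (fun α => SpherePacking.condRenyiDiv 1
          (SpherePacking.tiltedChannel α W (SpherePacking.augustinMean α P W)) W P)
        (𝓝[>] 0) (𝓝 (SpherePacking.spherePackingExponent R₀ W {P})) ∧
      (SpherePacking.spherePackingExponent R₀ W {P} ≠ ⊤ →
        ∃ V : X → ProbabilityMeasure Y,
          SpherePacking.augustinInfo 1 P V = SpherePacking.augustinInfoZero P W ∧
          SpherePacking.condRenyiDiv 1 V W P =
            SpherePacking.spherePackingExponent R₀ W {P}) := by
  have : Nonempty (X → ProbabilityMeasure Y) := ⟨W⟩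
  choose! V hV using fun (α : ℝ) (hα : α ∈ Ioc (0 : ℝ) 1) => exists_isTradeoffMin hα.1 P W
  have h := optimalCurve_of_isTradeoffMin hV
  set f := infoCurve P V with hf
  set g := divCurve P W V with hg
  have hlim := tendsto_augustinInfo hV
  have hzero : SpherePacking.augustinInfoZero P W = (lowRate f : EReal) := hlim.limUnder_eq
  have hone : SpherePacking.augustinInfo 1 P W = (f 1 : EReal) := by
    rw [augustinInfo_one, hf, coe_infoCurve, mutualInfo_one hV]
  have hlt : lowRate f < f 1 := by
    refine lt_of_le_of_ne (h.lowRate_le one_mem_Ioc) fun heq => hne ?_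
    rw [hzero, hone, heq]
  have hinj := injOn_infoCurve hV hlt
  have hrate : ∀ α ∈ Ioc (0 : ℝ) 1, SpherePacking.augustinInfo 1 P
      (SpherePacking.tiltedChannel α W (SpherePacking.augustinMean α P W)) = (f α : EReal) := by
    intro α hα
    rw [augustinInfo_one, hf, coe_infoCurve,
      mutualInfo_congr ((hV α hα).tiltedChannel_eq hα.1 hα.2)]
  have hdiv : ∀ α ∈ Ioc (0 : ℝ) 1, SpherePacking.condRenyiDiv 1
      (SpherePacking.tiltedChannel α W (SpherePacking.augustinMean α P W)) W P
        = (g α : EReal) := by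
    intro α hα
    rw [condRenyiDiv_one, hg, coe_divCurve hV hα,
      condKL_congr ((hV α hα).tiltedChannel_eq hα.1 hα.2) fun _ _ => rfl]
  have hE : ∀ R, SpherePacking.spherePackingExponent R W {P} = lineEnvelope f g R :=
    spherePackingExponent_eq hV
  have hord : ∀ R ∈ Ioc (lowRate f) (f 1), rateOrder f R ∈ Ioc (0 : ℝ) 1 ∧
      (R : EReal) = SpherePacking.augustinInfo 1 P (SpherePacking.tiltedChannel (rateOrder f R) W
        (SpherePacking.augustinMean (rateOrder f R) P W)) := fun R hR => by
    have hα := h.rateOrder_mem hinj hR.1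
    exact ⟨hα, by rw [hrate _ hα, h.f_rateOrder_of_mem hinj hR]⟩
  have hsub : Ioc (lowRate f) (f 1) ⊆ Ioi (lowRate f) := fun R hR => hR.1
  -- the real-valued exponent is `toReal` of the envelope, which is finite above `lowRate f`
  refine ⟨fun α hα => ⟨?_, fun Q hQ => ?_⟩, lowRate f, f 1, hzero, hlim, hone,
    OptimalCurve.le_lowRate h.f_nonneg, hlt, fun R hR => ?_,
    ⟨rateOrder f, fun R => (lineEnvelope f g R).toReal, hord, h.strictMonoOn_rateOrder hinj,
      (h.continuousOn_rateOrder hinj).mono hsub, h.bijOn_rateOrder hinj, fun R hR => ?_,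
      fun R hR => ?_, fun R hR => h.hasDerivAt_lineEnvelope hinj hR.1,
      (h.convexOn_lineEnvelope hinj).subset hsub (convex_Ioc _ _),
      (h.contDiffOn_lineEnvelope hinj).mono hsub, h.strictAntiOn_lineEnvelope hinj⟩, ?_, ?_⟩
  · rw [(hV α hα).isAugustinMean_iff hα.1 hα.2]
    exact (hV α hα).augustinMean_eq hα.1 hα.2
  · rw [(hV α hα).augustinMean_eq hα.1 hα.2]
    exact ((hV α hα).isAugustinMean_iff hα.1 hα.2).1 hQ
  · refine ⟨rateOrder f R, hord R hR, fun β hβ => ?_⟩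
    have hβR := hβ.2
    rw [hrate β hβ.1, EReal.coe_eq_coe_iff] at hβR
    rw [hβR, h.rateOrder_f hinj hβ.1]
  · rw [hE, h.coe_toReal_lineEnvelope hR]
  · have hα := h.rateOrder_mem hinj hR.1
    rw [hE, hdiv _ hα, ← h.lineEnvelope_f hα, h.f_rateOrder_of_mem hinj hR]
  · rw [hE]
    refine h.tendsto_g.congr' ?_
    filter_upwards [OptimalCurve.eventually_mem_Ioo] with α hα
    exact (hdiv α (Ioo_subset_Ioc_self hα)).symm
  · intro htop
    rw [hE] at htop ⊢
    have hbot : lineEnvelope f g (lowRate f) ≠ ⊥ := fun hbot => by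
      have := h.lineEnvelope_nonneg (lowRate f)
      rw [hbot] at this
      simp at this
    have hL := h.tendsto_g
    rw [← EReal.coe_toReal htop hbot] at hL ⊢
    obtain ⟨U, hU1, hU2⟩ := exists_limit_channel hV (EReal.tendsto_coe.1 hL)
    exact ⟨U, by rw [augustinInfo_one, hU1, hzero], by rw [condRenyiDiv_one, hU2]⟩
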